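/- **Definitions.** For a set $X$, let $\mathfrak S^\star(X)$ be the group of bijections between cofinite subsets of $X$, two of them being identified when they coincide on a cofinite set (more generally one has near bijections from $X$ to $Y$). A *near action* of a group $G$ on $X$ is a homomorphism $\alpha:G\to\mathfrak S^\star(X)$; $X$ is then a *near $G$-set*. It is *$\star$-faithful* if $\alpha$ is injective, and *near free* if every $g\neq 1$ fixes only finitely many points of $X$. It is *1-ended* if $X$ is infinite and every $A\subseteq X$ such that, for each $g\in G$, $gx\in A$ for all but finitely many $x\in A$, is finite or cofinite. Near $G$-sets $X,Y$ are *near isomorphic* if there is a near bijection $\phi$ from $X$ to $Y$ with $\phi\circ\alpha_X(g)=\alpha_Y(g)\circ\phi$ for all $g$. $X$ is *realizable* if $\alpha$ lifts to an action of $G$ on $X$, and *completable* if $X\sqcup Y$ is realizable for some near $G$-set $Y$. A *near automorphism* of $X$ is an element of $\mathfrak S^\star(X)$ commuting with $\alpha(G)$. Let $X$ be a near $\mathbf Z^2$-set. A *graded near corner* in $X$ is a subset $P\subseteq X$ with an injective map $f:P\to\mathbf Z^2$ (a grading) whose image is, up to a finite symmetric difference, a translate of one of the four quadrants, and such that for $e\in\{\pm(1,0),\pm(0,1)\}$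 and all but finitely many $x\in P$ with $f(x)+e\in f(P)$ we have $ex\in P$ and $f(ex)=f(x)+e$. For $m\ge 1$ and $s\in\mathbf Z^2$, we say that $X$ has *winding number* $m$ and *additive holonomy* $s$ if, up to finite sets, $X$ is partitioned into $4m$ graded near corners $(P_j,f_j)$, $0\le j<4m$, of type upper right, upper left, lower left, lower right according to $j$ modulo $4$, such that, with $P_{4m}=P_0$, $f_{4m}=f_0+s$, and $e_j=(-1,0),(0,-1),(1,0),(0,1)$ according to $j$ modulo $4$, for every $j<4m$ and all but finitely many $x\in P_j$ with $f_j(x)+e_j\notin f_j(P_j)$, we have $e_jx\in P_{j+1}$ and $f_{j+1}(e_jx)=f_j(x)+e_j$. For $m\ge1$ and $s=(s_1,s_2)\in\mathbf Z^2$, the near $\mathbf Z^2$-set $X_{m,s}$ is the following. Take upper halves $U_k=\mathbf Z\times\mathbf Z_{\ge0}$ and lower halves $L_k$ ($0\le k<m$), where $L_k=\mathbf Z\times\mathbf Z_{<0}$ for $k<m-1$ and $L_{m-1}=(\mathbf Z_{<0}\times\mathbf Z_{<0})\cup(\mathbf Z_{\ge0}\times\mathbf Z_{<s_2})$. The generators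 $(1,0)$ and $(0,1)$ act by one step to the right and one step up within each half, and in addition one step up maps: $(x,-1)\in L_k$ to $(x,0)\in U_k$ for $x<0$; $(x,-1)\in L_k$ to $(x,0)\in U_{k+1}$ for $x\ge0$ and $k<m-1$; and $(x,s_2-1)\in L_{m-1}$ to $(x-s_1,0)\in U_0$ for $x\ge0$, $x-s_1\ge0$. **Theorem.** 1. A 1-ended near $\mathbf Z^2$-set is near free if and only if it is $\star$-faithful. 2. Every near free 1-ended near $\mathbf Z^2$-set has exactly one pair $(m,s)$, $m\ge1$, $s\in\mathbf Z^2$, of winding number and additive holonomy, and two near free 1-ended near $\mathbf Z^2$-sets are near isomorphic if and only if they have the same pair $(m,s)$. 3. For all $m\ge1$ and $s\in\mathbf Z^2$, $X_{m,s}$ is a $\star$-faithful, near free, 1-ended near $\mathbf Z^2$-set with winding number $m$ and additive holonomy $s$. Every near free 1-ended near $\mathbf Z^2$-set is near isomorphic to $X_{m,s}$ for exactly one pair $(m,s)$; in particular the $X_{m,s}$ are pairwise not near isomorphic. 4. $X_{1,0}$ is near isomorphic to the simply transitive action of $\mathbf Z^2$ on itself, and $X_{m,s}$ is completable if and only if $(m,s)=(1,0)$.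 5. For $m\ge1$ and $s\in\mathbf Z^2$, the group $A_{m,s}$ of near automorphisms of $X_{m,s}$ is abelian and contains the image of $\mathbf Z^2$ as a subgroup of index $m$. There is an isomorphism from $A_{m,s}$ onto $\mathbf Z^3/\langle(s_1,s_2,-m)\rangle$ (that is, onto the abelian group $\langle u,v,z: z^m=u^{s_1}v^{s_2}\rangle$) that maps the near action of $(a,b)\in\mathbf Z^2$ to the class of $(a,b,0)$. In particular $A_{m,s}\simeq\mathbf Z^2\times(\mathbf Z/\gcd(s_1,s_2,m)\mathbf Z)$; it is torsion-free if and only if no prime divisor of $m$ divides $s$, and it is isomorphic to $\mathbf Z^2\times(\mathbf Z/m\mathbf Z)$ if and only if $m$ divides $s$. -/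

import Mathlib

universe u v w

namespace NearActions

/-! ### Near bijections and the near symmetric group -/

/-- A cofinite-partial bijection: a bijection from a cofinite subset of `X` onto a cofinite
subset of `Y`, encoded as a partial injection with cofinite domain and cofinite range. -/
structure CofPBij (X : Type u) (Y : Type v) where
  toPEquiv : X ≃. Y
  finite_dom : {x | toPEquiv x = none}.Finite
  finite_ran : {y | toPEquiv.symm y = none}.Finite

namespace CofPBij

variable {X : Type u} {Y : Type v} {Z : Type w}

def refl (X : Type u) : CofPBij X X where
  toPEquiv := PEquiv.refl X
  finite_dom := by simp
  finite_ran := by simp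

def symm (f : CofPBij X Y) : CofPBij Y X where
  toPEquiv := f.toPEquiv.symm
  finite_dom := f.finite_ran
  finite_ran := f.finite_dom

theorem finite_preimage (f : X ≃. Y) {D : Set Y} (hD : D.Finite) :
    {x | ∃ y ∈ D, f x = some y}.Finite := by
  have h : {x | ∃ y ∈ D, f x = some y} ⊆ ⋃ y ∈ D, {x | f.symm y = some x} := by
    rintro x ⟨y, hy, hxy⟩
    simp only [Set.mem_iUnion]
    exact ⟨y, hy, f.eq_some_iff.2 hxy⟩
  refine (hD.biUnion fun y _ => ?_).subset h
  refine Set.Subsingleton.finite ?_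
  intro a ha b hb
  simp only [Set.mem_ofPred_eq] at ha hb
  rw [ha] at hb
  exact Option.some.inj hb

theorem finite_trans_none (f : X ≃. Y) (g : Y ≃. Z) (hf : {x | f x = none}.Finite)
    (hg : {y | g y = none}.Finite) : {x | f.trans g x = none}.Finite := by
  refine (hf.union (finite_preimage f hg)).subset ?_
  intro x hx
  rcases hfx : f x with _ | y
  · exact Or.inl hfx
  · refine Or.inr ⟨y, ?_, hfx⟩
    rcases hgy : g y with _ | z
    · exact hgy
    · exact absurd ((PEquiv.trans_eq_some f g x z).2 ⟨y, hfx, hgy⟩)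
        (by rw [Set.mem_ofPred_eq] at hx; simp [hx])

/-- Composition, in diagrammatic order: first `f`, then `g`. -/
def trans (f : CofPBij X Y) (g : CofPBij Y Z) : CofPBij X Z where
  toPEquiv := f.toPEquiv.trans g.toPEquiv
  finite_dom := finite_trans_none _ _ f.finite_dom g.finite_dom
  finite_ran := by
    rw [PEquiv.symm_trans_rev]
    exact finite_trans_none _ _ g.finite_ran f.finite_ran

/-- Two cofinite-partial bijections are near equal if they coincide outside a finite set. -/
def NearEq (f g : CofPBij X Y) : Prop := {x | f.toPEquiv x ≠ g.toPEquiv x}.Finite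

theorem NearEq.refl (f : CofPBij X Y) : NearEq f f := by simp [NearEq]

theorem NearEq.symm {f g : CofPBij X Y} (h : NearEq f g) : NearEq g f := by
  refine Set.Finite.subset h ?_
  intro x hx
  exact Ne.symm hx

theorem NearEq.trans {f g h : CofPBij X Y} (h₁ : NearEq f g) (h₂ : NearEq g h) :
    NearEq f h := by
  refine (Set.Finite.union h₁ h₂).subset ?_
  intro x hx
  by_contra hc
  simp only [Set.mem_union, Set.mem_ofPred_eq, not_or, not_not] at hc
  exact hx (hc.1.trans hc.2)

theorem NearEq.inv {f g : CofPBij X Y} (h : NearEq f g) : NearEq f.symm g.symm := by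
  have h1 := finite_preimage f.toPEquiv.symm h
  have h2 := finite_preimage g.toPEquiv.symm h
  refine (h1.union h2).subset ?_
  intro y hy
  change f.toPEquiv.symm y ≠ g.toPEquiv.symm y at hy
  rcases hf : f.toPEquiv.symm y with _ | x
  · rcases hg : g.toPEquiv.symm y with _ | x
    · exact absurd (hf.trans hg.symm) hy
    · refine Or.inr ⟨x, ?_, hg⟩
      intro hc
      have := g.toPEquiv.eq_some_iff.1 hg
      rw [← hc] at this
      rw [f.toPEquiv.eq_some_iff.2 this] at hf
      cases hf
  · refine Or.inl ⟨x, ?_, hf⟩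
    intro hc
    have := f.toPEquiv.eq_some_iff.1 hf
    rw [hc] at this
    exact hy (hf.trans (g.toPEquiv.eq_some_iff.2 this).symm)

theorem NearEq.comp {f f' : CofPBij X Y} {g g' : CofPBij Y Z} (hf : NearEq f f')
    (hg : NearEq g g') : NearEq (f.trans g) (f'.trans g') := by
  refine (Set.Finite.union hf (finite_preimage f.toPEquiv hg)).subset ?_
  intro x hx
  by_cases hfx : f.toPEquiv x = f'.toPEquiv x
  · rcases h : f.toPEquiv x with _ | y
    · exfalso
      apply hx
      have h' := hfx.symm.trans h
      change (f.toPEquiv x).bind g.toPEquiv = (f'.toPEquiv x).bind g'.toPEquiv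
      rw [h, h']
      rfl
    · refine Or.inr ⟨y, ?_, h⟩
      intro hc
      apply hx
      have h' := hfx.symm.trans h
      change (f.toPEquiv x).bind g.toPEquiv = (f'.toPEquiv x).bind g'.toPEquiv
      rw [h, h']
      exact hc
  · exact Or.inl hfx

instance setoid (X : Type u) (Y : Type v) : Setoid (CofPBij X Y) where
  r := NearEq
  iseqv := ⟨NearEq.refl, NearEq.symm, NearEq.trans⟩

/-- A bijection, seen as a cofinite-partial bijection. -/
def ofEquiv (e : X ≃ Y) : CofPBij X Y where
  toPEquiv := e.toPEquiv
  finite_dom := by simp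
  finite_ran := by simp [← Equiv.toPEquiv_symm]

/-- The disjoint union of two partial injections. -/
def sumPEquiv {X' : Type u} {Y' : Type v} (f : X ≃. X') (g : Y ≃. Y') : X ⊕ Y ≃. X' ⊕ Y' where
  toFun := Sum.elim (fun x => (f x).map Sum.inl) (fun y => (g y).map Sum.inr)
  invFun := Sum.elim (fun x => (f.symm x).map Sum.inl) (fun y => (g.symm y).map Sum.inr)
  inv := by
    rintro (a | a) (b | b)
    · simpa using f.mem_iff_mem
    · simp
    · simp
    · simpa using g.mem_iff_mem

theorem finite_sum_none {X' : Type u} {Y' : Type v} (f : X ≃. X') (g : Y ≃. Y')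
    (hf : {x | f x = none}.Finite) (hg : {x | g x = none}.Finite) :
    {x | sumPEquiv f g x = none}.Finite := by
  refine ((hf.image Sum.inl).union (hg.image Sum.inr)).subset ?_
  rintro (x | x) hx
  · refine Or.inl ⟨x, ?_, rfl⟩
    change Option.map _ (f x) = none at hx
    simpa using hx
  · refine Or.inr ⟨x, ?_, rfl⟩
    change Option.map _ (g x) = none at hx
    simpa using hx

/-- The disjoint union of two cofinite-partial bijections. -/
def sum (f : CofPBij X X) (g : CofPBij Y Y) : CofPBij (X ⊕ Y) (X ⊕ Y) where
  toPEquiv := sumPEquiv f.toPEquiv g.toPEquiv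
  finite_dom := finite_sum_none _ _ f.finite_dom g.finite_dom
  finite_ran := finite_sum_none f.toPEquiv.symm g.toPEquiv.symm f.finite_ran g.finite_ran

theorem NearEq.sum {f f' : CofPBij X X} {g g' : CofPBij Y Y} (hf : NearEq f f')
    (hg : NearEq g g') : NearEq (f.sum g) (f'.sum g') := by
  refine ((Set.Finite.image Sum.inl hf).union (Set.Finite.image Sum.inr hg)).subset ?_
  rintro (x | x) hx
  · refine Or.inl ⟨x, ?_, rfl⟩
    intro hc
    apply hx
    change Option.map _ (f.toPEquiv x) = Option.map _ (f'.toPEquiv x)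
    rw [hc]
  · refine Or.inr ⟨x, ?_, rfl⟩
    intro hc
    apply hx
    change Option.map _ (g.toPEquiv x) = Option.map _ (g'.toPEquiv x)
    rw [hc]

end CofPBij

/-- Near bijections from `X` to `Y`: cofinite-partial bijections modulo near equality. -/
def NearBij (X : Type u) (Y : Type v) : Type (max u v) := Quotient (CofPBij.setoid X Y)

/-- The near symmetric group of `X`. -/
abbrev NearPerm (X : Type u) : Type u := NearBij X X

namespace NearBij

variable {X : Type u} {Y : Type v} {Z : Type w}

/-- The near bijection represented by a cofinite-partial bijection. -/
def mk (f : CofPBij X Y) : NearBij X Y := Quotient.mk _ f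

/-- Composition of near bijections, in diagrammatic order. -/
def trans (f : NearBij X Y) (g : NearBij Y Z) : NearBij X Z :=
  Quotient.map₂ CofPBij.trans (fun _ _ hf _ _ hg => CofPBij.NearEq.comp hf hg) f g

def symm (f : NearBij X Y) : NearBij Y X :=
  Quotient.map CofPBij.symm (fun _ _ hf => CofPBij.NearEq.inv hf) f

/-- The near permutation `f ⊔ g` of `X ⊔ Y`. -/
def sum (f : NearPerm X) (g : NearPerm Y) : NearPerm (X ⊕ Y) :=
  Quotient.map₂ CofPBij.sum (fun _ _ hf _ _ hg => CofPBij.NearEq.sum hf hg) f g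

end NearBij

/-- The group law is `a * b = a ∘ b`. -/
instance NearPerm.group (X : Type u) : Group (NearPerm X) where
  mul a b := NearBij.trans b a
  one := NearBij.mk (CofPBij.refl X)
  inv a := NearBij.symm a
  mul_assoc a b c := by
    induction a using Quotient.inductionOn
    induction b using Quotient.inductionOn
    induction c using Quotient.inductionOn
    refine congrArg NearBij.mk ?_
    simp only [CofPBij.trans, PEquiv.trans_assoc]
  one_mul a := by
    induction a using Quotient.inductionOn
    refine congrArg NearBij.mk ?_
    simp only [CofPBij.trans, CofPBij.refl, PEquiv.trans_refl]
  mul_one a := by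
    induction a using Quotient.inductionOn
    refine congrArg NearBij.mk ?_
    simp only [CofPBij.trans, CofPBij.refl, PEquiv.refl_trans]
  inv_mul_cancel a := by
    induction a using Quotient.inductionOn with
    | h f =>
      refine Quotient.sound (Set.Finite.subset f.finite_dom ?_)
      intro x hx
      by_contra hc
      obtain ⟨y, hy⟩ := Option.ne_none_iff_exists'.1 hc
      apply hx
      change (f.toPEquiv x).bind f.toPEquiv.symm = some x
      rw [hy]
      exact f.toPEquiv.eq_some_iff.2 hy

/-- The canonical homomorphism from the symmetric group to the near symmetric group. -/
def NearPerm.ofPerm (X : Type u) : Equiv.Perm X →* NearPerm X where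
  toFun e := NearBij.mk (CofPBij.ofEquiv e)
  map_one' := rfl
  map_mul' a b := by
    refine congrArg NearBij.mk ?_
    simp only [CofPBij.ofEquiv, CofPBij.trans, ← Equiv.toPEquiv_trans]
    rfl

/-! ### Near actions -/

/-- A near action of the group `G` on the set `X`; it makes `X` a near `G`-set. -/
abbrev NearAction (G : Type w) [Group G] (X : Type u) := G →* NearPerm X

section

variable {G : Type w} [Group G] {X : Type u} {Y : Type v}

def StarFaithful (α : NearAction G X) : Prop := Function.Injective α

/-- Every `g ≠ 1` has finitely many fixed points (for any representative of `α g`). -/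
def NearFree (α : NearAction G X) : Prop :=
  ∀ g : G, g ≠ 1 → ∀ f : CofPBij X X, NearBij.mk f = α g → {x | f.toPEquiv x = some x}.Finite

/-- For each `g`, one has `g x ∈ A` for all but finitely many `x ∈ A`. -/
def Commensurated (α : NearAction G X) (A : Set X) : Prop :=
  ∀ g : G, ∀ f : CofPBij X X, NearBij.mk f = α g →
    {x | x ∈ A ∧ ¬ ∃ y ∈ A, f.toPEquiv x = some y}.Finite

def OneEnded (α : NearAction G X) : Prop :=
  Infinite X ∧ ∀ A : Set X, Commensurated α A → A.Finite ∨ Aᶜ.Finite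

/-- There is a near bijection `φ` from `X` to `Y` with `φ ∘ α g = β g ∘ φ` for all `g`. -/
def NearIsomorphic (α : NearAction G X) (β : NearAction G Y) : Prop :=
  ∃ φ : NearBij X Y, ∀ g : G, (α g).trans φ = φ.trans (β g)

/-- The near action is induced by an action. -/
def Realizable (α : NearAction G X) : Prop :=
  ∃ ρ : G →* Equiv.Perm X, α = (NearPerm.ofPerm X).comp ρ

/-- The disjoint union of two near `G`-sets. -/
def NearAction.sum (α : NearAction G X) (β : NearAction G Y) : NearAction G (X ⊕ Y) where
  toFun g := NearBij.sum (α g) (β g)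
  map_one' := by
    rw [map_one, map_one]
    refine congrArg NearBij.mk ?_
    simp only [CofPBij.sum, CofPBij.refl, CofPBij.mk.injEq]
    ext (x | x) <;> simp [CofPBij.sumPEquiv]
  map_mul' g h := by
    rw [map_mul, map_mul]
    induction α g using Quotient.inductionOn with | h a =>
    induction α h using Quotient.inductionOn with | h b =>
    induction β g using Quotient.inductionOn with | h c =>
    induction β h using Quotient.inductionOn with | h d =>
    refine congrArg NearBij.mk ?_
    simp only [CofPBij.sum, CofPBij.trans, CofPBij.mk.injEq]
    refine PEquiv.ext ?_
    rintro (x | x)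
    · change Option.map _ ((b.toPEquiv x).bind a.toPEquiv) =
        (Option.map _ (b.toPEquiv x)).bind _
      rcases b.toPEquiv x with _ | y <;> rfl
    · change Option.map _ ((d.toPEquiv x).bind c.toPEquiv) =
        (Option.map _ (d.toPEquiv x)).bind _
      rcases d.toPEquiv x with _ | y <;> rfl

/-- The near `G`-set `X` is completable: `X ⊔ Y` is realizable for some near `G`-set `Y`. -/
def Completable (α : NearAction G X) : Prop :=
  ∃ (Y : Type v) (β : NearAction G Y), Realizable (α.sum β)

/-- The group of near automorphisms of a near `G`-set: the near permutations of `X` that commute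
with the near action. -/
def nearAut (α : NearAction G X) : Subgroup (NearPerm X) :=
  Subgroup.centralizer (Set.range α)

end

/-! ### Winding number and additive holonomy of near `ℤ²`-sets -/

/-- The group `ℤ²`, written multiplicatively. -/
abbrev Z2 := Multiplicative (ℤ × ℤ)

/-- The corner of type `j` with apex `c`: upper right, upper left, lower left, lower right
according to `j` modulo `4`. -/
def corner (j : ℕ) (c : ℤ × ℤ) : Set (ℤ × ℤ) :=
  match j % 4 with
  | 0 => {p | c.1 ≤ p.1 ∧ c.2 ≤ p.2}
  | 1 => {p | p.1 ≤ c.1 ∧ c.2 ≤ p.2}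
  | 2 => {p | p.1 ≤ c.1 ∧ p.2 ≤ c.2}
  | _ => {p | c.1 ≤ p.1 ∧ p.2 ≤ c.2}

/-- The unit vector by which one leaves a corner of type `j` through its left boundary (as seen
from the apex of the corner), thus entering a corner of type `j + 1`. -/
def exitVec (j : ℕ) : ℤ × ℤ :=
  match j % 4 with
  | 0 => (-1, 0)
  | 1 => (0, -1)
  | 2 => (1, 0)
  | _ => (0, 1)

/-- `(P, f)` is a graded near corner of type `j` in the near `ℤ²`-set `X`: `f` is injective on
`P`, its image is a corner of type `j` up to finite symmetric difference, and `f` intertwines the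
near action of the unit vectors with translations, up to finitely many exceptions. -/
def IsGradedCorner {X : Type u} (α : NearAction Z2 X) (j : ℕ) (P : Set X) (f : X → ℤ × ℤ) :
    Prop :=
  Set.InjOn f P ∧
  (∃ c : ℤ × ℤ, (symmDiff (f '' P) (corner j c)).Finite) ∧
  ∀ e : ℤ × ℤ, e = (1, 0) ∨ e = (-1, 0) ∨ e = (0, 1) ∨ e = (0, -1) →
    ∀ φ : CofPBij X X, NearBij.mk φ = α (Multiplicative.ofAdd e) →
      {x | x ∈ P ∧ f x + e ∈ f '' P ∧
        ¬ ∃ y ∈ P, φ.toPEquiv x = some y ∧ f y = f x + e}.Finite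

/-- `(P, f)` is followed by `(Q, g)` in direction `e`: for all but finitely many points `x` of the
boundary of `P` in direction `e`, the point `e x` belongs to `Q`, and its degree for the grading
`g` is the one that continues the grading `f`. -/
def GradedAdjacent {X : Type u} (α : NearAction Z2 X) (e : ℤ × ℤ) (P : Set X) (f : X → ℤ × ℤ)
    (Q : Set X) (g : X → ℤ × ℤ) : Prop :=
  ∀ φ : CofPBij X X, NearBij.mk φ = α (Multiplicative.ofAdd e) →
    {x | x ∈ P ∧ f x + e ∉ f '' P ∧
      ¬ ∃ y ∈ Q, φ.toPEquiv x = some y ∧ g y = f x + e}.Finite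

/-- The near `ℤ²`-set `X` has winding number `m` and additive holonomy `s`: up to finite sets, `X`
is partitioned into `4 * m ≥ 4` near corners `P 0, …, P (4 * m - 1)`, starting with an upper right
one and turning counterclockwise, each adjacent to the next one and the last one adjacent to
`P (4 * m) = P 0`; and if one starts with a grading `f 0` of `P 0` and continues it from each
corner to the next one, then after one turn the grading of `P 0` obtained is `f 0 + s`. -/
def HasWindingHolonomy {X : Type u} (α : NearAction Z2 X) (m : ℕ) (s : ℤ × ℤ) : Prop :=
  1 ≤ m ∧ ∃ (P : ℕ → Set X) (f : ℕ → X → ℤ × ℤ),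
    (∀ j < 4 * m, IsGradedCorner α j (P j) (f j)) ∧
    (∀ i < 4 * m, ∀ j < 4 * m, i ≠ j → (P i ∩ P j).Finite) ∧
    {x | ∀ j < 4 * m, x ∉ P j}.Finite ∧
    (∀ j < 4 * m, GradedAdjacent α (exitVec j) (P j) (f j) (P (j + 1)) (f (j + 1))) ∧
    P (4 * m) = P 0 ∧ ∀ x, f (4 * m) x = f 0 x + s

/-! ### The near `ℤ²`-sets `X_{m,s}` -/

/-- The near action of `ℤ²` defined by two commuting near permutations. -/
def nearActionOfCommute {X : Type u} (a b : NearPerm X) (h : Commute a b) : NearAction Z2 X where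
  toFun p := a ^ (Multiplicative.toAdd p).1 * b ^ (Multiplicative.toAdd p).2
  map_one' := by simp
  map_mul' p q := by
    simp only [toAdd_mul, Prod.fst_add, Prod.snd_add, zpow_add]
    rw [mul_assoc, mul_assoc]
    congr 1
    rw [← mul_assoc, ← mul_assoc]
    congr 1
    exact (h.zpow_zpow _ _).eq

/-- A point with coordinates `(x, y)` in the upper or lower half of the `k`-th sheet. -/
@[ext] structure Pt (m : ℕ) where
  upper : Bool
  k : Fin m
  x : ℤ
  y : ℤ
deriving DecidableEq

section Model

variable (m : ℕ) (s : ℤ × ℤ)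

/-- The seam between sheet `k` and the next one is untwisted, except for the last sheet. -/
def seam (k : Fin m) : ℤ × ℤ := if k.1 + 1 = m then s else 0

/-- The lower half of the `k`-th sheet has points of ordinate `< height k x` above `x`. -/
def height (k : Fin m) (x : ℤ) : ℤ := if 0 ≤ x then (seam m s k).2 else 0

/-- The points of `X_{m,s}`: each upper half is `ℤ × ℤ_{≥ 0}`, each lower half is `ℤ × ℤ_{< 0}`,
except the last one, which is `{(x, y) | y < 0 if x < 0, y < s₂ if x ≥ 0}`. -/
def modelSet : Set (Pt m) :=
  {p | if p.upper then 0 ≤ p.y else p.y < height m s p.k p.x}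

def right (p : Pt m) : Pt m := { p with x := p.x + 1 }

def left (p : Pt m) : Pt m := { p with x := p.x - 1 }

/-- One step up. The top row of the lower half of sheet `k` is glued to the bottom row of the
upper half of the same sheet for `x < 0`, and of the (cyclically) next sheet for `x ≥ 0`; in the
latter case the point `(x, s₂ - 1)` of the last sheet is glued below the point `(x - s₁, 0)` of
the first one. -/
def up (p : Pt m) : Pt m :=
  if p.upper = true ∨ p.y + 1 < height m s p.k p.x then { p with y := p.y + 1 }
  else if 0 ≤ p.x then ⟨true, finRotate m p.k, p.x - (seam m s p.k).1, 0⟩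
  else ⟨true, p.k, p.x, 0⟩

/-- One step down. -/
def down (p : Pt m) : Pt m :=
  if p.upper = false ∨ 0 < p.y then { p with y := p.y - 1 }
  else if 0 ≤ p.x then
    ⟨false, (finRotate m).symm p.k, p.x + (seam m s ((finRotate m).symm p.k)).1,
      (seam m s ((finRotate m).symm p.k)).2 - 1⟩
  else ⟨false, p.k, p.x, -1⟩

end Model

/-- The partial injection of `S` that maps `p` to `q` if and only if `q = a p` and `p = b q`. -/
def pequivOfMaps {E : Type u} [DecidableEq E] (S : Set E) [DecidablePred (· ∈ S)] (a b : E → E) :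
    S ≃. S where
  toFun p := if h : a p ∈ S ∧ b (a p) = p then some ⟨a p, h.1⟩ else none
  invFun q := if h : b q ∈ S ∧ a (b q) = q then some ⟨b q, h.1⟩ else none
  inv := by
    rintro ⟨p, hp⟩ ⟨q, hq⟩
    constructor
    · intro h
      simp only [Option.dite_none_right_eq_some, Option.some.injEq,
        Subtype.mk.injEq] at h ⊢
      obtain ⟨⟨h1, h2⟩, h3⟩ := h
      subst h3
      exact ⟨⟨by rwa [h2], by rw [h2]⟩, h2⟩
    · intro h
      simp only [Option.dite_none_right_eq_some, Option.some.injEq,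
        Subtype.mk.injEq] at h ⊢
      obtain ⟨⟨h1, h2⟩, h3⟩ := h
      subst h3
      exact ⟨⟨by rwa [h2], by rw [h2]⟩, h2⟩

section Model

variable (m : ℕ) (s : ℤ × ℤ)

instance : DecidablePred (· ∈ modelSet m s) := fun p =>
  inferInstanceAs (Decidable (if p.upper then 0 ≤ p.y else p.y < height m s p.k p.x))

theorem finite_box (N : ℤ) : {p : Pt m | |p.x| ≤ N ∧ |p.y| ≤ N}.Finite := by
  have h : ((Set.univ : Set (Bool × Fin m)) ×ˢ (Set.Icc (-N) N ×ˢ Set.Icc (-N) N)).Finite :=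
    Set.finite_univ.prod ((Set.finite_Icc _ _).prod (Set.finite_Icc _ _))
  refine (h.image fun q => (⟨q.1.1, q.1.2, q.2.1, q.2.2⟩ : Pt m)).subset ?_
  rintro ⟨b, k, x, y⟩ ⟨hx, hy⟩
  exact ⟨((b, k), (x, y)), ⟨Set.mem_univ _, abs_le.1 hx, abs_le.1 hy⟩, rfl⟩

theorem finite_of_box (N : ℤ) (A : Set (modelSet m s))
    (h : ∀ p ∈ A, |p.1.x| ≤ N ∧ |p.1.y| ≤ N) : A.Finite := by
  refine Set.Finite.of_finite_image ((finite_box m N).subset ?_) Subtype.val_injective.injOn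
  rintro _ ⟨p, hp, rfl⟩
  exact h p hp

theorem seam_le (k : Fin m) : |(seam m s k).1| ≤ |s.1| ∧ |(seam m s k).2| ≤ |s.2| := by
  unfold seam
  split_ifs <;> simp

/-- The point `p` is far from the origin of its sheet. -/
def Far (p : Pt m) : Prop := |s.1| + |s.2| + 2 < |p.x| ∨ |s.1| + |s.2| + 2 < |p.y|

theorem right_spec (p : Pt m) (hp : p ∈ modelSet m s) (h : Far m s p) :
    right m p ∈ modelSet m s ∧ left m (right m p) = p := by
  rcases p with ⟨b, k, x, y⟩
  have h0 := seam_le m s k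
  cases b <;>
    simp only [modelSet, Set.mem_ofPred_eq, right, left, height, Far] at * <;> grind

theorem left_spec (p : Pt m) (hp : p ∈ modelSet m s) (h : Far m s p) :
    left m p ∈ modelSet m s ∧ right m (left m p) = p := by
  rcases p with ⟨b, k, x, y⟩
  have h0 := seam_le m s k
  cases b <;>
    simp only [modelSet, Set.mem_ofPred_eq, right, left, height, Far] at * <;> grind

theorem up_spec (p : Pt m) (hp : p ∈ modelSet m s) (h : Far m s p) :
    up m s p ∈ modelSet m s ∧ down m s (up m s p) = p := by
  rcases p with ⟨b, k, x, y⟩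
  have h0 := seam_le m s k
  cases b <;>
    simp only [modelSet, Set.mem_ofPred_eq, up, down, height, Far] at * <;>
    grind [Equiv.symm_apply_apply]

theorem down_spec (p : Pt m) (hp : p ∈ modelSet m s) (h : Far m s p) :
    down m s p ∈ modelSet m s ∧ up m s (down m s p) = p := by
  rcases p with ⟨b, k, x, y⟩
  have h0 := seam_le m s k
  have h1 := seam_le m s ((finRotate m).symm k)
  cases b <;>
    simp only [modelSet, Set.mem_ofPred_eq, up, down, height, Far] at * <;>
    grind [Equiv.apply_symm_apply]

theorem far_up_right (p : Pt m) (hp : p ∈ modelSet m s)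
    (h : ¬ (|p.x| ≤ 2 * (|s.1| + |s.2|) + 4 ∧ |p.y| ≤ 2 * (|s.1| + |s.2|) + 4)) :
    Far m s p ∧ Far m s (right m p) ∧ Far m s (up m s p) ∧
      up m s (right m p) = right m (up m s p) := by
  rcases p with ⟨b, k, x, y⟩
  have h0 := seam_le m s k
  cases b <;>
    simp only [modelSet, Set.mem_ofPred_eq, right, up, height, Far] at * <;> grind

theorem pequivOfMaps_apply {E : Type u} [DecidableEq E] (S : Set E) [DecidablePred (· ∈ S)]
    (a b : E → E) (p : S) (h : a p ∈ S ∧ b (a p) = p) :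
    pequivOfMaps S a b p = some ⟨a p, h.1⟩ :=
  dif_pos h

theorem not_far_of_none (a b : Pt m → Pt m)
    (h : ∀ p ∈ modelSet m s, Far m s p → a p ∈ modelSet m s ∧ b (a p) = p) :
    {p | pequivOfMaps (modelSet m s) a b p = none}.Finite := by
  refine finite_of_box m s (|s.1| + |s.2| + 2) _ ?_
  intro p hp
  by_contra hc
  have hfar : Far m s p.1 := by
    unfold Far
    by_contra h'
    push Not at h'
    exact hc h'
  rw [Set.mem_ofPred_eq, pequivOfMaps_apply _ _ _ _ (h p.1 p.2 hfar)] at hp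
  cases hp

/-- One step to the right in `X_{m,s}`. -/
def modelRight : CofPBij (modelSet m s) (modelSet m s) where
  toPEquiv := pequivOfMaps (modelSet m s) (right m) (left m)
  finite_dom := not_far_of_none m s _ _ (right_spec m s)
  finite_ran := not_far_of_none m s _ _ (left_spec m s)

/-- One step up in `X_{m,s}`. -/
def modelUp : CofPBij (modelSet m s) (modelSet m s) where
  toPEquiv := pequivOfMaps (modelSet m s) (up m s) (down m s)
  finite_dom := not_far_of_none m s _ _ (up_spec m s)
  finite_ran := not_far_of_none m s _ _ (down_spec m s)

theorem commute_model : Commute (NearBij.mk (modelRight m s)) (NearBij.mk (modelUp m s)) := by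
  refine Quotient.sound ?_
  refine finite_of_box m s (2 * (|s.1| + |s.2|) + 4) _ ?_
  rintro p hp
  by_contra hc
  obtain ⟨h1, h2, h3, h4⟩ := far_up_right m s p.1 p.2 hc
  apply hp
  have r1 := right_spec m s p.1 p.2 h1
  have u1 := up_spec m s p.1 p.2 h1
  have u2 := up_spec m s _ r1.1 h2
  have r2 := right_spec m s _ u1.1 h3
  change ((modelUp m s).toPEquiv p).bind (modelRight m s).toPEquiv =
    ((modelRight m s).toPEquiv p).bind (modelUp m s).toPEquiv
  have e1 : (modelUp m s).toPEquiv p = some ⟨_, u1.1⟩ := pequivOfMaps_apply _ _ _ p u1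
  have e2 : (modelRight m s).toPEquiv p = some ⟨_, r1.1⟩ := pequivOfMaps_apply _ _ _ p r1
  have e3 : (modelRight m s).toPEquiv ⟨_, u1.1⟩ = some ⟨_, r2.1⟩ := pequivOfMaps_apply _ _ _ _ r2
  have e4 : (modelUp m s).toPEquiv ⟨_, r1.1⟩ = some ⟨_, u2.1⟩ := pequivOfMaps_apply _ _ _ _ u2
  rw [e1, e2, Option.bind_some, Option.bind_some, e3, e4]
  simp only [h4]

/-- The near `ℤ²`-set `X_{m,s}`, for `m ≥ 1`: the two generators of `ℤ²` act by one step to the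
right and one step up. -/
def modelAction : NearAction Z2 (modelSet m s) :=
  nearActionOfCommute _ _ (commute_model m s)

end Model

/-- The simply transitive action of `ℤ²` on itself by translations, as a near action. -/
def translationAction : NearAction Z2 Z2 :=
  (NearPerm.ofPerm Z2).comp (MulAction.toPermHom Z2 Z2)

end NearActions

/-!
A near `ℤ²`-set `X` is studied through functions `ρ g : X → X` that represent the near permutations
`α g` outside finite sets (`RepAction`). A *chart* is an equivariant injection into `X` of one of
the half-planes `n ≤ ht j v`, where `ht j` runs through the linear forms `y, -x, -y, x`, and a
*development* is a sequence of charts `c 0, c 1, c 2, …` whose half-planes turn counterclockwise,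
each chart coinciding with the next one in the depth of the corner that they share.

An equivariant injection of a corner extends to a half-plane (`NearRep.exists_halfPlane_of_corner`):
the relations of `ℤ²` fail at finitely many points only, so they break finitely many rows. Hence a
chart starts a development, and a development is determined by any one of its charts
(`Development.shift_add`). If `X` is 1-ended and near free, then a first chart exists: otherwise the
orbits of `(1, 0)` would be finite, and their lengths would cut `X` into two infinite pieces
(`exists_injective_iterate`). Continuing an upper half-plane downwards, one either fills a plane or
runs into the finite exceptional set, so that up to translation there are finitely many upper
half-planes, and the development is periodic: after a minimal number `m` of turns, it comes back to
itself up to a translation by `s` (`exists_hasPeriod`).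

When two half-planes meet, they are continued into each other up to a translation, so the
period `(m, s)` does not depend on the development (`HasPeriod.eq_of_covers`). The half-planes of
one period cover `X` by 1-endedness, and the way in which they overlap only depends on `(m, s)`;
matching two developments of the same period therefore gives a near isomorphism
(`exists_nearIso_of_period`). A partition of `X` into graded near corners amounts to a development
that covers `X` (`HasWindingHolonomy.exists_development`), and such a development makes `X` 1-ended
and near free. The quadrants of `X_{m,s}` form such a partition, which gives the classification.

In a realization of `X ⊔ Y`, a half-plane of `X` lies in a free orbit, which is a plane; the
development is then constant, so `(m, s) = (1, 0)` (`Completable.eq_of_development`). A near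
automorphism maps a development to a development, hence acts on it by a number of turns and a
translation, by which it is determined; one turn is realized by a near automorphism, as the shifted
development has the same period. Since `m` turns amount to the translation by `-s`, the group is
`ℤ³ / ⟨(s₁, s₂, -m)⟩` (`exists_nearAut_equiv`), whose structure follows from Bézout's identity.
-/

namespace NearActions

open Filter

/-! ### Near bijections as functions modulo finite sets -/

section Representatives

variable {X : Type u} {Y : Type v} {Z : Type w}

/-- The everywhere defined function `F` represents the near bijection `φ`: it coincides with `φ`
outside a finite set. The values of `F` on the finite set where `φ` is undefined are irrelevant. -/
def Represents (F : X → Y) (φ : NearBij X Y) : Prop :=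
  ∀ f : CofPBij X Y, NearBij.mk f = φ → ∀ᶠ x in cofinite, f.toPEquiv x = some (F x)

theorem NearBij.mk_eq_mk {f g : CofPBij X Y} :
    NearBij.mk f = NearBij.mk g ↔ ∀ᶠ x in cofinite, f.toPEquiv x = g.toPEquiv x :=
  ⟨fun h => Quotient.exact h, fun h => Quotient.sound h⟩

theorem NearBij.exists_mk (φ : NearBij X Y) : ∃ f, NearBij.mk f = φ := Quotient.exists_rep φ

theorem represents_mk {f : CofPBij X Y} {F : X → Y} :
    Represents F (NearBij.mk f) ↔ ∀ᶠ x in cofinite, f.toPEquiv x = some (F x) := by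
  refine ⟨fun h => h f rfl, fun h g hg => ?_⟩
  filter_upwards [h, NearBij.mk_eq_mk.1 hg] with x h1 h2
  rw [h2, h1]

theorem CofPBij.eventually_ne_none (f : CofPBij X Y) :
    ∀ᶠ x in cofinite, f.toPEquiv x ≠ none := by
  simpa [Filter.eventually_cofinite] using f.finite_dom

theorem exists_represents [Nonempty Y] (φ : NearBij X Y) : ∃ F, Represents F φ := by
  obtain ⟨f, rfl⟩ := φ.exists_mk
  refine ⟨fun x => (f.toPEquiv x).getD (Classical.arbitrary Y), represents_mk.2 ?_⟩
  filter_upwards [f.eventually_ne_none] with x hx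
  obtain ⟨y, hy⟩ := Option.ne_none_iff_exists'.1 hx
  simp [hy]

theorem exists_represents_self (φ : NearPerm X) : ∃ F, Represents F φ := by
  rcases isEmpty_or_nonempty X with h | h
  · obtain ⟨f, rfl⟩ := φ.exists_mk
    exact ⟨id, represents_mk.2 (Eventually.of_forall fun x => h.elim x)⟩
  · exact exists_represents φ

theorem Represents.eventuallyEq {F F' : X → Y} {φ : NearBij X Y} (h : Represents F φ)
    (h' : Represents F' φ) : F =ᶠ[cofinite] F' := by
  obtain ⟨f, rfl⟩ := φ.exists_mk
  filter_upwards [h f rfl, h' f rfl] with x h1 h2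
  exact Option.some.inj (h1.symm.trans h2)

theorem Represents.unique {F F' : X → Y} {φ ψ : NearBij X Y} (h : Represents F φ)
    (h' : Represents F' ψ) (hF : F =ᶠ[cofinite] F') : φ = ψ := by
  obtain ⟨f, rfl⟩ := φ.exists_mk
  obtain ⟨g, rfl⟩ := ψ.exists_mk
  refine NearBij.mk_eq_mk.2 ?_
  filter_upwards [h f rfl, h' g rfl, hF] with x h1 h2 h3
  rw [h1, h2, h3]

theorem Represents.tendsto {F : X → Y} {φ : NearBij X Y} (h : Represents F φ) :
    Tendsto F cofinite cofinite := by
  obtain ⟨f, rfl⟩ := φ.exists_mk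
  intro s hs
  have hs' : sᶜ.Finite := hs
  have h1 := CofPBij.finite_preimage f.toPEquiv hs'
  have h2 : {x | ¬ f.toPEquiv x = some (F x)}.Finite := h f rfl
  refine Set.Finite.subset (h1.union h2) fun x hx => ?_
  by_cases hc : f.toPEquiv x = some (F x)
  · exact Or.inl ⟨F x, hx, hc⟩
  · exact Or.inr hc

theorem Represents.trans {F : X → Y} {G : Y → Z} {φ : NearBij X Y} {ψ : NearBij Y Z}
    (hF : Represents F φ) (hG : Represents G ψ) : Represents (fun x => G (F x)) (φ.trans ψ) := by
  obtain ⟨f, rfl⟩ := φ.exists_mk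
  obtain ⟨g, rfl⟩ := ψ.exists_mk
  change Represents _ (NearBij.mk (f.trans g))
  refine represents_mk.2 ?_
  filter_upwards [hF f rfl, hF.tendsto.eventually (hG g rfl)] with x h1 h2
  change (f.toPEquiv x).bind g.toPEquiv = _
  rw [h1, Option.bind_some, h2]

theorem Represents.mul {F G : X → X} {φ ψ : NearPerm X} (hF : Represents F φ)
    (hG : Represents G ψ) : Represents (fun x => F (G x)) (φ * ψ) :=
  hG.trans hF

theorem represents_one : Represents (fun x : X => x) (1 : NearPerm X) := by
  change Represents _ (NearBij.mk (CofPBij.refl X))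
  exact represents_mk.2 (Eventually.of_forall fun x => rfl)

theorem represents_ofEquiv (e : X ≃ Y) : Represents e (NearBij.mk (CofPBij.ofEquiv e)) :=
  represents_mk.2 (Eventually.of_forall fun _ => rfl)

/-- Two functions inverse to each other up to finite sets represent a near bijection. -/
theorem exists_nearBij (F : X → Y) (G : Y → X) (h : ∀ᶠ x in cofinite, G (F x) = x)
    (h' : ∀ᶠ y in cofinite, F (G y) = y) : ∃ φ : NearBij X Y, Represents F φ := by
  classical
  let f : X ≃. Y :=
    { toFun := fun x => if G (F x) = x then some (F x) else none
      invFun := fun y => if F (G y) = y then some (G y) else none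
      inv := by
        intro x y
        simp only [Option.ite_none_right_eq_some, Option.some.injEq]
        constructor
        · rintro ⟨h1, rfl⟩
          exact ⟨congrArg G h1, h1⟩
        · rintro ⟨h1, rfl⟩
          exact ⟨congrArg F h1, h1⟩ }
  have hf : ∀ x, f x = if G (F x) = x then some (F x) else none := fun _ => rfl
  have hg : ∀ x, f.symm x = if F (G x) = x then some (G x) else none := fun _ => rfl
  let f' : CofPBij X Y := ⟨f, by
    refine Set.Finite.subset (show {x | ¬ G (F x) = x}.Finite from h) fun x hx => ?_
    intro hc
    simp [hf, hc] at hx, by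
    refine Set.Finite.subset (show {x | ¬ F (G x) = x}.Finite from h') fun x hx => ?_
    intro hc
    simp [hg, hc] at hx⟩
  refine ⟨NearBij.mk f', represents_mk.2 ?_⟩
  filter_upwards [h] with x hx
  exact (hf x).trans (if_pos hx)

end Representatives

/-! ### Near `ℤ²`-sets as families of functions -/

section NearRep

variable {X : Type u} {Y : Type v}

/-- A family of functions indexed by `ℤ²` that satisfies the axioms of an action up to finite
sets. -/
structure NearRep (ρ : ℤ × ℤ → X → X) : Prop where
  zero : ∀ᶠ x in cofinite, ρ 0 x = x
  add : ∀ g h, ∀ᶠ x in cofinite, ρ (g + h) x = ρ g (ρ h x)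
  tendsto : ∀ g, Tendsto (ρ g) cofinite cofinite

/-- The functions `ρ g` represent the near permutations `α g`. -/
def RepAction (ρ : ℤ × ℤ → X → X) (α : NearAction Z2 X) : Prop :=
  ∀ g, Represents (ρ g) (α (Multiplicative.ofAdd g))

theorem exists_repAction (α : NearAction Z2 X) : ∃ ρ, RepAction ρ α := by
  choose ρ hρ using fun g : ℤ × ℤ => exists_represents_self (α (Multiplicative.ofAdd g))
  exact ⟨ρ, hρ⟩

theorem RepAction.nearRep {ρ : ℤ × ℤ → X → X} {α : NearAction Z2 X} (h : RepAction ρ α) :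
    NearRep ρ where
  zero := by
    have h0 := h 0
    rw [ofAdd_zero, map_one] at h0
    exact h0.eventuallyEq represents_one
  add g k := by
    have h0 := h (g + k)
    rw [ofAdd_add, map_mul] at h0
    exact h0.eventuallyEq ((h g).mul (h k))
  tendsto g := (h g).tendsto

/-- The four unit vectors of `ℤ²`. -/
def UnitVec (e : ℤ × ℤ) : Prop := e = (1, 0) ∨ e = (-1, 0) ∨ e = (0, 1) ∨ e = (0, -1)

theorem eventually_unitVec {ι : Type*} {l : Filter ι} {P : ℤ × ℤ → ι → Prop}
    (h : ∀ e, UnitVec e → ∀ᶠ i in l, P e i) : ∀ᶠ i in l, ∀ e, UnitVec e → P e i := by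
  filter_upwards [h (1, 0) (by simp [UnitVec]), h (-1, 0) (by simp [UnitVec]),
    h (0, 1) (by simp [UnitVec]), h (0, -1) (by simp [UnitVec])] with i h1 h2 h3 h4
  rintro e (rfl | rfl | rfl | rfl) <;> assumption

theorem induction_unitVec {P : ℤ × ℤ → Prop} (h0 : P 0) (hadd : ∀ g h, P g → P h → P (g + h))
    (hu : ∀ e, UnitVec e → P e) (g : ℤ × ℤ) : P g := by
  have key : ∀ e, UnitVec e → ∀ n : ℕ, P (n • e) := by
    intro e he n
    induction n with
    | zero => simpa using h0
    | succ n ih => rw [succ_nsmul]; exact hadd _ _ ih (hu e he)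
  have hx : ∀ x : ℤ, P (x, 0) := by
    intro x
    obtain ⟨n, rfl | rfl⟩ := x.eq_nat_or_neg
    · simpa using key (1, 0) (by simp [UnitVec]) n
    · simpa using key (-1, 0) (by simp [UnitVec]) n
  have hy : ∀ y : ℤ, P (0, y) := by
    intro x
    obtain ⟨n, rfl | rfl⟩ := x.eq_nat_or_neg
    · simpa using key (0, 1) (by simp [UnitVec]) n
    · simpa using key (0, -1) (by simp [UnitVec]) n
  have := hadd _ _ (hx g.1) (hy g.2)
  simpa using this

/-- Every `g ≠ 0` has finitely many fixed points. -/
def FreeRep (ρ : ℤ × ℤ → X → X) : Prop := ∀ g, g ≠ 0 → ∀ᶠ x in cofinite, ρ g x ≠ x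

/-- `X` is infinite and cannot be cut into two infinite pieces that are preserved, up to finite
sets, by the unit vectors. -/
def OneEndedRep (ρ : ℤ × ℤ → X → X) : Prop :=
  Infinite X ∧ ∀ A : Set X, (∀ e, UnitVec e → ∀ᶠ x in cofinite, x ∈ A → ρ e x ∈ A) →
    A.Finite ∨ Aᶜ.Finite

variable {ρ : ℤ × ℤ → X → X} {α : NearAction Z2 X}

theorem NearRep.neg_add (hρ : NearRep ρ) (g : ℤ × ℤ) :
    ∀ᶠ x in cofinite, ρ (-g) (ρ g x) = x := by
  filter_upwards [hρ.add (-g) g, hρ.zero] with x h1 h2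
  rw [← h1, neg_add_cancel, h2]

theorem NearRep.comm (hρ : NearRep ρ) (g h : ℤ × ℤ) :
    ∀ᶠ x in cofinite, ρ g (ρ h x) = ρ h (ρ g x) := by
  filter_upwards [hρ.add g h, hρ.add h g] with x h1 h2
  rw [← h1, ← h2, add_comm]

theorem RepAction.freeRep (h : RepAction ρ α) (hf : NearFree α) : FreeRep ρ := by
  intro g hg
  obtain ⟨f, hfg⟩ := (α (Multiplicative.ofAdd g)).exists_mk
  have h1 : ∀ᶠ x in cofinite, ¬ f.toPEquiv x = some x := by
    simpa [Filter.eventually_cofinite] using hf (Multiplicative.ofAdd g) (by simpa using hg) f hfg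
  filter_upwards [h1, h g f hfg] with x h2 h3 h4
  rw [h4] at h3
  exact h2 h3

theorem RepAction.nearFree (h : RepAction ρ α) (hf : FreeRep ρ) : NearFree α := by
  intro g hg f hfg
  have h1 := hf (Multiplicative.toAdd g) (by simpa using hg)
  have h2 : ∀ᶠ x in cofinite, ¬ f.toPEquiv x = some x := by
    filter_upwards [h1, h (Multiplicative.toAdd g) f hfg] with x h2 h3 h4
    rw [h3] at h4
    exact h2 (Option.some.inj h4)
  simpa [Filter.eventually_cofinite] using h2

theorem commensurated_iff (h : RepAction ρ α) (A : Set X) :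
    Commensurated α A ↔ ∀ g, ∀ᶠ x in cofinite, x ∈ A → ρ g x ∈ A := by
  constructor
  · intro hA g
    obtain ⟨f, hfg⟩ := (α (Multiplicative.ofAdd g)).exists_mk
    have h1 : ∀ᶠ x in cofinite, ¬ (x ∈ A ∧ ¬ ∃ y ∈ A, f.toPEquiv x = some y) := by
      simpa [Filter.eventually_cofinite] using hA _ f hfg
    filter_upwards [h1, h g f hfg] with x h2 h3 h4
    by_contra hc
    refine h2 ⟨h4, ?_⟩
    rintro ⟨y, hy, hxy⟩
    rw [h3] at hxy
    exact hc (Option.some.inj hxy ▸ hy)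
  · intro hA g f hfg
    have h1 : ∀ᶠ x in cofinite, ¬ (x ∈ A ∧ ¬ ∃ y ∈ A, f.toPEquiv x = some y) := by
      filter_upwards [hA (Multiplicative.toAdd g), h (Multiplicative.toAdd g) f hfg] with x h1 h2
      rintro ⟨h3, h4⟩
      exact h4 ⟨_, h1 h3, h2⟩
    simpa [Filter.eventually_cofinite] using h1

theorem NearRep.mapsTo_of_unitVec (hρ : NearRep ρ) {A : Set X}
    (hA : ∀ e, UnitVec e → ∀ᶠ x in cofinite, x ∈ A → ρ e x ∈ A) (g : ℤ × ℤ) :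
    ∀ᶠ x in cofinite, x ∈ A → ρ g x ∈ A := by
  refine induction_unitVec ?_ ?_ hA g
  · filter_upwards [hρ.zero] with x hx h
    rwa [hx]
  · intro g k hg hk
    filter_upwards [hρ.add g k, hk, (hρ.tendsto k).eventually hg] with x h1 h2 h3 h4
    rw [h1]
    exact h3 (h2 h4)

theorem oneEnded_iff (h : RepAction ρ α) : OneEnded α ↔ OneEndedRep ρ := by
  refine and_congr Iff.rfl (forall_congr' fun A => ?_)
  rw [commensurated_iff h]
  exact ⟨fun H hA => H (h.nearRep.mapsTo_of_unitVec hA), fun H hA => H fun e _ => hA e⟩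

theorem nearIsomorphic_of_represents {σ : ℤ × ℤ → Y → Y} {β : NearAction Z2 Y}
    (hα : RepAction ρ α) (hβ : RepAction σ β) {F : X → Y} {φ : NearBij X Y}
    (hF : Represents F φ)
    (h : ∀ e, UnitVec e → ∀ᶠ x in cofinite, F (ρ e x) = σ e (F x)) :
    ∀ g, (α g).trans φ = φ.trans (β g) := by
  intro g
  have key : ∀ g, ∀ᶠ x in cofinite, F (ρ g x) = σ g (F x) := by
    intro g
    refine induction_unitVec ?_ ?_ h g
    · filter_upwards [hα.nearRep.zero, hF.tendsto.eventually hβ.nearRep.zero] with x h1 h2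
      rw [h1, h2]
    · intro g k hg hk
      filter_upwards [hα.nearRep.add g k, hF.tendsto.eventually (hβ.nearRep.add g k), hk,
        (hα.nearRep.tendsto k).eventually hg] with x h1 h2 h3 h4
      rw [h1, h2, h4, h3]
  exact ((hα (Multiplicative.toAdd g)).trans hF).unique (hF.trans (hβ (Multiplicative.toAdd g)))
    (key _)

theorem represents_of_intertwines {σ : ℤ × ℤ → Y → Y} {β : NearAction Z2 Y}
    (hα : RepAction ρ α) (hβ : RepAction σ β) {F : X → Y} {φ : NearBij X Y}
    (hF : Represents F φ) (h : ∀ g, (α g).trans φ = φ.trans (β g)) (g : ℤ × ℤ) :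
    ∀ᶠ x in cofinite, F (ρ g x) = σ g (F x) := by
  have h1 := (hα g).trans hF
  rw [h] at h1
  exact h1.eventuallyEq (hF.trans (hβ g))

/-- A near bijection and its inverse, represented by functions. -/
theorem exists_represents_symm {φ : NearBij X Y} {F : X → Y} (hF : Represents F φ)
    [Nonempty X] : ∃ G, Represents G φ.symm ∧ (∀ᶠ x in cofinite, G (F x) = x) ∧
      ∀ᶠ y in cofinite, F (G y) = y := by
  obtain ⟨G, hG⟩ := exists_represents φ.symm
  obtain ⟨f, rfl⟩ := φ.exists_mk
  have h1 := hF f rfl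
  have h2 : ∀ᶠ y in cofinite, f.toPEquiv.symm y = some (G y) := hG f.symm rfl
  refine ⟨G, hG, ?_, ?_⟩
  · filter_upwards [h1, hF.tendsto.eventually h2] with x h3 h4
    rw [f.toPEquiv.eq_some_iff.2 h3] at h4
    exact (Option.some.inj h4).symm
  · filter_upwards [h2, hG.tendsto.eventually h1] with x h3 h4
    rw [f.toPEquiv.eq_some_iff.1 h3] at h4
    exact (Option.some.inj h4).symm

end NearRep

/-! ### Near freeness and `⋆`-faithfulness -/

theorem OneEnded.nearFree_iff_starFaithful {X : Type u} {α : NearAction Z2 X} (h : OneEnded α) :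
    NearFree α ↔ StarFaithful α := by
  obtain ⟨ρ, hρ⟩ := exists_repAction α
  obtain ⟨hX, hA⟩ := (oneEnded_iff hρ).1 h
  constructor
  · intro hf
    refine (injective_iff_map_eq_one α).2 fun g hg => ?_
    by_contra hc
    have h1 := hρ.freeRep hf (Multiplicative.toAdd g) (by simpa using hc)
    have h2 := hρ (Multiplicative.toAdd g)
    rw [ofAdd_toAdd, hg] at h2
    obtain ⟨x, h3, h4⟩ := (h1.and (h2.eventuallyEq represents_one)).exists
    exact h3 h4
  · intro hf
    refine hρ.nearFree fun g hg => ?_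
    -- the set of fixed points of `g` is commensurated, as `ℤ²` is abelian
    have hc : ∀ e, UnitVec e → ∀ᶠ x in cofinite, x ∈ {x | ρ g x = x} → ρ e x ∈ {x | ρ g x = x} := by
      intro e _
      filter_upwards [hρ.nearRep.comm g e] with x h1 (h2 : ρ g x = x)
      rw [h1, h2]
    rcases hA _ hc with h1 | h1
    · simpa [Filter.eventually_cofinite] using h1
    · refine absurd (hf ?_) (show Multiplicative.ofAdd g ≠ 1 by simpa using hg)
      rw [map_one]
      exact (hρ g).unique represents_one h1

/-! ### Half-planes of `ℤ²` -/

/-- The linear forms `y, -x, -y, x` on `ℤ²`, according to `j` modulo `4`. A corner of type `j + 1`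
is a set where both `ht j` and `ht (j + 1)` are bounded below. -/
def ht : ℕ → ℤ × ℤ → ℤ
  | 0, v => v.2
  | j + 1, v => ht j (v.2, -v.1)

/-- The rotation by a quarter turn, counterclockwise. -/
def rot : ℤ × ℤ ≃+ ℤ × ℤ where
  toFun v := (-v.2, v.1)
  invFun v := (v.2, -v.1)
  left_inv v := by simp
  right_inv v := by simp
  map_add' v w := by ext <;> simp [add_comm]

/-- The rotation by `j` quarter turns. -/
def rotPow : ℕ → (ℤ × ℤ ≃+ ℤ × ℤ)
  | 0 => AddEquiv.refl _
  | j + 1 => (rotPow j).trans rot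

theorem ht_add (j : ℕ) (v w : ℤ × ℤ) : ht j (v + w) = ht j v + ht j w := by
  induction j generalizing v w with
  | zero => rfl
  | succ j ih =>
    have : (((v + w).2, -(v + w).1) : ℤ × ℤ) = (v.2, -v.1) + (w.2, -w.1) := by
      ext <;> simp [add_comm]
    rw [ht, this, ih]
    rfl

theorem ht_neg (j : ℕ) (v : ℤ × ℤ) : ht j (-v) = -ht j v := by
  have h := ht_add j v (-v)
  have h0 := ht_add j 0 0
  simp only [add_zero, add_neg_cancel] at h h0
  omega

theorem ht_sub (j : ℕ) (v w : ℤ × ℤ) : ht j (v - w) = ht j v - ht j w := by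
  rw [sub_eq_add_neg, ht_add, ht_neg, sub_eq_add_neg]

theorem ht_add_two (j : ℕ) (v : ℤ × ℤ) : ht (j + 2) v = -ht j v := by
  rw [← ht_neg]
  rfl

theorem ht_add_four (j : ℕ) (v : ℤ × ℤ) : ht (j + 4) v = ht j v := by
  rw [show j + 4 = j + 2 + 2 by rfl, ht_add_two, ht_add_two, neg_neg]

theorem ht_add_four_mul (j k : ℕ) (v : ℤ × ℤ) : ht (j + 4 * k) v = ht j v := by
  induction k with
  | zero => rfl
  | succ k ih => rw [Nat.mul_succ, ← add_assoc, ht_add_four, ih]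

theorem ht_mod (j : ℕ) (v : ℤ × ℤ) : ht (j % 4) v = ht j v := by
  conv_rhs => rw [← Nat.mod_add_div j 4]
  rw [ht_add_four_mul]

theorem ht_congr {i j : ℕ} (h : i % 4 = j % 4) (v : ℤ × ℤ) : ht i v = ht j v := by
  rw [← ht_mod i, ← ht_mod j, h]

theorem ht_rotPow (i j : ℕ) (v : ℤ × ℤ) : ht (i + j) (rotPow j v) = ht i v := by
  induction j with
  | zero => rfl
  | succ j ih =>
    rw [← ih, ← add_assoc]
    change ht (i + j) ((rot (rotPow j v)).2, -(rot (rotPow j v)).1) = _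
    congr 1
    simp [rot]

theorem ht_zero (v : ℤ × ℤ) : ht 0 v = v.2 := rfl

theorem ht_one (v : ℤ × ℤ) : ht 1 v = -v.1 := rfl

theorem ht_two (v : ℤ × ℤ) : ht 2 v = -v.2 := rfl

theorem ht_three (v : ℤ × ℤ) : ht 3 v = v.1 := by simp [ht]

theorem UnitVec.rotPow {e : ℤ × ℤ} (h : UnitVec e) (j : ℕ) : UnitVec (rotPow j e) := by
  induction j with
  | zero => exact h
  | succ j ih =>
    change UnitVec (rot (NearActions.rotPow j e))
    rcases ih with h | h | h | h <;> rw [h] <;> simp [UnitVec, rot]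

theorem UnitVec.rotPow_symm {e : ℤ × ℤ} (h : UnitVec e) (j : ℕ) :
    UnitVec ((NearActions.rotPow j).symm e) := by
  induction j generalizing e with
  | zero => exact h
  | succ j ih =>
    change UnitVec ((NearActions.rotPow j).symm (rot.symm e))
    refine ih ?_
    rcases h with h | h | h | h <;> rw [h] <;> simp [UnitVec, rot]

theorem UnitVec.abs_ht_le {e : ℤ × ℤ} (h : UnitVec e) (j : ℕ) : -1 ≤ ht j e ∧ ht j e ≤ 1 := by
  rw [← ht_mod]
  have := Nat.mod_lt j (show 4 > 0 by norm_num)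
  interval_cases j % 4 <;> rcases h with rfl | rfl | rfl | rfl <;> simp [ht]

/-- The forms `ht j` and `ht (j + 1)` are coordinates on `ℤ²`. -/
theorem exists_ht_eq (j : ℕ) (a b : ℤ) : ∃ v, ht j v = a ∧ ht (j + 1) v = b := by
  refine ⟨rotPow j (-b, a), ?_, ?_⟩
  · simpa [ht] using ht_rotPow 0 j (-b, a)
  · simpa [ht, add_comm] using ht_rotPow 1 j (-b, a)

theorem ht_le_abs (j : ℕ) (v : ℤ × ℤ) : ht j v ≤ |v.1| + |v.2| := by
  rw [← ht_mod]
  have := Nat.mod_lt j (show 4 > 0 by norm_num)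
  have h1 := abs_nonneg v.1
  have h2 := abs_nonneg v.2
  have h3 := le_abs_self v.1
  have h4 := le_abs_self v.2
  have h5 := neg_abs_le v.1
  have h6 := neg_abs_le v.2
  interval_cases j % 4 <;> simp only [ht] <;> linarith

theorem ext_ht (j : ℕ) {v w : ℤ × ℤ} (h : ht j v = ht j w) (h' : ht (j + 1) v = ht (j + 1) w) :
    v = w := by
  obtain ⟨v, rfl⟩ := (rotPow j).surjective v
  obtain ⟨w, rfl⟩ := (rotPow j).surjective w
  have e0 := fun v => ht_rotPow 0 j v
  have e1 := fun v => ht_rotPow 1 j v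
  simp only [zero_add] at e0
  rw [e0, e0] at h
  rw [add_comm, e1, e1] at h'
  simp only [ht] at h h'
  rw [show v = w by ext <;> omega]

theorem finite_of_ht (j : ℕ) {B : Set (ℤ × ℤ)} {n N : ℤ}
    (h : ∀ v ∈ B, n ≤ ht j v ∧ ht j v ≤ N ∧ n ≤ ht (j + 1) v ∧ ht (j + 1) v ≤ N) : B.Finite := by
  refine Set.Finite.of_finite_image (f := fun v => (ht j v, ht (j + 1) v)) ?_ ?_
  · refine ((Set.finite_Icc n N).prod (Set.finite_Icc n N)).subset ?_
    rintro _ ⟨v, hv, rfl⟩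
    obtain ⟨h1, h2, h3, h4⟩ := h v hv
    exact ⟨⟨h1, h2⟩, ⟨h3, h4⟩⟩
  · intro v _ w _ h
    exact ext_ht j (congrArg Prod.fst h) (congrArg Prod.snd h)

theorem exists_ht_lt {B : Set (ℤ × ℤ)} (hB : B.Finite) : ∃ n, ∀ v ∈ B, ∀ j, ht j v < n := by
  obtain ⟨n, hn⟩ := (hB.image fun v => |v.1| + |v.2|).bddAbove
  refine ⟨n + 1, fun v hv j => ?_⟩
  have := hn ⟨v, hv, rfl⟩
  have := ht_le_abs j v
  simp only at *
  omega

/-- The half-plane where `ht j` is at least `n`. -/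
def halfPlane (j : ℕ) (n : ℤ) : Set (ℤ × ℤ) := {v | n ≤ ht j v}

theorem mem_halfPlane {j : ℕ} {n : ℤ} {v : ℤ × ℤ} : v ∈ halfPlane j n ↔ n ≤ ht j v := Iff.rfl

theorem halfPlane_anti (j : ℕ) {n N : ℤ} (h : n ≤ N) : halfPlane j N ⊆ halfPlane j n :=
  fun _ hv => h.trans hv

theorem halfPlane_congr {i j : ℕ} (h : i % 4 = j % 4) (n : ℤ) : halfPlane i n = halfPlane j n := by
  ext v
  rw [mem_halfPlane, mem_halfPlane, ht_congr h]

/-- Any two points of `S` are joined by a path in `S` made of unit steps. -/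
def StepConnected (S : Set (ℤ × ℤ)) : Prop :=
  ∀ P : ℤ × ℤ → Prop, ∀ v ∈ S, P v →
    (∀ u ∈ S, P u → ∀ e, UnitVec e → u + e ∈ S → P (u + e)) → ∀ w ∈ S, P w

theorem int_path {I : Set ℤ} (hI : I.OrdConnected) {P : ℤ → Prop} {a b : ℤ} (ha : a ∈ I)
    (hb : b ∈ I) (hP : P a) (h1 : ∀ x ∈ I, P x → x + 1 ∈ I → P (x + 1))
    (h2 : ∀ x ∈ I, P x → x + -1 ∈ I → P (x + -1)) : P b := by
  rcases le_total a b with h | h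
  · have key : ∀ x, a ≤ x → x ≤ b → P x := by
      intro x hx
      induction x, hx using Int.leInduction with
      | base => exact fun _ => hP
      | succ x hx ih =>
        intro hxb
        exact h1 x (hI.out ha hb ⟨hx, by omega⟩) (ih (by omega))
          (hI.out ha hb ⟨by omega, hxb⟩)
    exact key b h le_rfl
  · have key : ∀ x, x ≤ a → b ≤ x → P x := by
      intro x hx
      induction x, hx using Int.leInductionDown with
      | base => exact fun _ => hP
      | pred x hx ih =>
        intro hxb
        exact h2 x (hI.out hb ha ⟨by omega, hx⟩) (ih (by omega))
          (hI.out hb ha ⟨hxb, by omega⟩)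
    exact key b h le_rfl

theorem stepConnected_ht (j : ℕ) {I J : Set ℤ} (hI : I.OrdConnected) (hJ : J.OrdConnected) :
    StepConnected {v | ht j v ∈ I ∧ ht (j + 1) v ∈ J} := by
  intro P v hv hP h w hw
  have e0 : ∀ v, ht j (rotPow j v) = v.2 := fun v => by simpa [ht] using ht_rotPow 0 j v
  have e1 : ∀ v, ht (j + 1) (rotPow j v) = -v.1 := fun v => by
    simpa [ht, add_comm] using ht_rotPow 1 j v
  have hJ' : (Neg.neg ⁻¹' J).OrdConnected :=
    ⟨fun x hx y hy z hz => hJ.out hy hx ⟨neg_le_neg hz.2, neg_le_neg hz.1⟩⟩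
  obtain ⟨⟨a, b⟩, rfl⟩ := (rotPow j).surjective v
  obtain ⟨⟨a', b'⟩, rfl⟩ := (rotPow j).surjective w
  simp only [Set.mem_ofPred_eq, e0, e1] at hv hw h
  have step : ∀ x y x' y', x' ∈ Neg.neg ⁻¹' J → y' ∈ I → x ∈ Neg.neg ⁻¹' J → y ∈ I →
      P (rotPow j (x, y)) → UnitVec ((x', y') - (x, y)) → P (rotPow j (x', y')) := by
    intro x y x' y' h1 h2 h3 h4 h5 h6
    have h7 : rotPow j (x, y) + rotPow j ((x', y') - (x, y)) = rotPow j (x', y') := by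
      rw [← map_add, add_sub_cancel]
    have := h (rotPow j (x, y)) (by rw [e0, e1]; exact ⟨h4, h3⟩) h5 _ (h6.rotPow j)
    rw [h7, e0, e1] at this
    exact this ⟨h2, h1⟩
  have hx : P (rotPow j (a', b)) :=
    int_path (P := fun x => P (rotPow j (x, b))) hJ' (show a ∈ Neg.neg ⁻¹' J from hv.2)
      (show a' ∈ Neg.neg ⁻¹' J from hw.2) hP
      (fun x hx hp hx' => step _ _ _ _ hx' hv.1 hx hv.1 hp (by simp [UnitVec]))
      (fun x hx hp hx' => step _ _ _ _ hx' hv.1 hx hv.1 hp (by simp [UnitVec]))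
  exact int_path (P := fun y => P (rotPow j (a', y))) hI hv.1 hw.1 hx
      (fun x hx hp hx' => step _ _ _ _ hw.2 hx' hw.2 hx hp (by simp [UnitVec]))
      (fun x hx hp hx' => step _ _ _ _ hw.2 hx' hw.2 hx hp (by simp [UnitVec]))

theorem stepConnected_halfPlane (j : ℕ) (n : ℤ) : StepConnected (halfPlane j n) := by
  have := stepConnected_ht j (Set.ordConnected_Ici (a := n)) Set.ordConnected_univ
  simpa [halfPlane] using this

theorem stepConnected_corner (j : ℕ) (n n' : ℤ) :
    StepConnected {v | n ≤ ht j v ∧ n' ≤ ht (j + 1) v} :=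
  stepConnected_ht j (Set.ordConnected_Ici (a := n)) (Set.ordConnected_Ici (a := n'))

/-! ### Charts and their extensions -/

section Charts

variable {X : Type u} {ρ : ℤ × ℤ → X → X}

/-- The map `c` intertwines unit steps inside `S` with the near action. -/
def EquivariantOn (ρ : ℤ × ℤ → X → X) (c : ℤ × ℤ → X) (S : Set (ℤ × ℤ)) : Prop :=
  ∀ v ∈ S, ∀ e, UnitVec e → v + e ∈ S → ρ e (c v) = c (v + e)

/-- The map `c` is an equivariant injection of the half-plane `n ≤ ht j` into `X`; its values
outside this half-plane are irrelevant. -/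
structure IsChart (ρ : ℤ × ℤ → X → X) (c : ℤ × ℤ → X) (j : ℕ) (n : ℤ) : Prop where
  equivariantOn : EquivariantOn ρ c (halfPlane j n)
  injOn : Set.InjOn c (halfPlane j n)

theorem EquivariantOn.mono {c : ℤ × ℤ → X} {S T : Set (ℤ × ℤ)} (h : EquivariantOn ρ c T)
    (hS : S ⊆ T) : EquivariantOn ρ c S :=
  fun v hv e he hve => h v (hS hv) e he (hS hve)

theorem IsChart.mono {c : ℤ × ℤ → X} {j : ℕ} {n N : ℤ} (h : IsChart ρ c j n) (hN : n ≤ N) :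
    IsChart ρ c j N :=
  ⟨h.equivariantOn.mono (halfPlane_anti j hN), h.injOn.mono (halfPlane_anti j hN)⟩

theorem IsChart.congr_mod {c : ℤ × ℤ → X} {i j : ℕ} {n : ℤ} (h : IsChart ρ c i n)
    (hij : i % 4 = j % 4) : IsChart ρ c j n := by
  have := halfPlane_congr hij n
  exact ⟨this ▸ h.equivariantOn, this ▸ h.injOn⟩

/-- Precomposition with rotations reduces statements on half-planes of any type to upper ones. -/
theorem NearRep.twist (hρ : NearRep ρ) (θ : ℤ × ℤ ≃+ ℤ × ℤ) : NearRep fun g => ρ (θ g) where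
  zero := by simpa using hρ.zero
  add g h := by simpa using hρ.add (θ g) (θ h)
  tendsto g := hρ.tendsto (θ g)

theorem IsChart.of_twist {c : ℤ × ℤ → X} {i j : ℕ} {n : ℤ}
    (h : IsChart (fun g => ρ (rotPow j g)) (fun v => c (rotPow j v)) i n) :
    IsChart ρ c (i + j) n := by
  constructor
  · intro v hv e he hve
    obtain ⟨v, rfl⟩ := (rotPow j).surjective v
    obtain ⟨e, rfl⟩ := (rotPow j).surjective e
    have he' := he.rotPow_symm j
    rw [AddEquiv.symm_apply_apply] at he'
    rw [← map_add] at hve ⊢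
    rw [mem_halfPlane, ht_rotPow] at hv hve
    have := h.equivariantOn v hv e he' hve
    simpa using this
  · intro v hv w hw hvw
    obtain ⟨v, rfl⟩ := (rotPow j).surjective v
    obtain ⟨w, rfl⟩ := (rotPow j).surjective w
    rw [mem_halfPlane, ht_rotPow] at hv hw
    rw [h.injOn hv hw hvw]

theorem IsChart.translate {c : ℤ × ℤ → X} {j : ℕ} {n : ℤ} (h : IsChart ρ c j n) (t : ℤ × ℤ) :
    IsChart ρ (fun v => c (v + t)) j (n - ht j t) := by
  constructor
  · intro v hv e he hve
    have := h.equivariantOn (v + t) (by rw [mem_halfPlane, ht_add] at *; omega) e he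
      (by rw [mem_halfPlane, ht_add] at *; rw [ht_add]; omega)
    rw [this]
    congr 1
    abel
  · intro v hv w hw hvw
    have := h.injOn (by rw [mem_halfPlane, ht_add] at *; omega)
      (by rw [mem_halfPlane, ht_add] at *; omega) hvw
    simpa using this

/-- Two equivariant maps that coincide at a point coincide on any region that is connected by unit
steps. -/
theorem EquivariantOn.eqOn {c c' : ℤ × ℤ → X} {S : Set (ℤ × ℤ)} (hS : StepConnected S)
    (h : EquivariantOn ρ c S) (h' : EquivariantOn ρ c' S) {v : ℤ × ℤ} (hv : v ∈ S)
    (hcv : c v = c' v) : ∀ w ∈ S, c w = c' w := by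
  refine hS (fun w => c w = c' w) v hv hcv fun u hu huc e he hue => ?_
  rw [← h u hu e he hue, ← h' u hu e he hue, huc]

/-- The point `x` is not exceptional for the relations between the unit vectors. -/
def Clean (ρ : ℤ × ℤ → X → X) (x : X) : Prop :=
  ∀ e, UnitVec e → ρ (-e) (ρ e x) = x ∧ ∀ e', UnitVec e' → ρ e (ρ e' x) = ρ e' (ρ e x)

theorem NearRep.eventually_clean (hρ : NearRep ρ) : ∀ᶠ x in cofinite, Clean ρ x :=
  eventually_unitVec fun e _ => (hρ.neg_add e).and (eventually_unitVec fun e' _ => hρ.comm e e')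

theorem Clean.of_twist {x : X} {j : ℕ} (h : Clean ρ x) :
    Clean (fun g => ρ (rotPow j g)) x := by
  intro e he
  refine ⟨?_, fun e' he' => (h _ (he.rotPow j)).2 _ (he'.rotPow j)⟩
  simp only [map_neg]
  exact (h _ (he.rotPow j)).1

/-- An equivariant injection `c` of a region whose rows, all infinite to the right, fill an upper
half-plane, extends to an upper half-plane: as the set of points that are not clean is finite, only
finitely many rows meet it when they are continued to the left. -/
theorem NearRep.exists_extension (hρ : NearRep ρ) {c : ℤ × ℤ → X} {n : ℤ} {I : ℤ → ℤ}
    (heq : EquivariantOn ρ c {v | n ≤ v.2 ∧ I v.2 ≤ v.1})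
    (hinj : Set.InjOn c {v | n ≤ v.2 ∧ I v.2 ≤ v.1})
    (hcl : ∀ v : ℤ × ℤ, n ≤ v.2 → I v.2 ≤ v.1 → Clean ρ (c v)) :
    ∃ N c', n ≤ N ∧ IsChart ρ c' 0 N ∧ ∀ v : ℤ × ℤ, I v.2 ≤ v.1 → c' v = c v := by
  classical
  have u1 : UnitVec (1, 0) := by simp [UnitVec]
  have u2 : UnitVec (-1, 0) := by simp [UnitVec]
  -- the row of ordinate `y`, continued to the left
  let c' : ℤ × ℤ → X := fun v =>
    if I v.2 ≤ v.1 then c v else (ρ (-1, 0))^[(I v.2 - v.1).toNat] (c (I v.2, v.2))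
  have hc1 : ∀ x y, I y ≤ x → c' (x, y) = c (x, y) := fun x y h => if_pos h
  have hc2 : ∀ y (k : ℕ), c' (I y - k, y) = (ρ (-1, 0))^[k] (c (I y, y)) := by
    intro y k
    rcases Nat.eq_zero_or_pos k with rfl | hk
    · simpa using hc1 (I y) y le_rfl
    · have : ¬ I y ≤ I y - k := by omega
      simp only [c', this, if_false]
      congr 2
      omega
  have hleft : ∀ x y, n ≤ y → c' (x - 1, y) = ρ (-1, 0) (c' (x, y)) := by
    intro x y hy
    rcases le_or_gt x (I y) with h | h
    · obtain ⟨k, hk⟩ := Int.eq_ofNat_of_zero_le (sub_nonneg.2 h)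
      have h1 := hc2 y k
      have h2 := hc2 y (k + 1)
      rw [Function.iterate_succ_apply', ← h1] at h2
      rw [show x = I y - k by omega]
      rw [← h2]
      congr 2
      push_cast
      ring
    · rw [hc1 _ _ (by omega), hc1 _ _ h.le]
      exact (heq (x, y) ⟨hy, h.le⟩ (-1, 0) u2
        ⟨by simpa using hy, by simp only [Prod.mk_add_mk, add_zero]; omega⟩).symm ▸ by
          simp [sub_eq_add_neg]
  have hright : ∀ y, n ≤ y → ∀ k : ℕ, (ρ (1, 0))^[k] (c (I y, y)) = c (I y + k, y) := by
    intro y hy k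
    induction k with
    | zero => simp
    | succ k ih =>
      rw [Function.iterate_succ_apply', ih]
      rw [heq (I y + k, y) ⟨hy, by simp⟩ (1, 0) u1 ⟨by simpa using hy, by simp; omega⟩]
      simp [add_assoc]
  -- a bad row reaches a point that is not clean, and is determined by the first such point
  let Bad : Set ℤ := {y | n ≤ y ∧ ∃ k : ℕ, ¬ Clean ρ ((ρ (-1, 0))^[k] (c (I y, y)))}
  have hbad : Bad.Finite := by
    have hfirst : ∀ y ∈ Bad, ∃ d, ¬ Clean ρ d ∧ ∃ k, (ρ (1, 0))^[k] d = c (I y, y) := by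
      rintro y ⟨hy, hk⟩
      refine ⟨_, Nat.find_spec hk, Nat.find hk, ?_⟩
      have hmin := fun k => Nat.find_min (m := k) hk
      generalize Nat.find hk = K at hmin
      induction K with
      | zero => rfl
      | succ K ih =>
        rw [Function.iterate_succ_apply, Function.iterate_succ_apply' (ρ (-1, 0))]
        have h1 := ((not_not.1 (hmin K (Nat.lt_succ_self K))) (-1, 0) u2).1
        rw [show -((-1 : ℤ), (0 : ℤ)) = (1, 0) by simp] at h1
        rw [h1]
        exact ih fun k hk => hmin k (by omega)
    have : Nonempty X := ⟨c 0⟩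
    choose! d hd k hk using hfirst
    refine Set.Finite.of_injOn (f := d) (t := {x | ¬ Clean ρ x}) (fun y hy => hd y hy) ?_
      hρ.eventually_clean
    have key : ∀ y ∈ Bad, ∀ z ∈ Bad, d y = d z → k y ≤ k z → y = z := by
      intro y hy z hz hyz hkk
      have h1 := hk z hz
      rw [← hyz, ← Nat.sub_add_cancel hkk, Function.iterate_add_apply, hk y hy,
        hright y hy.1] at h1
      exact congrArg Prod.snd (hinj ⟨hy.1, by simp⟩ ⟨hz.1, le_rfl⟩ h1)
    intro y hy z hz hyz
    rcases le_total (k y) (k z) with h | h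
    · exact key y hy z hz hyz h
    · exact (key z hz y hy hyz.symm h).symm
  obtain ⟨M, hM⟩ := hbad.bddAbove
  set N := max n (M + 1)
  have hN : n ≤ N := le_max_left _ _
  have hclean : ∀ x y, N ≤ y → Clean ρ (c' (x, y)) := by
    intro x y hy
    rcases le_or_gt (I y) x with h | h
    · rw [hc1 _ _ h]
      exact hcl _ (hN.trans hy) h
    · obtain ⟨k, hk⟩ := Int.eq_ofNat_of_zero_le (sub_nonneg.2 h.le)
      have h1 := hc2 y k
      rw [show I y - k = x by omega] at h1
      rw [h1]
      by_contra hc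
      have := hM (a := y) ⟨hN.trans hy, k, hc⟩
      have := le_max_right n (M + 1)
      omega
  have hR : ∀ x y, N ≤ y → ρ (1, 0) (c' (x, y)) = c' (x + 1, y) := by
    intro x y hy
    have h1 := hleft (x + 1) y (hN.trans hy)
    rw [add_sub_cancel_right] at h1
    have h2 := (hclean (x + 1) y hy (-1, 0) u2).1
    rw [show -((-1 : ℤ), (0 : ℤ)) = (1, 0) by simp] at h2
    rw [h1, h2]
  have hV : ∀ e, UnitVec (0, e) → ∀ x y, N ≤ y → N ≤ y + e →
      ρ (0, e) (c' (x, y)) = c' (x, y + e) := by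
    intro e he x y hy hy'
    have base : ∀ x, max (I y) (I (y + e)) ≤ x → ρ (0, e) (c' (x, y)) = c' (x, y + e) := by
      intro x hx
      have h1 : I y ≤ x := (le_max_left _ _).trans hx
      have h2 : I (y + e) ≤ x := (le_max_right _ _).trans hx
      rw [hc1 _ _ h1, hc1 _ _ h2]
      simpa using heq (x, y) ⟨hN.trans hy, h1⟩ (0, e) he ⟨by simpa using hN.trans hy', by simpa⟩
    rcases le_total (max (I y) (I (y + e))) x with h | h
    · exact base x h
    · induction x, h using Int.leInductionDown with
      | base => exact base _ le_rfl
      | pred x hx ih =>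
        rw [hleft x y (hN.trans hy), hleft x (y + e) (hN.trans hy'), ← ih,
          (hclean x y hy (0, e) he).2 _ u2]
  have heq' : EquivariantOn ρ c' (halfPlane 0 N) := by
    rintro ⟨x, y⟩ hy e he hye
    have hy' : N ≤ y := hy
    rcases he with rfl | rfl | rfl | rfl
    · simpa using hR x y hy
    · simpa [sub_eq_add_neg] using (hleft x y (hN.trans hy)).symm
    · simpa using hV 1 (by simp [UnitVec]) x y hy hye
    · simpa using hV (-1) (by simp [UnitVec]) x y hy hye
  refine ⟨N, c', hN, ⟨heq', ?_⟩, fun v hv => hc1 v.1 v.2 hv⟩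
  -- two points with the same image are moved to the right until `c` is defined there
  rintro ⟨x, y⟩ hv ⟨z, t⟩ hw hvw
  have key : ∀ k : ℕ, c' (x + k, y) = c' (z + k, t) := by
    intro k
    induction k with
    | zero => simpa using hvw
    | succ k ih =>
      push_cast
      rw [← add_assoc, ← add_assoc, ← hR _ y hv, ← hR _ t hw, ih]
  obtain ⟨k, hk⟩ : ∃ k : ℕ, I y ≤ x + k ∧ I t ≤ z + k :=
    ⟨(max (I y - x) (I t - z)).toNat, by omega, by omega⟩
  have h1 := key k
  rw [hc1 _ _ hk.1, hc1 _ _ hk.2] at h1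
  have h2 := hinj (x₁ := (x + k, y)) (x₂ := (z + k, t)) ⟨hN.trans hv, hk.1⟩
    ⟨hN.trans hw, hk.2⟩ h1
  simpa using h2

/-- An equivariant injection of a corner extends to a half-plane. -/
theorem NearRep.exists_halfPlane_of_corner (hρ : NearRep ρ) {c : ℤ × ℤ → X} {j : ℕ} {n : ℤ}
    (heq : EquivariantOn ρ c {v | n ≤ ht j v ∧ n ≤ ht (j + 1) v})
    (hinj : Set.InjOn c {v | n ≤ ht j v ∧ n ≤ ht (j + 1) v}) :
    ∃ N c', IsChart ρ c' (j + 1) N ∧ ∀ v, N ≤ ht j v → N ≤ ht (j + 1) v → c' v = c v := by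
  have hfin : {v | (n ≤ ht j v ∧ n ≤ ht (j + 1) v) ∧ ¬ Clean ρ (c v)}.Finite :=
    Set.Finite.of_injOn (f := c) (t := {x | ¬ Clean ρ x}) (fun v hv => hv.2)
      (hinj.mono fun v hv => hv.1) hρ.eventually_clean
  obtain ⟨N₀, hN₀⟩ := exists_ht_lt hfin
  set n' := max n N₀
  have hn : n ≤ n' := le_max_left _ _
  set θ := rotPow (j + 1)
  have e0 : ∀ v, ht (j + 1) (θ v) = v.2 := fun v => by simpa [ht] using ht_rotPow 0 (j + 1) v
  have e1 : ∀ v, ht j (θ v) = v.1 := fun v => by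
    have := ht_rotPow 3 (j + 1) v
    rwa [show 3 + (j + 1) = j + 4 by ring, ht_add_four, ht_three] at this
  obtain ⟨N, c', hN, hc', hcc⟩ := (hρ.twist θ).exists_extension (c := fun v => c (θ v)) (n := n')
    (I := fun _ => n') (fun v hv e he hve => by
      have := heq (θ v)
        (by simp only [Set.mem_ofPred_eq, e0, e1]; exact ⟨hn.trans hv.2, hn.trans hv.1⟩)
        (θ e) (he.rotPow _) (by
          rw [← map_add]; simp only [Set.mem_ofPred_eq, e0, e1]
          exact ⟨hn.trans hve.2, hn.trans hve.1⟩)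
      simpa using this) (fun v hv w hw hvw => θ.injective (hinj
        (by simp only [Set.mem_ofPred_eq, e0, e1]; exact ⟨hn.trans hv.2, hn.trans hv.1⟩)
        (by simp only [Set.mem_ofPred_eq, e0, e1]; exact ⟨hn.trans hw.2, hn.trans hw.1⟩) hvw))
      (fun v hv (hv' : n' ≤ v.1) => Clean.of_twist (by
        by_contra hc
        have h1 := hN₀ (θ v) ⟨by rw [e0, e1]; exact ⟨hn.trans hv', hn.trans hv⟩, hc⟩ j
        rw [e1] at h1
        have := le_max_right n N₀
        omega))
  refine ⟨N, fun v => c' (θ.symm v), ?_, fun v hv hv' => ?_⟩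
  · have := IsChart.of_twist (ρ := ρ) (c := fun v => c' (θ.symm v)) (i := 0) (j := j + 1) (n := N)
      (by simpa [θ] using hc')
    simpa using this
  · obtain ⟨v, rfl⟩ := θ.surjective v
    change c' (θ.symm (θ v)) = c (θ v)
    rw [θ.symm_apply_apply]
    rw [e1] at hv
    exact hcc v (hN.trans hv)

end Charts

/-! ### A first half-plane -/

section Initial

variable {X : Type u} {ρ : ℤ × ℤ → X → X}

theorem NearRep.iterate (hρ : NearRep ρ) (g : ℤ × ℤ) (n : ℕ) :
    ∀ᶠ x in cofinite, (ρ g)^[n] x = ρ (n • g) x := by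
  induction n with
  | zero => filter_upwards [hρ.zero] with x hx; simp [hx]
  | succ n ih =>
    filter_upwards [ih, hρ.add g (n • g)] with x h1 h2
    rw [Function.iterate_succ_apply', h1, succ_nsmul', h2]

theorem FreeRep.ne (hρ : NearRep ρ) (hf : FreeRep ρ) {g h : ℤ × ℤ} (hgh : g ≠ h) :
    ∀ᶠ x in cofinite, ρ g x ≠ ρ h x := by
  filter_upwards [hf (-h + g) (fun hc => hgh (by rw [neg_add_eq_zero] at hc; exact hc.symm)),
    hρ.add (-h) g, hρ.neg_add h] with x h1 h2 h3 h4
  rw [h2, h4, h3] at h1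
  exact h1 rfl

theorem finite_range_iterate {f : X → X} {x : X}
    (h : ¬ Function.Injective fun n => f^[n] x) : (Set.range fun n => f^[n] x).Finite := by
  obtain ⟨m, n, hmn, hlt⟩ : ∃ m n, f^[m] x = f^[n] x ∧ m < n := by
    simp only [Function.Injective, not_forall] at h
    obtain ⟨m, n, h1, h2⟩ := h
    rcases lt_or_gt_of_ne h2 with h3 | h3
    · exact ⟨m, n, h1, h3⟩
    · exact ⟨n, m, h1.symm, h3⟩
  refine ((Set.finite_Iio n).image fun n => f^[n] x).subset ?_
  rintro _ ⟨k, rfl⟩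
  induction k using Nat.strong_induction_on with
  | _ k ih =>
    rcases lt_or_ge k n with hk | hk
    · exact ⟨k, hk, rfl⟩
    · have h1 : f^[k] x = f^[k - (n - m)] x := by
        obtain ⟨l, rfl⟩ := Nat.exists_eq_add_of_le' hk
        rw [show l + n - (n - m) = l + m by omega, Function.iterate_add_apply,
          Function.iterate_add_apply, hmn]
      change f^[k] x ∈ _
      rw [h1]
      exact ih _ (by omega)

theorem iterate_back {x : X} {e : ℤ × ℤ} (he : UnitVec e) (n : ℕ)
    (h : ∀ k < n, Clean ρ ((ρ e)^[k] x)) : (ρ (-e))^[n] ((ρ e)^[n] x) = x := by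
  induction n with
  | zero => rfl
  | succ n ih =>
    rw [Function.iterate_succ_apply, Function.iterate_succ_apply' (ρ e),
      (h n (Nat.lt_succ_self n) e he).1]
    exact ih fun k hk => h k (by omega)

theorem exists_infinite_split {L : Set ℕ} (hL : L.Infinite) :
    ∃ T ⊆ L, T.Infinite ∧ (L \ T).Infinite := by
  classical
  have : Infinite L := hL.to_subtype
  let f := Nat.orderEmbeddingOfSet L
  refine ⟨Set.range fun n => f (2 * n), ?_, ?_, ?_⟩
  · rintro _ ⟨n, rfl⟩
    exact Nat.orderEmbeddingOfSet_range L ▸ Set.mem_range_self (2 * n)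
  · refine Set.infinite_range_of_injective fun a b h => ?_
    have := f.injective h
    omega
  · refine (Set.infinite_range_of_injective (f := fun n => f (2 * n + 1)) fun a b h => ?_).mono ?_
    · have := f.injective h
      omega
    · rintro _ ⟨n, rfl⟩
      refine ⟨Nat.orderEmbeddingOfSet_range L ▸ Set.mem_range_self (2 * n + 1), ?_⟩
      rintro ⟨k, hk⟩
      have := f.injective hk
      omega

/-- Some orbit of the first generator contains a ray. Otherwise all its orbits are finite, with
finitely many orbits of each given length by near freeness, and the length is preserved by both
generators up to finitely many exceptions: this contradicts 1-endedness. -/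
theorem exists_injective_iterate (hρ : NearRep ρ) (hf : FreeRep ρ) (h1 : OneEndedRep ρ) :
    ∃ e, (e = (1, 0) ∨ e = (-1, 0)) ∧ ∃ x, Function.Injective fun n => (ρ e)^[n] x := by
  obtain ⟨hX, hA⟩ := h1
  by_contra! hc
  have hn := fun x => finite_range_iterate (hc _ (Or.inr rfl) x)
  have u1 : UnitVec (1, 0) := by simp [UnitVec]
  let W : Set X := ⋃ d ∈ {x | ¬ Clean ρ x}, Set.range fun n => (ρ (-1, 0))^[n] d
  have hW : W.Finite := hρ.eventually_clean.biUnion fun d _ => hn d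
  -- outside `W`, the forward orbits consist of clean points
  have hcl : ∀ x, x ∉ W → ∀ n, Clean ρ ((ρ (1, 0))^[n] x) := by
    intro x hx
    by_contra! hk
    classical
    refine hx (Set.mem_biUnion (Nat.find_spec hk) ⟨Nat.find hk, ?_⟩)
    have := iterate_back u1 (Nat.find hk) fun k hkk => not_not.1 (Nat.find_min hk hkk)
    simpa using this
  let l : X → ℕ := Function.minimalPeriod (ρ (1, 0))
  have hl : ∀ x, x ∉ W → 0 < l x := by
    intro x hx
    obtain ⟨m, n, hmn, hlt⟩ : ∃ m n, (ρ (1, 0))^[m] x = (ρ (1, 0))^[n] x ∧ m < n := by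
      have := hc _ (Or.inl rfl) x
      simp only [Function.Injective, not_forall] at this
      obtain ⟨m, n, h1, h2⟩ := this
      rcases lt_or_gt_of_ne h2 with h3 | h3
      · exact ⟨m, n, h1, h3⟩
      · exact ⟨n, m, h1.symm, h3⟩
    refine Function.IsPeriodicPt.minimalPeriod_pos (n := n - m) (by omega) ?_
    have h2 := iterate_back u1 m fun k _ => hcl x hx k
    have h3 := iterate_back (x := (ρ (1, 0))^[n - m] x) u1 m fun k _ => by
      rw [← Function.iterate_add_apply]
      exact hcl x hx _
    rw [← Function.iterate_add_apply, Nat.add_sub_cancel' hlt.le, ← hmn, h2] at h3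
    exact h3.symm
  have hstep : ∀ x, x ∉ W → ∀ e, UnitVec e → l (ρ e x) = l x := by
    intro x hx e he
    have hcomm : ∀ n, (ρ (1, 0))^[n] (ρ e x) = ρ e ((ρ (1, 0))^[n] x) := by
      intro n
      induction n with
      | zero => rfl
      | succ n ih =>
        rw [Function.iterate_succ_apply', ih, Function.iterate_succ_apply',
          (hcl x hx n e he).2 _ u1]
    refine Function.minimalPeriod_eq_minimalPeriod_iff.2 fun n => ?_
    unfold Function.IsPeriodicPt Function.IsFixedPt
    rw [hcomm]
    refine ⟨fun h => ?_, fun h => by rw [h]⟩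
    rw [← (hcl x hx n e he).1, h]
    exact (hcl x hx 0 e he).1
  have hfib : ∀ p, 0 < p → {x | l x = p}.Finite := by
    intro p hp
    have h1 : ∀ᶠ x in cofinite, ¬ l x = p := by
      filter_upwards [hρ.iterate (1, 0) p, hf (p • (1, 0)) (by simp; omega)] with x h1 h2 h3
      rw [← h1, ← h3] at h2
      exact h2 (Function.iterate_minimalPeriod)
    simpa [Filter.eventually_cofinite] using h1
  have hL : (l '' Wᶜ).Infinite := by
    intro hfin
    refine hW.infinite_compl ((hfin.biUnion (t := fun p => {x | x ∉ W ∧ l x = p}) ?_).subset ?_)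
    · rintro _ ⟨x, hx, rfl⟩
      exact (hfib _ (hl x hx)).subset fun y hy => hy.2
    · intro x hx
      exact Set.mem_biUnion ⟨x, hx, rfl⟩ ⟨hx, rfl⟩
  obtain ⟨T, hTL, hT, hT'⟩ := exists_infinite_split hL
  rcases hA {x | l x ∈ T} (fun e he => by
    filter_upwards [show ∀ᶠ x in cofinite, x ∉ W by simpa [Filter.eventually_cofinite] using hW]
      with x hx (h : l x ∈ T)
    rwa [hstep x hx e he]) with h | h
  · refine hT ((h.image l).subset fun p hp => ?_)
    obtain ⟨x, _, rfl⟩ := hTL hp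
    exact ⟨x, hp, rfl⟩
  · refine hT' ((h.image l).subset fun p hp => ?_)
    obtain ⟨x, _, rfl⟩ := hp.1
    exact ⟨x, hp.2, rfl⟩

/-- A ray in the direction of the first generator yields an upper half-plane, filled by translates
of this ray. -/
theorem exists_chart_of_ray (hρ : NearRep ρ) (hf : FreeRep ρ) {x : X}
    (hx : Function.Injective fun n => (ρ (1, 0))^[n] x) : ∃ c n, IsChart ρ c 0 n := by
  set r : ℕ → X := fun n => (ρ (1, 0))^[n] x with hr
  have hlim : Tendsto r atTop cofinite := by
    rw [← Nat.cofinite_eq_atTop]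
    exact hx.tendsto_cofinite
  have hsucc : ∀ n k, r (n + k) = (ρ (1, 0))^[k] (r n) := by
    intro n k
    rw [hr, add_comm]
    exact Function.iterate_add_apply _ _ _ _
  let c : ℤ × ℤ → X := fun v => ρ (0, v.2) (r v.1.toNat)
  have hev : ∀ y : ℤ, ∃ I : ℕ, ∀ n ≥ I, Clean ρ (ρ (0, y) (r n)) ∧
      ρ (1, 0) (ρ (0, y) (r n)) = ρ (0, y) (r (n + 1)) ∧
      ρ (0, 1) (ρ (0, y) (r n)) = ρ (0, y + 1) (r n) ∧
      ρ (0, -1) (ρ (0, y) (r n)) = ρ (0, y - 1) (r n) := by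
    intro y
    refine eventually_atTop.1 ?_
    filter_upwards [hlim.eventually ((hρ.tendsto (0, y)).eventually hρ.eventually_clean),
      hlim.eventually (hρ.comm (1, 0) (0, y)), hlim.eventually (hρ.add (0, 1) (0, y)),
      hlim.eventually (hρ.add (0, -1) (0, y))] with n h1 h2 h3 h4
    refine ⟨h1, ?_, ?_, ?_⟩
    · rw [h2, hsucc n 1]
      rfl
    · rw [← h3]
      simp [add_comm]
    · rw [← h4]
      simp [neg_add_eq_sub]
  choose I hI using hev
  have hinj : ∀ y y' : ℤ, ∀ n ≥ I y, ∀ n' ≥ I y', n ≤ n' →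
      ρ (0, y) (r n) = ρ (0, y') (r n') → n = n' ∧ y = y' := by
    intro y y' n hn n' hn' hnn h
    have key : ∀ k, ρ (0, y) (r (n + k)) = ρ (0, y') (r (n' + k)) := by
      intro k
      induction k with
      | zero => exact h
      | succ k ih =>
        rw [← add_assoc, ← add_assoc, ← (hI y (n + k) (by omega)).2.1,
          ← (hI y' (n' + k) (by omega)).2.1, ih]
    obtain ⟨d, rfl⟩ := Nat.exists_eq_add_of_le hnn
    by_contra hc
    have hne : ((0, y) : ℤ × ℤ) ≠ (0, y') + d • (1, 0) := by
      intro h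
      simp at h
      omega
    have hlim' : Tendsto (fun k => r (n + k)) atTop cofinite :=
      hlim.comp (tendsto_atTop_mono (fun k => Nat.le_add_left k n) tendsto_id)
    obtain ⟨k, h1, h2, h3⟩ := (hlim'.eventually ((hf.ne hρ hne).and
      ((hρ.add (0, y') (d • (1, 0))).and (hρ.iterate (1, 0) d)))).exists
    rw [h2, ← h3, ← hsucc, show n + k + d = n + d + k by ring] at h1
    exact h1 (key k)
  have heq : EquivariantOn ρ c {v | 0 ≤ v.2 ∧ (I v.2 : ℤ) ≤ v.1} := by
    rintro ⟨p, y⟩ hv e he hve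
    obtain ⟨n, rfl⟩ := Int.eq_ofNat_of_zero_le ((Int.natCast_nonneg _).trans hv.2)
    have hn : I y ≤ n := by simpa using hv.2
    rcases he with rfl | rfl | rfl | rfl
    · simpa [c] using (hI y n hn).2.1
    · have h1 : (I y : ℤ) ≤ n + -1 := by simpa using hve.2
      obtain ⟨k, rfl⟩ : ∃ k, n = k + 1 := ⟨n - 1, by omega⟩
      have h2 := hI y k (by omega)
      have h3 := (h2.1 (1, 0) (by simp [UnitVec])).1
      rw [h2.2.1] at h3
      simpa [c] using h3
    · simpa [c] using (hI y n hn).2.2.1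
    · simpa [c, sub_eq_add_neg] using (hI y n hn).2.2.2
  have hinj' : Set.InjOn c {v | 0 ≤ v.2 ∧ (I v.2 : ℤ) ≤ v.1} := by
    rintro ⟨p, y⟩ hv ⟨q, z⟩ hw hvw
    obtain ⟨n, rfl⟩ := Int.eq_ofNat_of_zero_le ((Int.natCast_nonneg _).trans hv.2)
    obtain ⟨k, rfl⟩ := Int.eq_ofNat_of_zero_le ((Int.natCast_nonneg _).trans hw.2)
    have hn : I y ≤ n := by simpa using hv.2
    have hk : I z ≤ k := by simpa using hw.2
    replace hvw : ρ (0, y) (r n) = ρ (0, z) (r k) := by simpa [c] using hvw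
    rcases le_total n k with h | h
    · obtain ⟨rfl, rfl⟩ := hinj y z n hn k hk h hvw
      rfl
    · obtain ⟨rfl, rfl⟩ := hinj z y k hk n hn h hvw.symm
      rfl
  have hcl : ∀ v : ℤ × ℤ, 0 ≤ v.2 → (I v.2 : ℤ) ≤ v.1 → Clean ρ (c v) := by
    rintro ⟨p, y⟩ - (hv : (I y : ℤ) ≤ p)
    obtain ⟨n, rfl⟩ := Int.eq_ofNat_of_zero_le ((Int.natCast_nonneg _).trans hv)
    exact (hI y n (by simpa using hv)).1
  obtain ⟨N, c', -, hc', -⟩ := hρ.exists_extension (I := fun y => I y) heq hinj' hcl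
  exact ⟨c', N, hc'⟩

end Initial

/-! ### Developments -/

section Developments

variable {X : Type u} {ρ : ℤ × ℤ → X → X}

/-- A sequence of charts on half-planes that turn counterclockwise, each of them coinciding with
the next one in the depth of the corner where both are defined. -/
structure Development (ρ : ℤ × ℤ → X → X) (c : ℕ → ℤ × ℤ → X) : Prop where
  chart : ∀ j, ∃ n, IsChart ρ (c j) j n
  agree : ∀ j, ∃ n, ∀ v, n ≤ ht j v → n ≤ ht (j + 1) v → c j v = c (j + 1) v

/-- The map `c` coincides with the translate of `c'` by `t` in the depth of the half-planes of
type `j`. -/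
def Shift (j : ℕ) (c c' : ℤ × ℤ → X) (t : ℤ × ℤ) : Prop :=
  ∃ n, ∀ v, n ≤ ht j v → c v = c' (v + t)

theorem Shift.refl (j : ℕ) (c : ℤ × ℤ → X) : Shift j c c 0 := ⟨0, fun v _ => by rw [add_zero]⟩

theorem Shift.symm {j : ℕ} {c c' : ℤ × ℤ → X} {t : ℤ × ℤ} (h : Shift j c c' t) :
    Shift j c' c (-t) := by
  obtain ⟨n, hn⟩ := h
  refine ⟨n + ht j t, fun v hv => ?_⟩
  rw [hn (v + -t) (by rw [ht_add, ht_neg]; omega), neg_add_cancel_right]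

theorem Shift.trans {j : ℕ} {c c' c'' : ℤ × ℤ → X} {t t' : ℤ × ℤ} (h : Shift j c c' t)
    (h' : Shift j c' c'' t') : Shift j c c'' (t + t') := by
  obtain ⟨n, hn⟩ := h
  obtain ⟨n', hn'⟩ := h'
  refine ⟨max n (n' - ht j t), fun v hv => ?_⟩
  have h1 := le_max_left n (n' - ht j t)
  have h2 := le_max_right n (n' - ht j t)
  rw [hn v (by omega), hn' _ (by rw [ht_add]; omega), add_assoc]

theorem Shift.congr_mod {i j : ℕ} (hij : i % 4 = j % 4) {c c' : ℤ × ℤ → X} {t : ℤ × ℤ}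
    (h : Shift i c c' t) : Shift j c c' t := by
  obtain ⟨n, hn⟩ := h
  exact ⟨n, fun v hv => hn v (by rwa [ht_congr hij])⟩

theorem IsChart.shift_of_eq {j : ℕ} {c c' : ℤ × ℤ → X} {n n' : ℤ} (h : IsChart ρ c j n)
    (h' : IsChart ρ c' j n') {t v : ℤ × ℤ} (hv : n ≤ ht j v) (hv' : n' ≤ ht j (v + t))
    (hcv : c v = c' (v + t)) : Shift j c c' t := by
  rw [ht_add] at hv'
  refine ⟨max n (n' - ht j t), fun w hw => ?_⟩
  exact EquivariantOn.eqOn (stepConnected_halfPlane j _)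
    (h.mono (le_max_left n (n' - ht j t))).equivariantOn
    ((h'.translate t).mono (le_max_right n (n' - ht j t))).equivariantOn
    (v := v) (max_le hv (by omega)) hcv w hw

theorem IsChart.eq_zero_of_shift {j : ℕ} {c : ℤ × ℤ → X} {n : ℤ} (h : IsChart ρ c j n)
    {t : ℤ × ℤ} (ht' : Shift j c c t) : t = 0 := by
  obtain ⟨n', hn'⟩ := ht'
  obtain ⟨v, hv, -⟩ := exists_ht_eq j (max n' (max n (n - ht j t))) 0
  have h1 := le_max_left n' (max n (n - ht j t))
  have h2 := (le_max_left n (n - ht j t)).trans (le_max_right n' _)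
  have h3 := (le_max_right n (n - ht j t)).trans (le_max_right n' _)
  have := h.injOn (by rw [mem_halfPlane]; omega) (by rw [mem_halfPlane, ht_add]; omega)
    (hn' v (by omega))
  simpa using this

/-- Forgetting the first `k` turns of a development. -/
theorem Development.tail {c : ℕ → ℤ × ℤ → X} (hc : Development ρ c) (k : ℕ) :
    Development ρ fun j => c (4 * k + j) where
  chart j := by
    obtain ⟨n, hn⟩ := hc.chart (4 * k + j)
    exact ⟨n, hn.congr_mod (by omega)⟩
  agree j := by
    obtain ⟨n, hn⟩ := hc.agree (4 * k + j)
    refine ⟨n, fun v hv hv' => hn v ?_ ?_⟩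
    · rwa [ht_congr (show (4 * k + j) % 4 = j % 4 by omega)]
    · rwa [ht_congr (show (4 * k + j + 1) % 4 = (j + 1) % 4 by omega)]

theorem NearRep.exists_development (hρ : NearRep ρ) {c₀ : ℤ × ℤ → X} {n : ℤ}
    (h : IsChart ρ c₀ 0 n) : ∃ c, Development ρ c ∧ c 0 = c₀ := by
  have step : ∀ j (c : {c // ∃ n, IsChart ρ c j n}), ∃ c' : {c // ∃ n, IsChart ρ c (j + 1) n},
      ∃ n, ∀ v, n ≤ ht j v → n ≤ ht (j + 1) v → c.1 v = c'.1 v := by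
    rintro j ⟨c, n, hc⟩
    obtain ⟨N, c', hc', h'⟩ := hρ.exists_halfPlane_of_corner (c := c) (j := j) (n := n)
      (hc.equivariantOn.mono fun v hv => hv.1) (hc.injOn.mono fun v hv => hv.1)
    exact ⟨⟨c', N, hc'⟩, N, fun v hv hv' => (h' v hv hv').symm⟩
  choose f hf using step
  let c : ∀ j, {c // ∃ n, IsChart ρ c j n} := fun j => Nat.rec ⟨c₀, n, h⟩ f j
  exact ⟨fun j => (c j).1, ⟨fun j => (c j).2, fun j => hf j (c j)⟩, rfl⟩

/-- A development is determined by any of its terms: the next term coincides with it in a corner,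
hence is known in a half-plane. -/
theorem Development.shift_add {c c' : ℕ → ℤ × ℤ → X} (hc : Development ρ c)
    (hc' : Development ρ c') {i i' : ℕ} (hi : i % 4 = i' % 4) {t : ℤ × ℤ}
    (h : Shift i (c i) (c' i') t) (l : ℕ) : Shift (i + l) (c (i + l)) (c' (i' + l)) t := by
  induction l with
  | zero => exact h
  | succ l ih =>
    obtain ⟨n₁, h₁⟩ := ih
    obtain ⟨n₂, h₂⟩ := hc.agree (i + l)
    obtain ⟨n₃, h₃⟩ := hc'.agree (i' + l)
    obtain ⟨n₄, h₄⟩ := hc.chart (i + l + 1)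
    obtain ⟨n₅, h₅⟩ := hc'.chart (i' + l + 1)
    have e0 : ∀ v, ht (i' + l) v = ht (i + l) v := fun v => ht_congr (by omega) v
    have e1 : ∀ v, ht (i' + l + 1) v = ht (i + l + 1) v := fun v => ht_congr (by omega) v
    obtain ⟨N, hN⟩ : ∃ N, n₁ ≤ N ∧ n₂ ≤ N ∧ n₃ - ht (i + l) t ≤ N ∧ n₃ - ht (i + l + 1) t ≤ N ∧
        n₄ ≤ N ∧ n₅ - ht (i + l + 1) t ≤ N :=
      ⟨max n₁ (max n₂ (max (n₃ - ht (i + l) t) (max (n₃ - ht (i + l + 1) t)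
        (max n₄ (n₅ - ht (i + l + 1) t))))), by simp only [le_max_iff, le_refl, true_or, or_true,
          and_self]⟩
    obtain ⟨v, hv, hv'⟩ := exists_ht_eq (i + l) N N
    refine h₄.shift_of_eq (h₅.congr_mod (j := i + l + 1) (by omega)) (v := v) ?_ ?_ ?_
    · omega
    · rw [ht_add]; omega
    · rw [← h₂ v (by omega) (by omega), h₁ v (by omega),
        h₃ _ (by rw [ht_add, e0, e0]; omega) (by rw [ht_add, e1, e1]; omega)]

/-- The development returns to its initial half-plane for the first time after `m` turns, after
which the coordinates have been translated by `s`. -/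
structure HasPeriod (c : ℕ → ℤ × ℤ → X) (m : ℕ) (s : ℤ × ℤ) : Prop where
  pos : 1 ≤ m
  shift : Shift 0 (c (4 * m)) (c 0) (-s)
  minimal : ∀ k, 0 < k → k < m → ∀ t, ¬ Shift 0 (c (4 * k)) (c 0) t

theorem Development.shift_period {c : ℕ → ℤ × ℤ → X} (hc : Development ρ c) {m : ℕ}
    {s : ℤ × ℤ} (hm : Shift 0 (c (4 * m)) (c 0) (-s)) (i k : ℕ) :
    Shift i (c (i + 4 * (m * k))) (c i) (-(k • s)) := by
  have one : ∀ i, Shift i (c (i + 4 * m)) (c i) (-s) := by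
    intro i
    have := hc.shift_add hc (i := 4 * m) (i' := 0) (by omega) (hm.congr_mod (by omega)) i
    rw [Nat.zero_add, Nat.add_comm] at this
    exact this.congr_mod (by omega)
  induction k with
  | zero => simpa using Shift.refl i (c i)
  | succ k ih =>
    have := ((one (i + 4 * (m * k))).congr_mod (by omega)).trans ih
    rw [show i + 4 * (m * (k + 1)) = i + 4 * (m * k) + 4 * m by ring, succ_nsmul', neg_add]
    exact this

/-- The only coincidences between the half-planes of a development are given by its period. -/
theorem Development.eq_of_shift {c : ℕ → ℤ × ℤ → X} (hc : Development ρ c) {m : ℕ}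
    {s : ℤ × ℤ} (hm : HasPeriod c m s) {i j : ℕ} (hij : i ≤ j) (hmod : i % 4 = j % 4)
    {t : ℤ × ℤ} (h : Shift i (c j) (c i) t) : ∃ k : ℕ, j = i + 4 * (m * k) ∧ t = -(k • s) := by
  obtain ⟨q, rfl⟩ : ∃ q, j = i + 4 * q := ⟨(j - i) / 4, by omega⟩
  have hpos := hm.pos
  obtain ⟨r, k, hr, rfl⟩ : ∃ r k, r < m ∧ q = r + m * k :=
    ⟨q % m, q / m, Nat.mod_lt _ hpos, (Nat.mod_add_div q m).symm⟩
  have h1 := hc.shift_period hm.shift (i + 4 * r) k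
  rw [show i + 4 * r + 4 * (m * k) = i + 4 * (r + m * k) by ring] at h1
  have h2 : Shift i (c (i + 4 * r)) (c i) (k • s + t) := by
    have := (h1.congr_mod (j := i) (by omega)).symm.trans h
    rwa [neg_neg] at this
  -- go forward to a multiple of the period
  have h3 := hc.shift_add hc (i := i + 4 * r) (i' := i) (by omega)
    (h2.congr_mod (by omega)) (4 * (m * i) - i)
  have hmi : i ≤ m * i := Nat.le_mul_of_pos_left i hpos
  rw [show i + 4 * r + (4 * (m * i) - i) = 4 * r + 4 * (m * i) by omega,
    show i + (4 * (m * i) - i) = 0 + 4 * (m * i) by omega] at h3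
  have h4 := (hc.shift_period hm.shift (4 * r) i).congr_mod (j := 0) (by omega)
  have h5 := hc.shift_period hm.shift 0 i
  have h6 := (h4.symm.trans ((h3.congr_mod (by omega)).trans h5))
  have hr0 : r = 0 := by
    by_contra hr0
    exact hm.minimal r (Nat.pos_of_ne_zero hr0) hr _ h6
  subst hr0
  obtain ⟨n, hn⟩ := hc.chart i
  have h7 := hn.eq_zero_of_shift h2
  refine ⟨k, by ring, ?_⟩
  rw [eq_neg_iff_add_eq_zero, add_comm, h7]

end Developments

/-! ### Periodicity of developments -/

section Periodicity

variable {X : Type u} {ρ : ℤ × ℤ → X → X}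

/-- An upper half-plane is continued downwards, row by row, either forever, or until a row meets
the finite set of points that are not clean. -/
theorem exists_extend_down (c : ℤ × ℤ → X) (n : ℤ) (h : IsChart ρ c 0 n) :
    ∃ c' : ℤ × ℤ → X, (∀ v, n ≤ ht 0 v → c' v = c v) ∧ (EquivariantOn ρ c' Set.univ ∨
      ∃ v, EquivariantOn ρ c' (halfPlane 0 (ht 0 v)) ∧
        (¬ Clean ρ (c' v) ∨ ∃ d, ¬ Clean ρ d ∧ c' v = ρ (0, 1) d)) := by
  classical
  have d1 : UnitVec (0, -1) := by simp [UnitVec]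
  have d2 : UnitVec (0, 1) := by simp [UnitVec]
  let c' : ℤ × ℤ → X := fun v =>
    if n ≤ v.2 then c v else (ρ (0, -1))^[(n - v.2).toNat] (c (v.1, n))
  have hc1 : ∀ x y, n ≤ y → c' (x, y) = c (x, y) := fun x y h => if_pos h
  have hc2 : ∀ x (k : ℕ), c' (x, n - k) = (ρ (0, -1))^[k] (c (x, n)) := by
    intro x k
    rcases Nat.eq_zero_or_pos k with rfl | hk
    · simpa using hc1 x n le_rfl
    · have : ¬ n ≤ n - k := by omega
      simp only [c', this, if_false]
      congr 2
      omega
  have hdown : ∀ x y, c' (x, y - 1) = ρ (0, -1) (c' (x, y)) := by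
    intro x y
    rcases le_or_gt y n with h' | h'
    · obtain ⟨k, hk⟩ := Int.eq_ofNat_of_zero_le (sub_nonneg.2 h')
      have h1 := hc2 x k
      have h2 := hc2 x (k + 1)
      rw [Function.iterate_succ_apply', ← h1] at h2
      rw [show y = n - k by omega, ← h2]
      congr 2
      push_cast
      ring
    · rw [hc1 _ _ (by omega), hc1 _ _ h'.le, h.equivariantOn (x, y)
        (show n ≤ y from h'.le) _ d1 (show n ≤ y + -1 by omega)]
      simp [sub_eq_add_neg]
  -- equivariance holds above `y₀` as soon as the rows above `y₀` and below `n` are clean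
  have key : ∀ S : Set (ℤ × ℤ), (∀ x y y', (x, y) ∈ S → y ≤ y' → (x, y') ∈ S) →
      (∀ x y, (x, y) ∈ S → ∀ x', (x', y) ∈ S) →
      (∀ x y, (x, y) ∈ S → y < n → Clean ρ (c' (x, y + 1))) → EquivariantOn ρ c' S := by
    intro S hS hS' hcl
    have hH : ∀ e, UnitVec (e, 0) → ∀ x y, (x, y) ∈ S →
        ρ (e, 0) (c' (x, y)) = c' (x + e, y) := by
      intro e he x y
      rcases le_total n y with h' | h'
      · intro _
        rw [hc1 _ _ h', hc1 _ _ h', h.equivariantOn (x, y) h' _ he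
          (show n ≤ y + 0 by omega)]
        simp
      · induction y, h' using Int.leInductionDown with
        | base =>
          intro _
          rw [hc1 _ _ le_rfl, hc1 _ _ le_rfl, h.equivariantOn (x, n) (le_refl n) _ he
            (show n ≤ n + 0 by omega)]
          simp
        | pred y hy ih =>
          intro hxy
          have h1 := hcl _ _ hxy (by omega)
          rw [sub_add_cancel] at h1
          rw [hdown, hdown, (h1 _ d1).2 _ he |>.symm, ih (hS _ _ _ hxy (by omega))]
    rintro ⟨x, y⟩ hxy e he hxye
    rcases he with rfl | rfl | rfl | rfl
    · simpa using hH 1 (by simp [UnitVec]) x y hxy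
    · simpa using hH (-1) (by simp [UnitVec]) x y hxy
    · rcases le_or_gt n y with h' | h'
      · rw [hc1 _ _ h', h.equivariantOn (x, y) h' _ d2 (show n ≤ y + 1 by omega)]
        simpa using (hc1 x (y + 1) (by omega)).symm
      · have h1 := ((hcl _ _ hxy h') _ d1).1
        have h2 := hdown x (y + 1)
        rw [add_sub_cancel_right] at h2
        rw [← h2] at h1
        simpa using h1
    · simpa [sub_eq_add_neg] using (hdown x y).symm
  refine ⟨c', fun v hv => hc1 _ _ hv, ?_⟩
  by_cases hk : ∃ k : ℕ, ∃ x, ¬ Clean ρ (c' (x, n - k))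
  · right
    obtain ⟨x, hx⟩ := Nat.find_spec hk
    have hmin := fun k => Nat.find_min (m := k) hk
    generalize Nat.find hk = K at hx hmin
    rcases Nat.eq_zero_or_pos K with rfl | hK
    · refine ⟨(x, n), ?_, Or.inl (by simpa using hx)⟩
      exact key _ (fun x y y' hy hyy => le_trans (show n ≤ y from hy) hyy) (fun x y hy x' => hy)
        fun x y hy hy' => absurd (show n ≤ y from hy) (by omega)
    · refine ⟨(x, n - K + 1), ?_, Or.inr ⟨_, hx, ?_⟩⟩
      · refine key _ (fun x y y' hy hyy => le_trans (show n - K + 1 ≤ y from hy) hyy)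
          (fun x y hy x' => hy) fun x y hy hy' => ?_
        replace hy : n - K + 1 ≤ y := hy
        have := hmin (n - (y + 1)).toNat (by omega)
        rw [not_exists] at this
        have := not_not.1 (this x)
        rwa [show n - ((n - (y + 1)).toNat : ℤ) = y + 1 by omega] at this
      · have h1 := hmin (K - 1) (by omega)
        rw [not_exists] at h1
        have h2 := not_not.1 (h1 x)
        rw [show n - ((K - 1 : ℕ) : ℤ) = n - K + 1 by omega] at h2
        have h3 := (h2 _ d1).1
        rw [← hdown, add_sub_cancel_right] at h3
        simpa using h3.symm
  · left
    push Not at hk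
    refine key _ (fun _ _ _ _ _ => trivial) (fun _ _ _ _ => trivial) fun x y _ hy => ?_
    have := hk (n - (y + 1)).toNat x
    rwa [show n - ((n - (y + 1)).toNat : ℤ) = y + 1 by omega] at this

theorem EquivariantOn.injective_of_injOn {c : ℤ × ℤ → X} (h : EquivariantOn ρ c Set.univ) {n : ℤ}
    (hinj : Set.InjOn c (halfPlane 0 n)) : Function.Injective c := by
  intro v w hvw
  have key : ∀ k : ℕ, c (v + k • (0, 1)) = c (w + k • (0, 1)) := by
    intro k
    induction k with
    | zero => simpa using hvw
    | succ k ih =>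
      rw [succ_nsmul, ← add_assoc, ← add_assoc, ← h _ trivial (0, 1) (by simp [UnitVec]) trivial,
        ← h _ trivial (0, 1) (by simp [UnitVec]) trivial, ih]
  have := hinj (x₁ := v + (max (n - v.2) (n - w.2)).toNat • (0, 1))
    (x₂ := w + (max (n - v.2) (n - w.2)).toNat • (0, 1))
    (by simp [mem_halfPlane, ht]; omega) (by simp [mem_halfPlane, ht]; omega) (key _)
  simpa using this

/-- Up to translation, there are finitely many upper half-planes: the continuation downwards of an
upper half-plane stops near the finite set of points that are not clean, unless it fills a plane,
all of whose turns are trivial. -/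
theorem Development.exists_shift (hρ : NearRep ρ) {c : ℕ → ℤ × ℤ → X} (hc : Development ρ c) :
    ∃ k l t, k < l ∧ Shift 0 (c (4 * l)) (c (4 * k)) t := by
  choose n hn using fun k => hc.chart (4 * k)
  have hn' : ∀ k, IsChart ρ (c (4 * k)) 0 (n k) := fun k => (hn k).congr_mod (by omega)
  choose d hd hd' using fun k => exists_extend_down (c (4 * k)) (n k) (hn' k)
  have hs : ∀ k, Shift 0 (c (4 * k)) (d k) 0 :=
    fun k => ⟨n k, fun v hv => by rw [add_zero, hd k v hv]⟩
  by_cases hplane : ∃ k, EquivariantOn ρ (d k) Set.univ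
  · obtain ⟨k, hk⟩ := hplane
    have hinj : Function.Injective (d k) := by
      refine hk.injective_of_injOn (n := n k) fun v hv w hw hvw => (hn' k).injOn hv hw ?_
      rwa [← hd k v hv, ← hd k w hw]
    have hdev : Development ρ fun _ => d k :=
      ⟨fun j => ⟨0, hk.mono (Set.subset_univ _), hinj.injOn⟩, fun j => ⟨0, fun _ _ _ => rfl⟩⟩
    have h1 := hc.shift_add hdev (i := 4 * k) (i' := 0) (by omega)
      ((hs k).congr_mod (by omega)) 4
    refine ⟨k, k + 1, 0, by omega, ?_⟩
    have := (h1.congr_mod (j := 0) (by omega)).trans (hs k).symm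
    simpa [mul_add] using this
  · have hd'' := fun k => (hd' k).resolve_left fun h => hplane ⟨k, h⟩
    choose v hv hv' using hd''
    have hfin : ({x | ¬ Clean ρ x} ∪ ρ (0, 1) '' {x | ¬ Clean ρ x}).Finite :=
      Set.Finite.union hρ.eventually_clean (Set.Finite.image _ hρ.eventually_clean)
    have hmaps : Set.MapsTo (fun k => d k (v k)) Set.univ
        ({x | ¬ Clean ρ x} ∪ ρ (0, 1) '' {x | ¬ Clean ρ x}) := by
      intro k _
      rcases hv' k with h | ⟨z, hz, h⟩
      · exact Or.inl h
      · exact Or.inr ⟨z, hz, h.symm⟩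
    obtain ⟨k, -, l, -, hkl, heq⟩ := Set.infinite_univ.exists_lt_map_eq_of_mapsTo hmaps hfin
    refine ⟨k, l, v k - v l, hkl, ?_⟩
    have h1 : Shift 0 (d l) (d k) (v k - v l) := by
      refine ⟨ht 0 (v l), fun w hw => ?_⟩
      refine EquivariantOn.eqOn (c' := fun w => d k (w + (v k - v l)))
        (stepConnected_halfPlane 0 _) (hv l) ?_ (v := v l) (mem_halfPlane.2 le_rfl)
        (by simp [heq]) w hw
      intro u hu e he hue
      have := hv k (u + (v k - v l))
        (by rw [mem_halfPlane] at *; rw [ht_add, ht_sub]; omega) e he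
        (by rw [mem_halfPlane] at *; rw [ht_add, ht_add, ht_sub]; rw [ht_add] at hue; omega)
      rw [this]
      congr 1
      abel
    have := ((hs l).trans h1).trans (hs k).symm
    simpa using this

/-- Every near free 1-ended near `ℤ²`-set has a periodic development. -/
theorem exists_hasPeriod (hρ : NearRep ρ) (hf : FreeRep ρ) (h1 : OneEndedRep ρ) :
    ∃ c m s, Development ρ c ∧ HasPeriod c m s := by
  obtain ⟨c₀, n, hc₀⟩ : ∃ c n, IsChart ρ c 0 n := by
    obtain ⟨e, he, x, hx⟩ := exists_injective_iterate hρ hf h1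
    rcases he with rfl | rfl
    · exact exists_chart_of_ray hρ hf hx
    · -- after a half turn, the ray yields a lower half-plane, followed by an upper one
      have hf' : FreeRep fun g => ρ (rotPow 2 g) := fun g hg => hf _ (by simpa using hg)
      obtain ⟨c, n, hc⟩ := exists_chart_of_ray (hρ.twist (rotPow 2)) hf' (x := x) hx
      have h2 : IsChart ρ (fun v => c ((rotPow 2).symm v)) (0 + 2) n :=
        IsChart.of_twist (by simpa using hc)
      obtain ⟨N, c', hc', -⟩ := hρ.exists_halfPlane_of_corner
        (h2.equivariantOn.mono fun v hv => hv.1) (h2.injOn.mono fun v hv => hv.1)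
      obtain ⟨N', c'', hc'', -⟩ := hρ.exists_halfPlane_of_corner
        (hc'.equivariantOn.mono fun v hv => hv.1) (hc'.injOn.mono fun v hv => hv.1)
      exact ⟨c'', N', hc''.congr_mod (by norm_num)⟩
  obtain ⟨c, hc, -⟩ := hρ.exists_development hc₀
  obtain ⟨k, l, t, hkl, ht'⟩ := hc.exists_shift hρ
  classical
  let d : ℕ → ℤ × ℤ → X := fun j => c (4 * k + j)
  have hex : ∃ m, 0 < m ∧ ∃ t, Shift 0 (d (4 * m)) (d 0) t := by
    refine ⟨l - k, by omega, t, ?_⟩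
    simp only [d]
    rw [show 4 * k + 4 * (l - k) = 4 * l by omega]
    exact ht'
  obtain ⟨hpos, s, hs⟩ := Nat.find_spec hex
  exact ⟨d, Nat.find hex, -s, hc.tail k, hpos, by simpa using hs, fun i hi hlt t hti =>
    Nat.find_min hex hlt ⟨hi, t, hti⟩⟩

end Periodicity

/-! ### Coincidences between half-planes -/

section Coincidences

variable {X : Type u} {Y : Type v} {ρ : ℤ × ℤ → X → X} {σ : ℤ × ℤ → Y → Y}

/-- If a half-plane `c` meets the half-plane `d` of the next type, then its continuation `c'` around
the corner coincides with `d`. -/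
theorem IsChart.shift_of_eq_succ {i : ℕ} {c c' d : ℤ × ℤ → X} {n n₁ n₂ n₃ : ℤ}
    (hc : IsChart ρ c i n) (hc' : IsChart ρ c' (i + 1) n₁) (hd : IsChart ρ d (i + 1) n₂)
    (h : ∀ v, n₃ ≤ ht i v → n₃ ≤ ht (i + 1) v → c v = c' v) {v w : ℤ × ℤ}
    (hv : n ≤ ht i v) (hw : n₂ ≤ ht (i + 1) w) (hvw : c v = d w) :
    Shift (i + 1) c' d (w - v) := by
  have key := EquivariantOn.eqOn (c' := fun u => d (u + (w - v)))
    (stepConnected_corner i (ht i v) (ht (i + 1) v))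
    (hc.equivariantOn.mono fun u hu => hv.trans hu.1)
    ((hd.translate (w - v)).equivariantOn.mono fun u hu => by
      rw [mem_halfPlane, ht_sub]; have := hu.2; omega)
    (v := v) ⟨le_rfl, le_rfl⟩ (by simpa using hvw)
  obtain ⟨u, hu, hu'⟩ := exists_ht_eq i (max (ht i v) n₃) (max (ht (i + 1) v) (max n₁ n₃))
  have h1 := le_max_left (ht i v) n₃
  have h2 := le_max_right (ht i v) n₃
  have h3 := le_max_left (ht (i + 1) v) (max n₁ n₃)
  have h4 := le_max_right (ht (i + 1) v) (max n₁ n₃)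
  have h5 := (le_max_left n₁ n₃).trans h4
  have h6 := (le_max_right n₁ n₃).trans h4
  refine hc'.shift_of_eq hd (v := u) (by omega) (by rw [ht_add, ht_sub]; omega) ?_
  rw [← h u (by omega) (by omega)]
  exact key u ⟨by omega, by omega⟩

/-- If a half-plane `c` meets a half-plane `d` of the opposite type, then they have a row in common,
hence the continuation `c'` of `c` around a corner coincides with the half-plane `d'` of which `d`
is the continuation. -/
theorem IsChart.shift_of_eq_add_two {i : ℕ} {c c' d d' : ℤ × ℤ → X} {N n₁ n₂ : ℤ}
    (hc : IsChart ρ c i N) (hc' : IsChart ρ c' (i + 1) n₁) (hd' : IsChart ρ d' (i + 1) n₂)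
    (hd : IsChart ρ d (i + 2) N)
    (h : ∀ v, N ≤ ht i v → N ≤ ht (i + 1) v → c v = c' v)
    (h' : ∀ v, N ≤ ht (i + 1) v → N ≤ ht (i + 2) v → d' v = d v) {v w : ℤ × ℤ}
    (hv : N ≤ ht i v) (hw : N ≤ ht (i + 2) w) (hvw : c v = d w) :
    Shift (i + 1) c' d' (w - v) := by
  have e := ht_add_two i
  have key := EquivariantOn.eqOn (c' := fun u => d (u + (w - v)))
    (stepConnected_ht i (Set.ordConnected_singleton (a := ht i v))
      (Set.ordConnected_Ici (a := ht (i + 1) v)))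
    (hc.equivariantOn.mono fun u hu => hv.trans (Eq.ge hu.1))
    ((hd.translate (w - v)).equivariantOn.mono fun u hu => by
      have h1 : ht i u = ht i v := hu.1
      rw [mem_halfPlane, ht_sub]
      rw [e] at *
      rw [e, e]
      omega)
    (v := v) ⟨rfl, Set.mem_Ici.2 le_rfl⟩ (by simpa using hvw)
  obtain ⟨M, hM⟩ : ∃ M, ht (i + 1) v ≤ M ∧ N ≤ M ∧ n₁ ≤ M ∧ N - ht (i + 1) (w - v) ≤ M ∧
      n₂ - ht (i + 1) (w - v) ≤ M :=
    ⟨max (ht (i + 1) v) (max N (max n₁ (max (N - ht (i + 1) (w - v))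
      (n₂ - ht (i + 1) (w - v))))), by simp only [le_max_iff, le_refl, true_or, or_true, and_self]⟩
  obtain ⟨u, hu, hu'⟩ := exists_ht_eq i (ht i v) M
  refine hc'.shift_of_eq hd' (v := u) (by omega) (by rw [ht_add]; omega) ?_
  rw [← h u (by omega) (by omega), h' _ (by rw [ht_add]; omega) (by
    rw [ht_add, ht_sub, e, e, e]; rw [e] at hw; omega)]
  exact key u ⟨hu, by change ht (i + 1) v ≤ _; omega⟩

/-- The half-planes `N ≤ ht j` of the first turn of the development are deep enough for the charts
to be equivariant, to coincide around corners, and to satisfy the period relation. -/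
structure Uniform (ρ : ℤ × ℤ → X → X) (c : ℕ → ℤ × ℤ → X) (m : ℕ) (s : ℤ × ℤ) (N : ℤ) :
    Prop where
  chart : ∀ j ≤ 4 * m, IsChart ρ (c j) j N
  agree : ∀ j ≤ 4 * m, ∀ v, N ≤ ht j v → N ≤ ht (j + 1) v → c j v = c (j + 1) v
  period : ∀ v, N ≤ ht 0 v → c (4 * m) v = c 0 (v - s)

theorem Uniform.mono {c : ℕ → ℤ × ℤ → X} {m : ℕ} {s : ℤ × ℤ} {N M : ℤ}
    (h : Uniform ρ c m s N) (hNM : N ≤ M) : Uniform ρ c m s M where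
  chart j hj := (h.chart j hj).mono hNM
  agree j hj v hv hv' := h.agree j hj v (hNM.trans hv) (hNM.trans hv')
  period v hv := h.period v (hNM.trans hv)

theorem Development.exists_uniform {c : ℕ → ℤ × ℤ → X} (hc : Development ρ c) {m : ℕ}
    {s : ℤ × ℤ} (hm : HasPeriod c m s) : ∃ N, Uniform ρ c m s N := by
  choose n hn using hc.chart
  choose n' hn' using hc.agree
  obtain ⟨n'', hn''⟩ := hm.shift
  obtain ⟨M, hM⟩ := ((Set.finite_Iic (4 * m)).image fun j => max (n j) (n' j)).bddAbove
  have hM' : ∀ j ≤ 4 * m, n j ≤ M ∧ n' j ≤ M := fun j hj => max_le_iff.1 (hM ⟨j, hj, rfl⟩)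
  refine ⟨max M n'', fun j hj => (hn j).mono ((hM' j hj).1.trans (le_max_left _ _)),
    fun j hj v hv hv' => hn' j v (((hM' j hj).2.trans (le_max_left _ _)).trans hv)
      (((hM' j hj).2.trans (le_max_left _ _)).trans hv'),
    fun v hv => by rw [hn'' v ((le_max_right _ _).trans hv), sub_eq_add_neg]⟩

/-- Two developments with a half-plane in common have the same period. -/
theorem HasPeriod.eq_of_shift {c d : ℕ → ℤ × ℤ → X} (hc : Development ρ c)
    (hd : Development ρ d) {m m' : ℕ} {s s' : ℤ × ℤ} (hm : HasPeriod c m s)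
    (hm' : HasPeriod d m' s') {a b : ℕ} (hab : a % 4 = b % 4) {t : ℤ × ℤ}
    (h : Shift a (c a) (d b) t) : m = m' ∧ s = s' := by
  have key : ∀ {c d : ℕ → ℤ × ℤ → X} (_ : Development ρ c) (_ : Development ρ d) {m m' : ℕ}
      {s s' : ℤ × ℤ} (_ : HasPeriod c m s) (_ : HasPeriod d m' s') {a b : ℕ}
      (_ : a % 4 = b % 4) {t : ℤ × ℤ} (_ : Shift a (c a) (d b) t),
      ∃ k : ℕ, m = m' * k ∧ s = k • s' := by
    intro c d hc hd m m' s s' hm hm' a b hab t h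
    have h1 := hc.shift_add hd hab h (4 * m)
    have h2 := hc.shift_period hm.shift a 1
    rw [mul_one, one_smul] at h2
    have h3 := ((h1.congr_mod (j := a) (by omega)).symm.trans h2).trans h
    rw [show -t + -s + t = -s by abel] at h3
    obtain ⟨k, hk, hk'⟩ := hd.eq_of_shift hm' (Nat.le_add_right b _) (by omega)
      (h3.congr_mod (j := b) hab)
    exact ⟨k, by omega, neg_injective hk'⟩
  obtain ⟨k, h1, h2⟩ := key hc hd hm hm' hab h
  obtain ⟨k', h3, h4⟩ := key hd hc hm' hm hab.symm (h.symm.congr_mod hab)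
  have hmm : m = m' := Nat.dvd_antisymm ⟨k', h3⟩ ⟨k, h1⟩
  subst hmm
  have hk : k = 1 := (Nat.mul_eq_left (Nat.pos_iff_ne_zero.1 hm.pos)).1 h1.symm
  subst hk
  exact ⟨rfl, by simpa using h2⟩

/-- The half-planes of the first turn fill the set, up to finite sets. -/
def Covers (c : ℕ → ℤ × ℤ → X) (m : ℕ) : Prop :=
  ∀ N : ℤ, ∀ᶠ x in cofinite, ∃ j < 4 * m, ∃ v, N ≤ ht j v ∧ c j v = x

theorem halfPlane_infinite (j : ℕ) (n : ℤ) : (halfPlane j n).Infinite := by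
  choose f hf _ using fun k : ℕ => exists_ht_eq j (n + k) 0
  refine (Set.infinite_range_of_injective (f := f) fun a b h => ?_).mono ?_
  · have h1 := hf a
    rw [h, hf b] at h1
    omega
  · rintro _ ⟨k, rfl⟩
    rw [mem_halfPlane, hf]
    omega

theorem IsChart.tendsto {c : ℤ × ℤ → X} {j : ℕ} {n : ℤ} (h : IsChart ρ c j n) {P : X → Prop}
    (hP : ∀ᶠ x in cofinite, P x) : ∃ N, ∀ v, N ≤ ht j v → P (c v) := by
  have hfin : {v | v ∈ halfPlane j n ∧ ¬ P (c v)}.Finite :=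
    Set.Finite.of_injOn (f := c) (t := {x | ¬ P x}) (fun v hv => hv.2)
      (h.injOn.mono fun v hv => hv.1) hP
  obtain ⟨N, hN⟩ := exists_ht_lt hfin
  refine ⟨max n N, fun v hv => ?_⟩
  by_contra hc
  have h1 := hN v ⟨(le_max_left _ _).trans hv, hc⟩ j
  have h2 := (le_max_right n N).trans hv
  omega

/-- Since all points but finitely many lie in the half-planes of `d`, some half-plane of any other
development `c` meets one of them, and then coincides with one of them up to a translation. -/
theorem Development.exists_shift_of_covers {c d : ℕ → ℤ × ℤ → X} (hc : Development ρ c)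
    (hd : Development ρ d) {m : ℕ} (hcov : Covers d m) :
    ∃ a b t, a % 4 = b % 4 ∧ Shift a (c a) (d b) t := by
  obtain ⟨n₀, hc0⟩ := hc.chart 0
  obtain ⟨n₁, hc1⟩ := hc.chart 1
  obtain ⟨n₂, hc01⟩ := hc.agree 0
  choose n hn using hd.chart
  choose n' hn' using hd.agree
  obtain ⟨M, hM⟩ := ((Set.finite_Iic (4 * m)).image fun j => max (n j) (n' j)).bddAbove
  replace hM : ∀ j ≤ 4 * m, n j ≤ M ∧ n' j ≤ M := fun j hj => max_le_iff.1 (hM ⟨j, hj, rfl⟩)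
  obtain ⟨N, h0, h1, h01, hMN⟩ : ∃ N, n₀ ≤ N ∧ n₁ ≤ N ∧ n₂ ≤ N ∧ M ≤ N :=
    ⟨max n₀ (max n₁ (max n₂ M)), by
      simp only [le_max_iff, le_refl, true_or, or_true, and_self]⟩
  replace hc0 := hc0.mono h0
  replace hc1 := hc1.mono h1
  replace hc01 : ∀ v, N ≤ ht 0 v → N ≤ ht 1 v → c 0 v = c 1 v :=
    fun v hv hv' => hc01 v (h01.trans hv) (h01.trans hv')
  have hdN : ∀ j ≤ 4 * m, IsChart ρ (d j) j N := fun j hj => (hn j).mono ((hM j hj).1.trans hMN)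
  have hdN' : ∀ j ≤ 4 * m, ∀ v, N ≤ ht j v → N ≤ ht (j + 1) v → d j v = d (j + 1) v :=
    fun j hj v hv hv' => hn' j v (((hM j hj).2.trans hMN).trans hv)
      (((hM j hj).2.trans hMN).trans hv')
  obtain ⟨M, hM⟩ := hc0.tendsto (hcov N)
  obtain ⟨v, hv, -⟩ := exists_ht_eq 0 (max N M) 0
  have hvN : N ≤ ht 0 v := hv ▸ le_max_left _ _
  obtain ⟨j, hj, w, hw, hjw⟩ := hM v (hv ▸ le_max_right _ _)
  have hdj := hdN j hj.le
  have hr : j % 4 = 0 ∨ j % 4 = 1 ∨ j % 4 = 2 ∨ j % 4 = 3 := by omega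
  rcases hr with hr | hr | hr | hr
  · exact ⟨0, j, _, by omega,
      (hc0.shift_of_eq (hdj.congr_mod hr) (t := w - v) hvN
        (by rw [add_sub_cancel, ← ht_congr hr]; exact hw) (by rw [add_sub_cancel, hjw]))⟩
  · exact ⟨1, j, _, by omega,
      (hc0.shift_of_eq_succ hc1 (hdj.congr_mod (j := 0 + 1) hr)
        hc01 hvN (by rw [ht_congr (j := j) (by omega)]; exact hw) hjw.symm)⟩
  · obtain ⟨j, rfl⟩ : ∃ i, j = i + 1 := ⟨j - 1, by omega⟩
    have e1 : ∀ u, ht (0 + 1) u = ht j u := fun u => ht_congr (by omega) u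
    have e2 : ∀ u, ht (0 + 2) u = ht (j + 1) u := fun u => ht_congr (by omega) u
    exact ⟨1, j, _, by omega,
      (hc0.shift_of_eq_add_two hc1
        ((hdN j (by omega)).congr_mod (j := 0 + 1) (by omega))
        (hdj.congr_mod (j := 0 + 2) (by omega)) hc01
        (fun u hu hu' => hdN' j (by omega) u (e1 u ▸ hu) (e2 u ▸ hu')) hvN
        (e2 w ▸ hw) hjw.symm)⟩
  · obtain ⟨n', hn'⟩ := hd.chart (j + 1)
    have := hdj.shift_of_eq_succ hn' (hc0.congr_mod (j := j + 1) (by omega)) (hdN' j (by omega))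
      hw (by rw [ht_congr (j := 0) (by omega)]; exact hvN) hjw
    exact ⟨0, j + 1, _, by omega, (this.symm.congr_mod (by omega))⟩

/-- The period of a development is an invariant of the near `ℤ²`-set, as soon as one of its
developments covers it. -/
theorem HasPeriod.eq_of_covers {c d : ℕ → ℤ × ℤ → X} (hc : Development ρ c)
    (hd : Development ρ d) {m m' : ℕ} {s s' : ℤ × ℤ} (hm : HasPeriod c m s)
    (hm' : HasPeriod d m' s') (hcov : Covers d m') : m = m' ∧ s = s' := by
  obtain ⟨a, b, t, hab, h⟩ := hc.exists_shift_of_covers hd hcov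
  exact HasPeriod.eq_of_shift hc hd hm hm' hab h

end Coincidences

/-! ### Comparison of two developments with the same period -/

section Comparison

variable {X : Type u} {Y : Type v} {ρ : ℤ × ℤ → X → X} {σ : ℤ × ℤ → Y → Y}

theorem ht_le_norm (s : ℤ × ℤ) (j : ℕ) : ht j s ≤ |s.1| + |s.2| ∧ -(|s.1| + |s.2|) ≤ ht j s := by
  refine ⟨ht_le_abs j s, ?_⟩
  have := ht_le_abs j (-s)
  rw [ht_neg] at this
  simp only [Prod.fst_neg, Prod.snd_neg, abs_neg] at this
  omega

/-- A unit step from a point of a half-plane of the first turn leads to a point of the same, of the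
next or of the previous half-plane, up to finitely many exceptions on the boundary of the
half-plane; the next half-plane of the last one is the first one, with coordinates translated
by `s`. The new half-plane and the new coordinates only depend on the period. -/
theorem Uniform.step {c : ℕ → ℤ × ℤ → X} {d : ℕ → ℤ × ℤ → Y} {m : ℕ} {s : ℤ × ℤ} {N N₁ : ℤ}
    (hc : Uniform ρ c m s N) (hd : Uniform σ d m s N) (hN : N + 1 + (|s.1| + |s.2|) ≤ N₁) {j : ℕ}
    (hj : j < 4 * m) {v : ℤ × ℤ} (hv : N₁ ≤ ht j v)
    (hfar : N₁ + 1 ≤ ht j v ∨ N₁ + 1 + (|s.1| + |s.2|) ≤ ht (j + 1) v ∨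
      ht (j + 1) v ≤ -(N₁ + 1 + (|s.1| + |s.2|))) {e : ℤ × ℤ} (he : UnitVec e) :
    ∃ j' < 4 * m, ∃ v', N₁ ≤ ht j' v' ∧ c j (v + e) = c j' v' ∧ d j (v + e) = d j' v' := by
  have a0 : 0 ≤ |s.1| + |s.2| := by positivity
  have b0 := he.abs_ht_le j
  have b1 := he.abs_ht_le (j + 1)
  rcases hfar with h | h | h
  · exact ⟨j, hj, v + e, by rw [ht_add]; omega, rfl, rfl⟩
  · -- the point lies in the corner shared with the next half-plane
    have h1 : N ≤ ht j (v + e) := by rw [ht_add]; omega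
    have h2 : N₁ + (|s.1| + |s.2|) ≤ ht (j + 1) (v + e) := by rw [ht_add]; omega
    have hc1 := hc.agree j hj.le (v + e) h1 (by omega)
    have hd1 := hd.agree j hj.le (v + e) h1 (by omega)
    rcases Nat.lt_or_ge (j + 1) (4 * m) with hlt | hge
    · exact ⟨j + 1, hlt, v + e, by omega, hc1, hd1⟩
    · have hjm : j + 1 = 4 * m := by omega
      rw [hjm] at hc1 hd1 h2
      rw [ht_congr (j := 0) (by omega)] at h2
      refine ⟨0, by omega, v + e - s, ?_, ?_, ?_⟩
      · rw [ht_sub]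
        have := (ht_le_norm s 0).1
        omega
      · rw [hc1, hc.period _ (by omega)]
      · rw [hd1, hd.period _ (by omega)]
  · -- the point lies in the corner shared with the previous half-plane
    rcases Nat.eq_zero_or_pos j with rfl | hj0
    · have h1 : N + (|s.1| + |s.2|) ≤ ht 0 (v + e) := by rw [ht_add]; omega
      have h2 : N₁ + (|s.1| + |s.2|) ≤ ht 3 (v + e) := by
        simp only [zero_add] at h b1
        rw [show 3 = 1 + 2 by rfl, ht_add_two, ht_add]; omega
      have e3 : ∀ u, ht (4 * m - 1) u = ht 3 u := fun u => ht_congr (by omega) u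
      have e4 : ∀ u, ht (4 * m) u = ht 0 u := fun u => ht_congr (by omega) u
      have h3 := (ht_le_norm s 0).2
      have h4 := (ht_le_norm s 3).2
      have hcd : 4 * m - 1 + 1 = 4 * m := by omega
      have hc1 := hc.agree (4 * m - 1) (by omega) (v + e + s) (by rw [ht_add, e3, e3]; omega)
        (by rw [hcd, ht_add, e4, e4]; omega)
      have hd1 := hd.agree (4 * m - 1) (by omega) (v + e + s) (by rw [ht_add, e3, e3]; omega)
        (by rw [hcd, ht_add, e4, e4]; omega)
      rw [hcd] at hc1 hd1
      refine ⟨4 * m - 1, by omega, v + e + s, by rw [ht_add, e3, e3]; omega, ?_, ?_⟩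
      · rw [hc1, hc.period _ (by rw [ht_add]; omega), add_sub_cancel_right]
      · rw [hd1, hd.period _ (by rw [ht_add]; omega), add_sub_cancel_right]
    · obtain ⟨j, rfl⟩ : ∃ i, j = i + 1 := ⟨j - 1, by omega⟩
      have h1 : N₁ ≤ ht j (v + e) := by
        rw [show j + 1 + 1 = j + 2 by rfl, ht_add_two] at h b1
        rw [ht_add]
        omega
      have h2 : N ≤ ht (j + 1) (v + e) := by rw [ht_add]; omega
      exact ⟨j, by omega, v + e, h1, (hc.agree j (by omega) _ (by omega) h2).symm,
        (hd.agree j (by omega) _ (by omega) h2).symm⟩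

/-- The set of points of the first turn for which a unit step may fail to be described by
`Uniform.step` is finite. -/
theorem finite_boundary (j : ℕ) (N₁ M : ℤ) : {v | N₁ ≤ ht j v ∧
    ¬ (N₁ + 1 ≤ ht j v ∨ M ≤ ht (j + 1) v ∨ ht (j + 1) v ≤ -M)}.Finite := by
  refine finite_of_ht j (n := min N₁ (-M)) (N := max N₁ M) fun v hv => ?_
  have h1 := hv.1
  have h2 := hv.2
  have h3 := min_le_left N₁ (-M)
  have h4 := min_le_right N₁ (-M)
  have h5 := le_max_left N₁ M
  have h6 := le_max_right N₁ M
  omega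

theorem Uniform.eventually_step {c : ℕ → ℤ × ℤ → X} {d : ℕ → ℤ × ℤ → Y} {m : ℕ} {s : ℤ × ℤ}
    {N N₁ : ℤ} (hc : Uniform ρ c m s N) (hd : Uniform σ d m s N)
    (hN : N + 1 + (|s.1| + |s.2|) ≤ N₁) :
    ∀ᶠ x in cofinite, ∀ j < 4 * m, ∀ v, N₁ ≤ ht j v → c j v = x → ∀ e, UnitVec e →
      ∃ j' < 4 * m, ∃ v', N₁ ≤ ht j' v' ∧ c j (v + e) = c j' v' ∧ d j (v + e) = d j' v' := by
  have hfin := (Set.finite_Iio (4 * m)).biUnion fun j _ =>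
    (finite_boundary j N₁ (N₁ + 1 + (|s.1| + |s.2|))).image (c j)
  filter_upwards [hfin.compl_mem_cofinite] with x hx j hj v hv hvx e he
  refine hc.step hd hN hj hv ?_ he
  by_contra hcon
  exact hx (Set.mem_biUnion hj ⟨v, ⟨hv, hcon⟩, hvx⟩)

theorem Uniform.eventually_equivariant {c : ℕ → ℤ × ℤ → X} {m : ℕ} {s : ℤ × ℤ} {N N₁ : ℤ}
    (hc : Uniform ρ c m s N) (hN : N + 1 ≤ N₁) {j : ℕ} (hj : j < 4 * m) {v : ℤ × ℤ}
    (hv : N₁ ≤ ht j v) {e : ℤ × ℤ} (he : UnitVec e) : ρ e (c j v) = c j (v + e) :=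
  (hc.chart j hj.le).equivariantOn v (mem_halfPlane.2 (by omega)) e he
    (by rw [mem_halfPlane, ht_add]; have := he.abs_ht_le j; omega)

theorem Uniform.covers {c : ℕ → ℤ × ℤ → X} {m : ℕ} {s : ℤ × ℤ} {N : ℤ}
    (hc : Uniform ρ c m s N) (hm : 1 ≤ m) (h1 : OneEndedRep ρ) : Covers c m := by
  intro N'
  set N₁ := max N' (N + 1 + (|s.1| + |s.2|))
  have hN : N + 1 + (|s.1| + |s.2|) ≤ N₁ := le_max_right _ _
  have a0 : 0 ≤ |s.1| + |s.2| := by positivity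
  rcases h1.2 {x | ∃ j < 4 * m, ∃ v, N₁ ≤ ht j v ∧ c j v = x} (fun e he => by
    filter_upwards [hc.eventually_step hc hN] with x hx
    rintro ⟨j, hj, v, hv, hvx⟩
    obtain ⟨j', hj', v', hv', h2, -⟩ := hx j hj v hv hvx e he
    refine ⟨j', hj', v', hv', ?_⟩
    rw [← h2, ← hvx, hc.eventually_equivariant (by omega) hj hv he]) with h | h
  · have hinj := ((hc.chart 0 (by omega)).mono (N := N₁) (by omega)).injOn
    refine absurd (Set.Finite.of_injOn (fun v hv => ?_) hinj h) (halfPlane_infinite 0 N₁)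
    exact ⟨0, by omega, v, hv, rfl⟩
  · filter_upwards [show ∀ᶠ x in cofinite, ∃ j < 4 * m, ∃ v, N₁ ≤ ht j v ∧ c j v = x from h]
      with x hx
    obtain ⟨j, hj, v, hv, hvx⟩ := hx
    exact ⟨j, hj, v, (le_max_left _ _).trans hv, hvx⟩

/-- A coincidence between two half-planes of the first turn holds in any development with the same
period. -/
theorem Uniform.eq_of_eq {c : ℕ → ℤ × ℤ → X} {d : ℕ → ℤ × ℤ → Y} {m : ℕ} {s : ℤ × ℤ} {N N₁ : ℤ}
    (hc : Uniform ρ c m s N) (hd : Uniform σ d m s N) (hcd : Development ρ c)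
    (hm : HasPeriod c m s) (hN : N + (|s.1| + |s.2|) ≤ N₁) (hN₀ : 0 < N₁)
    {i j : ℕ} (hi : i < 4 * m) (hj : j < 4 * m) {v w : ℤ × ℤ} (hv : N₁ ≤ ht i v)
    (hw : N₁ ≤ ht j w) (h : c i v = c j w) : d i v = d j w := by
  wlog hij : i ≤ j generalizing i j v w
  · exact (this hj hi hw hv h.symm (by omega)).symm
  have a0 : 0 ≤ |s.1| + |s.2| := by positivity
  have hci := hc.chart i hi.le
  have hcj := hc.chart j hj.le
  have hmp := hm.pos
  have small : ∀ k a b, a < 4 * m → a = b + 4 * (m * k) → k = 0 := by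
    intro k a b ha hab
    rcases Nat.eq_zero_or_pos k with hk | hk
    · exact hk
    · have := Nat.le_mul_of_pos_right m hk
      omega
  have hr : j % 4 = i % 4 ∨ j % 4 = (i + 1) % 4 ∨ j % 4 = (i + 2) % 4 ∨ i % 4 = (j + 1) % 4 := by
    omega
  rcases hr with hr | hr | hr | hr
  · have h1 := hci.shift_of_eq (hcj.congr_mod hr) (t := w - v) (v := v) (by omega)
      (by rw [add_sub_cancel, ← ht_congr hr]; omega) (by rw [add_sub_cancel, h])
    obtain ⟨k, hk, hk'⟩ := hcd.eq_of_shift hm hij hr.symm h1.symm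
    obtain rfl := small k j i hj hk
    obtain rfl : j = i := by simpa using hk
    rw [show v = w by simpa [sub_eq_zero] using hk']
  · have h1 := hci.shift_of_eq_succ (hc.chart (i + 1) (by omega)) (hcj.congr_mod hr)
      (hc.agree i hi.le) (by omega) (by rw [← ht_congr hr]; omega) h
    obtain ⟨k, hk, hk'⟩ := hcd.eq_of_shift hm (by omega) hr.symm h1.symm
    obtain rfl := small k j (i + 1) hj hk
    obtain rfl : j = i + 1 := by simpa using hk
    obtain rfl : v = w := by simpa [sub_eq_zero] using hk'
    exact hd.agree i hi.le v (by omega) (by omega)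
  · obtain ⟨j, rfl⟩ : ∃ k, j = k + 1 := ⟨j - 1, by omega⟩
    have e1 : ∀ u, ht (i + 1) u = ht j u := fun u => ht_congr (by omega) u
    have e2 : ∀ u, ht (i + 2) u = ht (j + 1) u := fun u => ht_congr (by omega) u
    have h1 := hci.shift_of_eq_add_two (hc.chart (i + 1) (by omega))
      ((hc.chart j (by omega)).congr_mod (j := i + 1) (by omega)) (hcj.congr_mod hr)
      (hc.agree i hi.le)
      (fun u hu hu' => hc.agree j (by omega) u (e1 u ▸ hu) (e2 u ▸ hu')) (by omega)
      (by rw [e2]; omega) h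
    obtain ⟨k, hk, hk'⟩ := hcd.eq_of_shift hm (by omega) (by omega) h1.symm
    obtain rfl := small k j (i + 1) (by omega) hk
    obtain rfl : v = w := by simpa [sub_eq_zero] using hk'
    -- the two half-planes have opposite types and the coordinates agree
    rw [← e2, ht_add_two] at hw
    omega
  · obtain ⟨n, hn⟩ := hcd.chart (j + 1)
    have h1 := hcj.shift_of_eq_succ hn (hci.congr_mod hr) (hc.agree j hj.le) (by omega)
      (by rw [← ht_congr hr]; omega) h.symm
    obtain ⟨k, hk, hk'⟩ := hcd.eq_of_shift hm (by omega) hr (h1.congr_mod hr.symm)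
    have hk1 : k = 1 := by
      rcases Nat.lt_or_ge k 2 with h2 | h2
      · interval_cases k
        · omega
        · rfl
      · have := Nat.mul_le_mul_left m h2
        omega
    subst hk1
    obtain ⟨rfl, rfl⟩ : i = 0 ∧ j = 4 * m - 1 := by omega
    obtain rfl : w = v + s := by
      rw [one_smul] at hk'
      rw [eq_neg_iff_add_eq_zero] at hk'
      rw [← sub_eq_zero, ← neg_eq_zero, ← hk']
      abel
    have e4 : ∀ u, ht (4 * m - 1 + 1) u = ht 0 u := fun u => ht_congr (by omega) u
    have h2 := (ht_le_norm s 0).2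
    rw [hd.agree _ hj.le _ (by omega) (by rw [e4, ht_add]; omega),
      show 4 * m - 1 + 1 = 4 * m by omega, hd.period _ (by rw [ht_add]; omega),
      add_sub_cancel_right]

/-- Two 1-ended near `ℤ²`-sets that have developments with the same period are near isomorphic, by
the near bijection that maps each half-plane of the first development to the corresponding one of
the second. -/
theorem exists_nearIso_of_period (hρ : OneEndedRep ρ) (hσ : OneEndedRep σ)
    {c : ℕ → ℤ × ℤ → X} {d : ℕ → ℤ × ℤ → Y} (hc : Development ρ c) (hd : Development σ d) {m : ℕ}
    {s : ℤ × ℤ} (hcm : HasPeriod c m s) (hdm : HasPeriod d m s) :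
    ∃ (F : X → Y) (G : Y → X), (∀ᶠ x in cofinite, G (F x) = x) ∧
      (∀ᶠ y in cofinite, F (G y) = y) ∧
      (∀ e, UnitVec e → ∀ᶠ x in cofinite, F (ρ e x) = σ e (F x)) ∧
      ∃ N, ∀ v, N ≤ ht 0 v → F (c 0 v) = d 0 v := by
  classical
  obtain ⟨n₁, h₁⟩ := hc.exists_uniform hcm
  obtain ⟨n₂, h₂⟩ := hd.exists_uniform hdm
  obtain ⟨N, hN⟩ : ∃ N, n₁ ≤ N ∧ n₂ ≤ N ∧ 0 ≤ N :=
    ⟨max n₁ (max n₂ 0), by simp only [le_max_iff, le_refl, true_or, or_true, and_self]⟩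
  replace h₁ := h₁.mono hN.1
  replace h₂ := h₂.mono hN.2.1
  have a0 : 0 ≤ |s.1| + |s.2| := by positivity
  obtain ⟨N₁, hN₁⟩ : ∃ N₁, N₁ = N + 1 + (|s.1| + |s.2|) := ⟨_, rfl⟩
  have hpos := hcm.pos
  have : Nonempty X := ⟨c 0 0⟩
  have : Nonempty Y := ⟨d 0 0⟩
  have hF : ∃ F : X → Y, ∀ j < 4 * m, ∀ v, N₁ ≤ ht j v → F (c j v) = d j v := by
    have : ∀ x, ∃ y, ∀ j < 4 * m, ∀ v, N₁ ≤ ht j v → c j v = x → y = d j v := by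
      intro x
      by_cases hx : ∃ j < 4 * m, ∃ v, N₁ ≤ ht j v ∧ c j v = x
      · obtain ⟨j, hj, v, hv, hvx⟩ := hx
        exact ⟨d j v, fun i hi w hw hwx => h₁.eq_of_eq h₂ hc hcm (by omega) (by omega) hj hi hv hw
          (hvx.trans hwx.symm)⟩
      · exact ⟨Classical.arbitrary Y, fun j hj v hv hvx => absurd ⟨j, hj, v, hv, hvx⟩ hx⟩
    choose F hF using this
    exact ⟨F, fun j hj v hv => hF _ j hj v hv rfl⟩
  have hG : ∃ G : Y → X, ∀ j < 4 * m, ∀ v, N₁ ≤ ht j v → G (d j v) = c j v := by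
    have : ∀ y, ∃ x, ∀ j < 4 * m, ∀ v, N₁ ≤ ht j v → d j v = y → x = c j v := by
      intro y
      by_cases hy : ∃ j < 4 * m, ∃ v, N₁ ≤ ht j v ∧ d j v = y
      · obtain ⟨j, hj, v, hv, hvx⟩ := hy
        exact ⟨c j v, fun i hi w hw hwx => h₂.eq_of_eq h₁ hd hdm (by omega) (by omega) hj hi hv hw
          (hvx.trans hwx.symm)⟩
      · exact ⟨Classical.arbitrary X, fun j hj v hv hvx => absurd ⟨j, hj, v, hv, hvx⟩ hy⟩
    choose G hG using this
    exact ⟨G, fun j hj v hv => hG _ j hj v hv rfl⟩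
  obtain ⟨F, hF⟩ := hF
  obtain ⟨G, hG⟩ := hG
  refine ⟨F, G, ?_, ?_, ?_, N₁, fun v hv => hF 0 (by omega) v hv⟩
  · filter_upwards [h₁.covers hpos hρ N₁] with x hx
    obtain ⟨j, hj, v, hv, rfl⟩ := hx
    rw [hF j hj v hv, hG j hj v hv]
  · filter_upwards [h₂.covers hpos hσ N₁] with x hx
    obtain ⟨j, hj, v, hv, rfl⟩ := hx
    rw [hG j hj v hv, hF j hj v hv]
  · intro e he
    filter_upwards [h₁.covers hpos hρ N₁, h₁.eventually_step h₂ hN₁.ge] with x hx hx'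
    obtain ⟨j, hj, v, hv, hvx⟩ := hx
    obtain ⟨j', hj', v', hv', h3, h4⟩ := hx' j hj v hv hvx e he
    rw [← hvx, hF j hj v hv, h₁.eventually_equivariant (N₁ := N₁) (by omega) hj hv he,
      h₂.eventually_equivariant (N₁ := N₁) (by omega) hj hv he, h3, h4, hF j' hj' v' hv']

end Comparison

/-! ### Graded corners -/

section GradedCorners

variable {X : Type u} {ρ : ℤ × ℤ → X → X} {α : NearAction Z2 X}

theorem mem_corner_iff (j : ℕ) (c p : ℤ × ℤ) :
    p ∈ corner j c ↔ ht j c ≤ ht j p ∧ ht (j + 3) c ≤ ht (j + 3) p := by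
  have e : ∀ i, ht (j + i) = ht (j % 4 + i) := fun i => funext fun v => ht_congr (by omega) v
  have e0 := e 0
  rw [add_zero, add_zero] at e0
  rw [e0, e 3]
  unfold corner
  have := Nat.mod_lt j (show 4 > 0 by norm_num)
  interval_cases j % 4 <;> simp [ht, and_comm]

theorem unitVec_exitVec (j : ℕ) : UnitVec (exitVec j) := by
  unfold exitVec
  have := Nat.mod_lt j (show 4 > 0 by norm_num)
  interval_cases j % 4 <;> simp [UnitVec]

theorem ht_exitVec (j : ℕ) : ht j (exitVec j) = 0 ∧ ht (j + 1) (exitVec j) = 1 := by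
  have e : ∀ i, ht (j + i) = ht (j % 4 + i) := fun i => funext fun v => ht_congr (by omega) v
  have e0 := e 0
  rw [add_zero, add_zero] at e0
  rw [e0, e 1]
  unfold exitVec
  have := Nat.mod_lt j (show 4 > 0 by norm_num)
  interval_cases j % 4 <;> simp [ht]

theorem eventually_iff_finite_of_represents {F : X → X} {φ : CofPBij X X}
    (h : Represents F (NearBij.mk φ)) (A : X → Prop) (Q : Set X) (R : X → X → Prop) :
    {x | A x ∧ ¬ ∃ y ∈ Q, φ.toPEquiv x = some y ∧ R x y}.Finite ↔
      ∀ᶠ x in cofinite, A x → F x ∈ Q ∧ R x (F x) := by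
  have h0 : {x | A x ∧ ¬ ∃ y ∈ Q, φ.toPEquiv x = some y ∧ R x y}.Finite ↔
      ∀ᶠ x in cofinite, A x → ∃ y ∈ Q, φ.toPEquiv x = some y ∧ R x y := by
    simp [Filter.eventually_cofinite]
  rw [h0]
  refine eventually_congr ?_
  filter_upwards [represents_mk.1 h] with x hx
  rw [hx]
  simp [eq_comm]

/-- The analogue of `IsGradedCorner` for a family of functions. -/
structure GradedRep (ρ : ℤ × ℤ → X → X) (j : ℕ) (P : Set X) (f : X → ℤ × ℤ) : Prop where
  injOn : Set.InjOn f P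
  image : ∃ c : ℤ × ℤ, (symmDiff (f '' P) (corner j c)).Finite
  step : ∀ e, UnitVec e → ∀ᶠ x in cofinite, x ∈ P → f x + e ∈ f '' P →
    ρ e x ∈ P ∧ f (ρ e x) = f x + e

/-- The analogue of `GradedAdjacent` for a family of functions. -/
def AdjacentRep (ρ : ℤ × ℤ → X → X) (e : ℤ × ℤ) (P : Set X) (f : X → ℤ × ℤ) (Q : Set X)
    (g : X → ℤ × ℤ) : Prop :=
  ∀ᶠ x in cofinite, x ∈ P → f x + e ∉ f '' P → ρ e x ∈ Q ∧ g (ρ e x) = f x + e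

theorem isGradedCorner_iff (h : RepAction ρ α) {j : ℕ} {P : Set X} {f : X → ℤ × ℤ} :
    IsGradedCorner α j P f ↔ GradedRep ρ j P f := by
  have key : ∀ e φ, NearBij.mk φ = α (Multiplicative.ofAdd e) →
      ({x | x ∈ P ∧ f x + e ∈ f '' P ∧
        ¬ ∃ y ∈ P, φ.toPEquiv x = some y ∧ f y = f x + e}.Finite ↔
      ∀ᶠ x in cofinite, x ∈ P → f x + e ∈ f '' P → ρ e x ∈ P ∧ f (ρ e x) = f x + e) := by
    intro e φ hφ
    have := eventually_iff_finite_of_represents (hφ ▸ h e)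
      (fun x => x ∈ P ∧ f x + e ∈ f '' P) P (fun x y => f y = f x + e)
    simpa only [and_assoc, and_imp] using this
  constructor
  · rintro ⟨h1, h2, h3⟩
    refine ⟨h1, h2, fun e he => ?_⟩
    obtain ⟨φ, hφ⟩ := (α (Multiplicative.ofAdd e)).exists_mk
    exact (key e φ hφ).1 (h3 e he φ hφ)
  · rintro ⟨h1, h2, h3⟩
    exact ⟨h1, h2, fun e he φ hφ => (key e φ hφ).2 (h3 e he)⟩

theorem gradedAdjacent_iff (h : RepAction ρ α) {e : ℤ × ℤ} {P Q : Set X} {f g : X → ℤ × ℤ} :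
    GradedAdjacent α e P f Q g ↔ AdjacentRep ρ e P f Q g := by
  have key : ∀ φ, NearBij.mk φ = α (Multiplicative.ofAdd e) →
      ({x | x ∈ P ∧ f x + e ∉ f '' P ∧
        ¬ ∃ y ∈ Q, φ.toPEquiv x = some y ∧ g y = f x + e}.Finite ↔
      AdjacentRep ρ e P f Q g) := by
    intro φ hφ
    have := eventually_iff_finite_of_represents (hφ ▸ h e)
      (fun x => x ∈ P ∧ f x + e ∉ f '' P) Q (fun x y => g y = f x + e)
    unfold AdjacentRep
    simpa only [and_assoc, and_imp] using this
  constructor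
  · intro h1
    obtain ⟨φ, hφ⟩ := (α (Multiplicative.ofAdd e)).exists_mk
    exact (key φ hφ).1 (h1 φ hφ)
  · intro h1 φ hφ
    exact (key φ hφ).2 h1

/-- The chart `c` inverts the grading `f` of `P` at `v`. -/
def Matches (P : Set X) (f : X → ℤ × ℤ) (c : ℤ × ℤ → X) (v : ℤ × ℤ) : Prop :=
  c v ∈ P ∧ f (c v) = v

theorem GradedRep.mem_image_iff {j : ℕ} {P : Set X} {f : X → ℤ × ℤ} (h : GradedRep ρ j P f) :
    ∃ (n : ℤ) (a : ℤ × ℤ), ∀ v, (∃ i, n ≤ ht i v) →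
      (v ∈ f '' P ↔ ht j a ≤ ht j v ∧ ht (j + 3) a ≤ ht (j + 3) v) := by
  obtain ⟨a, ha⟩ := h.image
  obtain ⟨n, hn⟩ := exists_ht_lt ha
  refine ⟨n, a, fun v ⟨i, hi⟩ => ?_⟩
  rw [← mem_corner_iff]
  by_contra hc
  have := hn v (by rw [Set.mem_symmDiff]; tauto) i
  omega

/-- Away from the exceptional points, matching propagates along the unit steps that do not leave
the corner. -/
theorem GradedRep.matches_of_stepConnected {j : ℕ} {P : Set X} {f : X → ℤ × ℤ}
    (h : GradedRep ρ j P f) : ∃ n : ℤ, ∀ (c : ℤ × ℤ → X) (S : Set (ℤ × ℤ)), StepConnected S →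
      EquivariantOn ρ c S → S ⊆ f '' P → (∀ v ∈ S, ∃ i, n ≤ ht i v) → ∀ v ∈ S, Matches P f c v →
      ∀ w ∈ S, Matches P f c w := by
  have hfin : {x | ¬ ∀ e, UnitVec e → x ∈ P → f x + e ∈ f '' P →
    ρ e x ∈ P ∧ f (ρ e x) = f x + e}.Finite := eventually_unitVec h.step
  obtain ⟨n, hn⟩ := exists_ht_lt (hfin.image f)
  refine ⟨n, fun c S hS hc hSP hSn v hv hvm => hS _ v hv hvm fun u hu hum e he hue => ?_⟩
  have h1 : ∀ e, UnitVec e → c u ∈ P → f (c u) + e ∈ f '' P →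
      ρ e (c u) ∈ P ∧ f (ρ e (c u)) = f (c u) + e := by
    by_contra hcon
    obtain ⟨i, hi⟩ := hSn u hu
    have := hn u ⟨c u, hcon, hum.2⟩ i
    omega
  have h2 := h1 e he hum.1 (by rw [hum.2]; exact hSP hue)
  rwa [hc u hu e he hue, hum.2] at h2

theorem GradedRep.translate {j : ℕ} {P : Set X} {f : X → ℤ × ℤ} (h : GradedRep ρ j P f)
    (s : ℤ × ℤ) : GradedRep ρ j P (fun x => f x + s) where
  injOn x hx y hy hxy := h.injOn hx hy (add_right_cancel hxy)
  image := by
    obtain ⟨a, ha⟩ := h.image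
    refine ⟨a + s, (ha.image fun v => v + s).subset ?_⟩
    intro v hv
    refine ⟨v - s, ?_, sub_add_cancel v s⟩
    have h1 : v ∈ (fun x => f x + s) '' P ↔ v - s ∈ f '' P :=
      exists_congr fun x => and_congr_right fun _ => eq_sub_iff_add_eq.symm
    have h2 : v ∈ corner j (a + s) ↔ v - s ∈ corner j a := by
      rw [mem_corner_iff, mem_corner_iff, ht_add, ht_add, ht_sub, ht_sub]
      omega
    rw [Set.mem_symmDiff] at *
    rwa [← h1, ← h2]
  step e he := by
    filter_upwards [h.step e he] with x hx h1 h2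
    have h3 := hx h1 (by
      obtain ⟨y, hy, hxy⟩ := h2
      exact ⟨y, hy, by rw [add_right_comm] at hxy; exact add_right_cancel hxy⟩)
    exact ⟨h3.1, by rw [h3.2, add_right_comm]⟩

theorem GradedRep.congr_mod {i j : ℕ} {P : Set X} {f : X → ℤ × ℤ} (h : GradedRep ρ i P f)
    (hij : i % 4 = j % 4) : GradedRep ρ j P f where
  injOn := h.injOn
  image := by
    have : corner i = corner j := by unfold corner; rw [hij]
    exact this ▸ h.image
  step := h.step

/-- A graded corner yields a half-plane, which inverts the grading in the depth of the corner. -/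
theorem GradedRep.exists_chart (hρ : NearRep ρ) {P : Set X} {f : X → ℤ × ℤ}
    (h : GradedRep ρ 0 P f) : ∃ c, (∃ n, IsChart ρ c 0 n) ∧
      ∃ N, ∀ v, N ≤ ht 3 v → N ≤ ht 0 v → Matches P f c v := by
  classical
  obtain ⟨n, a, hn⟩ := h.mem_image_iff
  have hfin : {x | ¬ ∀ e, UnitVec e → x ∈ P → f x + e ∈ f '' P →
    ρ e x ∈ P ∧ f (ρ e x) = f x + e}.Finite := eventually_unitVec h.step
  obtain ⟨n', hn'⟩ := exists_ht_lt (hfin.image f)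
  obtain ⟨M, hM⟩ : ∃ M, n ≤ M ∧ n' ≤ M ∧ ht 0 a ≤ M ∧ ht 3 a ≤ M :=
    ⟨max n (max n' (max (ht 0 a) (ht 3 a))), by
      simp only [le_max_iff, le_refl, true_or, or_true, and_self]⟩
  have hmem : ∀ v, M ≤ ht 3 v → M ≤ ht (3 + 1) v → ∃ x ∈ P, f x = v := fun v h1 h2 => by
    rw [show 3 + 1 = 0 + 4 by rfl, ht_add_four] at h2
    exact (hn v ⟨0, by omega⟩).2 ⟨by omega, by rw [zero_add]; omega⟩
  obtain ⟨x₀, -, -⟩ := hmem (M, M) (by simp [ht]) (by simp [ht])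
  have : Nonempty X := ⟨x₀⟩
  choose! p hpP hp using hmem
  have heq : EquivariantOn ρ p {v | M ≤ ht 3 v ∧ M ≤ ht (3 + 1) v} := by
    rintro v ⟨h1, h2⟩ e he ⟨h3, h4⟩
    have h5 : ∀ e, UnitVec e → p v ∈ P → f (p v) + e ∈ f '' P →
        ρ e (p v) ∈ P ∧ f (ρ e (p v)) = f (p v) + e := by
      by_contra hcon
      have := hn' v ⟨p v, hcon, hp v h1 h2⟩ 3
      omega
    have h6 := h5 e he (hpP v h1 h2) (by rw [hp v h1 h2]; exact ⟨_, hpP _ h3 h4, hp _ h3 h4⟩)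
    exact h.injOn h6.1 (hpP _ h3 h4) (by rw [h6.2, hp v h1 h2, hp _ h3 h4])
  have hinj : Set.InjOn p {v | M ≤ ht 3 v ∧ M ≤ ht (3 + 1) v} := by
    rintro v ⟨h1, h2⟩ w ⟨h3, h4⟩ hvw
    rw [← hp v h1 h2, hvw, hp w h3 h4]
  obtain ⟨N, c, hc, hcp⟩ := hρ.exists_halfPlane_of_corner heq hinj
  refine ⟨c, ⟨N, hc.congr_mod (by norm_num)⟩, max N M, fun v hv hv' => ?_⟩
  have h1 : ht (3 + 1) v = ht 0 v := ht_add_four 0 v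
  have h2 := le_max_left N M
  have h3 := le_max_right N M
  have h4 := hcp v (by omega) (by omega)
  exact ⟨h4 ▸ hpP v (by omega) (by omega), by rw [h4, hp v (by omega) (by omega)]⟩

/-- A half-plane that inverts the grading of a corner also inverts the grading of the next one. -/
theorem GradedRep.matches_next {j : ℕ} {P Q : Set X} {f g : X → ℤ × ℤ} {c : ℤ × ℤ → X} {n : ℤ}
    (hP : GradedRep ρ j P f) (hQ : GradedRep ρ (j + 1) Q g)
    (hPQ : AdjacentRep ρ (exitVec j) P f Q g) (hc : IsChart ρ c j n)
    (hN : ∃ N, ∀ v, N ≤ ht (j + 3) v → N ≤ ht j v → Matches P f c v) :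
    ∃ N, ∀ v, N ≤ ht j v → v ∈ g '' Q → Matches Q g c v := by
  obtain ⟨N, hN⟩ := hN
  obtain ⟨n₁, a, h₁⟩ := hP.mem_image_iff
  obtain ⟨n₂, b, h₂⟩ := hQ.mem_image_iff
  obtain ⟨n₃, h₃⟩ := hP.matches_of_stepConnected
  obtain ⟨n₄, h₄⟩ := hQ.matches_of_stepConnected
  have hfin : {x | ¬ (x ∈ P → f x + exitVec j ∉ f '' P →
    ρ (exitVec j) x ∈ Q ∧ g (ρ (exitVec j) x) = f x + exitVec j)}.Finite := hPQ
  obtain ⟨n₅, h₅⟩ := exists_ht_lt (hfin.image f)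
  obtain ⟨M, hM⟩ : ∃ M, n ≤ M ∧ N ≤ M ∧ n₁ ≤ M ∧ n₂ ≤ M ∧ n₃ ≤ M ∧ n₄ ≤ M ∧ n₅ ≤ M ∧
      ht j a ≤ M ∧ ht j b ≤ M :=
    ⟨max n (max N (max n₁ (max n₂ (max n₃ (max n₄ (max n₅ (max (ht j a) (ht j b)))))))), by
      simp only [le_max_iff, le_refl, true_or, or_true, and_self]⟩
  have e3 : ∀ u, ht (j + 3) u = -ht (j + 1) u := fun u => ht_add_two (j + 1) u
  have e4 : ∀ u, ht (j + 1 + 3) u = ht j u := fun u => ht_add_four j u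
  refine ⟨M, fun v hv hvQ => ?_⟩
  -- the part in `P` of the row of `v`, up to its last point `u`
  obtain ⟨u, hu, hu'⟩ := exists_ht_eq j (ht j v) (ht (j + 1) a)
  obtain ⟨u₀, hu₀, hu₀'⟩ := exists_ht_eq j (ht j v) (min (ht (j + 1) a) (-N))
  have h6 := min_le_left (ht (j + 1) a) (-N)
  have h7 := min_le_right (ht (j + 1) a) (-N)
  have hum : Matches P f c u :=
    h₃ c {w | ht j w ∈ ({ht j v} : Set ℤ) ∧ ht (j + 1) w ∈ Set.Iic (ht (j + 1) a)}
      (stepConnected_ht j Set.ordConnected_singleton Set.ordConnected_Iic)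
      (hc.equivariantOn.mono fun w hw => by
        have : ht j w = ht j v := hw.1
        rw [mem_halfPlane]; omega)
      (fun w hw => by
        have h8 : ht j w = ht j v := hw.1
        have h9 : ht (j + 1) w ≤ ht (j + 1) a := hw.2
        exact (h₁ w ⟨j, by omega⟩).2 ⟨by omega, by rw [e3, e3]; omega⟩)
      (fun w hw => ⟨j, by have : ht j w = ht j v := hw.1; omega⟩)
      u₀ ⟨hu₀, by rw [hu₀']; exact h6⟩ (hN u₀ (by rw [e3]; omega) (by omega))
      u ⟨hu, Set.mem_Iic.2 hu'.le⟩
  -- the next point of the row is in `Q`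
  have hex := ht_exitVec j
  have hu1 : ht j (u + exitVec j) = ht j v := by rw [ht_add]; omega
  have hum' : Matches Q g c (u + exitVec j) := by
    have h8 : c u ∈ P → f (c u) + exitVec j ∉ f '' P →
        ρ (exitVec j) (c u) ∈ Q ∧ g (ρ (exitVec j) (c u)) = f (c u) + exitVec j := by
      by_contra hcon
      have := h₅ u ⟨c u, hcon, hum.2⟩ j
      omega
    have h9 := h8 hum.1 (by
      rw [hum.2, h₁ _ ⟨j, by omega⟩, e3, e3, ht_add (j + 1)]
      omega)
    rw [hc.equivariantOn u (by rw [mem_halfPlane]; omega) _ (unitVec_exitVec j)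
      (by rw [mem_halfPlane]; omega), hum.2] at h9
    exact h9
  -- hence so is the part in `Q` of the row
  have hvQ' := (h₂ v ⟨j, by omega⟩).1 hvQ
  have huQ' := (h₂ (u + exitVec j) ⟨j, by omega⟩).1 ⟨_, hum'.1, hum'.2⟩
  exact h₄ c {w | ht j w ∈ ({ht j v} : Set ℤ) ∧ ht (j + 1) w ∈ Set.Ici (ht (j + 1) b)}
      (stepConnected_ht j Set.ordConnected_singleton Set.ordConnected_Ici)
      (hc.equivariantOn.mono fun w hw => by
        have : ht j w = ht j v := hw.1
        rw [mem_halfPlane]; omega)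
      (fun w hw => by
        have h8 : ht j w = ht j v := hw.1
        have h9 : ht (j + 1) b ≤ ht (j + 1) w := hw.2
        exact (h₂ w ⟨j, by omega⟩).2 ⟨h9, by rw [e4, e4]; omega⟩)
      (fun w hw => ⟨j, by have : ht j w = ht j v := hw.1; omega⟩)
      _ ⟨hu1, huQ'.1⟩ hum' v ⟨rfl, hvQ'.1⟩

/-- A half-plane that inverts the grading in the depth of a corner also inverts it along the
boundary of the corner. -/
theorem GradedRep.matches_boundary {j : ℕ} {Q : Set X} {g : X → ℤ × ℤ} {c : ℤ × ℤ → X} {n : ℤ}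
    (hQ : GradedRep ρ (j + 1) Q g) (hc : IsChart ρ c (j + 1) n)
    (hN : ∃ N, ∀ v, N ≤ ht j v → N ≤ ht (j + 1) v → Matches Q g c v) :
    ∃ N, ∀ v, N ≤ ht (j + 1) v → v ∈ g '' Q → Matches Q g c v := by
  obtain ⟨N, hN⟩ := hN
  obtain ⟨n₂, b, h₂⟩ := hQ.mem_image_iff
  obtain ⟨n₄, h₄⟩ := hQ.matches_of_stepConnected
  obtain ⟨M, hM⟩ : ∃ M, n ≤ M ∧ N ≤ M ∧ n₂ ≤ M ∧ n₄ ≤ M ∧ ht (j + 1) b ≤ M :=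
    ⟨max n (max N (max n₂ (max n₄ (ht (j + 1) b)))), by
      simp only [le_max_iff, le_refl, true_or, or_true, and_self]⟩
  have e4 : ∀ u, ht (j + 1 + 3) u = ht j u := fun u => ht_add_four j u
  refine ⟨M, fun v hv hvQ => ?_⟩
  have hvQ' := (h₂ v ⟨j + 1, by omega⟩).1 hvQ
  rw [e4, e4] at hvQ'
  obtain ⟨u, hu, hu'⟩ := exists_ht_eq j (max (ht j b) N) (ht (j + 1) v)
  have h6 := le_max_left (ht j b) N
  have h7 := le_max_right (ht j b) N
  exact h₄ c {w | ht j w ∈ Set.Ici (ht j b) ∧ ht (j + 1) w ∈ ({ht (j + 1) v} : Set ℤ)}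
      (stepConnected_ht j Set.ordConnected_Ici Set.ordConnected_singleton)
      (hc.equivariantOn.mono fun w hw => by
        have : ht (j + 1) w = ht (j + 1) v := hw.2
        rw [mem_halfPlane]; omega)
      (fun w hw => by
        have h8 : ht (j + 1) w = ht (j + 1) v := hw.2
        have h9 : ht j b ≤ ht j w := hw.1
        exact (h₂ w ⟨j + 1, by omega⟩).2 ⟨by omega, by rw [e4, e4]; omega⟩)
      (fun w hw => ⟨j + 1, by have : ht (j + 1) w = ht (j + 1) v := hw.2; omega⟩)
      u ⟨Set.mem_Ici.2 (by omega), hu'⟩ (hN u (by omega) (by omega)) v ⟨hvQ'.2, rfl⟩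

theorem corner_infinite (j : ℕ) (n : ℤ) : {v | n ≤ ht j v ∧ n ≤ ht (j + 1) v}.Infinite := by
  choose f hf hf' using fun k : ℕ => exists_ht_eq j (n + k) n
  refine (Set.infinite_range_of_injective (f := f) fun a b h => ?_).mono ?_
  · have h1 := hf a
    rw [h, hf b] at h1
    omega
  · rintro _ ⟨k, rfl⟩
    simp only [Set.mem_ofPred_eq, hf, hf']
    omega

/-- A near `ℤ²`-set with winding number `m` and additive holonomy `s` has a development of period
`(m, s)`, which covers it. -/
theorem HasWindingHolonomy.exists_development (hα : RepAction ρ α) {m : ℕ} {s : ℤ × ℤ}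
    (h : HasWindingHolonomy α m s) :
    ∃ c, Development ρ c ∧ HasPeriod c m s ∧ Covers c m := by
  obtain ⟨hm, P, f, hP, hdisj, hcov, hadj, hP0, hf0⟩ := h
  have hG : ∀ j ≤ 4 * m, GradedRep ρ j (P j) (f j) := by
    intro j hj
    rcases Nat.lt_or_ge j (4 * m) with h | h
    · exact (isGradedCorner_iff hα).1 (hP j h)
    · obtain rfl : j = 4 * m := by omega
      have h1 := ((isGradedCorner_iff hα).1 (hP 0 (by omega))).translate s
      rw [show f (4 * m) = fun x => f 0 x + s from funext hf0, hP0]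
      exact h1.congr_mod (by omega)
  have hA : ∀ j < 4 * m, AdjacentRep ρ (exitVec j) (P j) (f j) (P (j + 1)) (f (j + 1)) :=
    fun j hj => (gradedAdjacent_iff hα).1 (hadj j hj)
  obtain ⟨c₀, ⟨n, hc₀⟩, hmatch⟩ := (hG 0 (by omega)).exists_chart hα.nearRep
  obtain ⟨c, hc, rfl⟩ := hα.nearRep.exists_development hc₀
  -- the development inverts the gradings in the depth of the corners
  have hdeep : ∀ j ≤ 4 * m, ∃ N, ∀ v, N ≤ ht (j + 3) v → N ≤ ht j v →
      Matches (P j) (f j) (c j) v := by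
    intro j
    induction j with
    | zero => intro _; simpa using hmatch
    | succ j ih =>
      intro hj
      obtain ⟨n₁, h₁⟩ := hc.chart j
      obtain ⟨N, hN⟩ := (hG j (by omega)).matches_next (hG (j + 1) hj) (hA j hj) h₁ (ih (by omega))
      obtain ⟨n₂, h₂⟩ := hc.agree j
      obtain ⟨n₃, a, h₃⟩ := (hG (j + 1) hj).mem_image_iff
      obtain ⟨M, hM⟩ : ∃ M, N ≤ M ∧ n₂ ≤ M ∧ n₃ ≤ M ∧ ht j a ≤ M ∧ ht (j + 1) a ≤ M :=
        ⟨max N (max n₂ (max n₃ (max (ht j a) (ht (j + 1) a)))), by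
          simp only [le_max_iff, le_refl, true_or, or_true, and_self]⟩
      have e4 : ∀ u, ht (j + 1 + 3) u = ht j u := fun u => ht_add_four j u
      refine ⟨M, fun v hv hv' => ?_⟩
      rw [e4] at hv
      have := hN v (by omega) ((h₃ v ⟨j, by omega⟩).2 ⟨by omega, by rw [e4, e4]; omega⟩)
      unfold Matches
      rw [← h₂ v (by omega) (by omega)]
      exact this
  have hnext : ∀ j < 4 * m, ∃ N, ∀ v, N ≤ ht j v → v ∈ f (j + 1) '' P (j + 1) →
      Matches (P (j + 1)) (f (j + 1)) (c j) v := by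
    intro j hj
    obtain ⟨n₁, h₁⟩ := hc.chart j
    exact (hG j hj.le).matches_next (hG (j + 1) hj) (hA j hj) h₁ (hdeep j hj.le)
  have hbound : ∀ j < 4 * m, ∃ N, ∀ v, N ≤ ht (j + 1) v → v ∈ f (j + 1) '' P (j + 1) →
      Matches (P (j + 1)) (f (j + 1)) (c (j + 1)) v := by
    intro j hj
    obtain ⟨n₁, h₁⟩ := hc.chart (j + 1)
    obtain ⟨N, hN⟩ := hdeep (j + 1) hj
    exact (hG (j + 1) hj).matches_boundary h₁ ⟨N, fun v hv hv' => hN v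
      (by rwa [show j + 1 + 3 = j + 4 by rfl, ht_add_four]) hv'⟩
  have hshift : Shift 0 (c (4 * m)) (c 0) (-s) := by
    obtain ⟨n₁, h₁⟩ := hc.chart (4 * m)
    obtain ⟨N₁, hN₁⟩ := hdeep (4 * m) le_rfl
    obtain ⟨N₂, hN₂⟩ := hdeep 0 (by omega)
    have e0 : ∀ u, ht (4 * m) u = ht 0 u := fun u => ht_congr (by omega) u
    have e3 : ∀ u, ht (4 * m + 3) u = ht 3 u := fun u => ht_congr (by omega) u
    have e4 : ∀ u, ht (3 + 1) u = ht 0 u := fun u => ht_add_four 0 u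
    obtain ⟨M, hM⟩ : ∃ M, n ≤ M + ht 0 (-s) ∧ n₁ ≤ M ∧ N₁ ≤ M ∧ N₂ ≤ M + ht 0 (-s) ∧
        N₂ ≤ M + ht 3 (-s) := by
      refine ⟨max (n - ht 0 (-s)) (max n₁ (max N₁ (max (N₂ - ht 0 (-s)) (N₂ - ht 3 (-s))))), ?_⟩
      omega
    obtain ⟨v, hv, hv'⟩ := exists_ht_eq 3 M M
    rw [e4] at hv'
    refine (h₁.congr_mod (j := 0) (by omega)).shift_of_eq hc₀ (v := v) (by omega)
      (by rw [ht_add]; omega) ?_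
    have h2 := hN₁ v (by rw [e3]; omega) (by rw [e0]; omega)
    have h3 := hN₂ (v + -s) (by rw [zero_add, ht_add]; omega) (by rw [ht_add]; omega)
    rw [hP0] at h2
    refine (hG 0 (by omega)).injOn h2.1 h3.1 ?_
    rw [h3.2, ← sub_eq_add_neg, eq_sub_iff_add_eq, ← hf0, h2.2]
  refine ⟨c, hc, ⟨hm, hshift, ?_⟩, ?_⟩
  · rintro k hk hkm t ⟨N, hN⟩
    obtain ⟨N₁, hN₁⟩ := hdeep (4 * k) (by omega)
    obtain ⟨N₂, hN₂⟩ := hdeep 0 (by omega)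
    have e0 : ∀ u, ht (4 * k) u = ht 0 u := fun u => ht_congr (by omega) u
    have e3 : ∀ u, ht (4 * k + 3) u = ht 3 u := fun u => ht_congr (by omega) u
    have e4 : ∀ u, ht (3 + 1) u = ht 0 u := fun u => ht_add_four 0 u
    obtain ⟨M, hM⟩ : ∃ M, n ≤ M + ht 0 t ∧ N ≤ M ∧ N₁ ≤ M ∧ N₂ ≤ M + ht 0 t ∧
        N₂ ≤ M + ht 3 t := by
      refine ⟨max (n - ht 0 t) (max N (max N₁ (max (N₂ - ht 0 t) (N₂ - ht 3 t)))), ?_⟩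
      omega
    refine (corner_infinite 3 M) (Set.Finite.of_injOn (f := fun v => c 0 (v + t)) (fun v hv => ?_)
      (fun v hv w hw hvw => ?_) (hdisj (4 * k) (by omega) 0 (by omega) (by omega)))
    · obtain ⟨h1, h2⟩ := hv
      rw [e4] at h2
      have h3 := (hN₂ (v + t) (by rw [zero_add, ht_add]; omega) (by rw [ht_add]; omega)).1
      refine ⟨?_, h3⟩
      change c 0 (v + t) ∈ _
      rw [← hN v (by omega)]
      exact (hN₁ v (by rw [e3]; omega) (by rw [e0]; omega)).1
    · obtain ⟨-, h2⟩ := hv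
      obtain ⟨-, h4⟩ := hw
      rw [e4] at h2 h4
      exact add_right_cancel (hc₀.injOn (by rw [mem_halfPlane, ht_add]; omega)
        (by rw [mem_halfPlane, ht_add]; omega) hvw)
  · intro N
    choose! N₁ hN₁ using hnext
    choose! N₂ hN₂ using hbound
    obtain ⟨n₃, hn₃⟩ := hshift
    obtain ⟨M, hM⟩ := ((Set.finite_Iio (4 * m)).image fun j =>
      max (N₁ j) (max (N₂ j) (max N (max n₃ (N + ht 0 s))))).bddAbove
    replace hM : ∀ j < 4 * m, N₁ j ≤ M ∧ N₂ j ≤ M ∧ N ≤ M ∧ n₃ ≤ M ∧ N + ht 0 s ≤ M := by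
      intro j hj
      have := hM ⟨j, hj, rfl⟩
      simpa only [max_le_iff] using this
    -- the points of each corner whose degree is deep for neither of the two half-planes
    have hsmall : ∀ j < 4 * m, {x | x ∈ P (j + 1) ∧ ht j (f (j + 1) x) < M ∧
        ht (j + 1) (f (j + 1) x) < M}.Finite := by
      intro j hj
      obtain ⟨a, ha⟩ := (hG (j + 1) hj).image
      have e4 : ∀ u, ht (j + 1 + 3) u = ht j u := fun u => ht_add_four j u
      refine Set.Finite.of_finite_image (f := f (j + 1)) ?_
        ((hG (j + 1) hj).injOn.mono fun x hx => hx.1)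
      refine (ha.union (finite_of_ht j (n := min (ht j a) (ht (j + 1) a)) (N := M)
        (B := {v | v ∈ corner (j + 1) a ∧ ht j v < M ∧ ht (j + 1) v < M}) ?_)).subset ?_
      · rintro v ⟨h1, h2, h3⟩
        rw [mem_corner_iff, e4, e4] at h1
        omega
      · rintro _ ⟨x, ⟨h1, h2, h3⟩, rfl⟩
        by_cases h4 : f (j + 1) x ∈ corner (j + 1) a
        · exact Or.inr ⟨h4, h2, h3⟩
        · exact Or.inl (Or.inl ⟨⟨x, h1, rfl⟩, h4⟩)
    filter_upwards [hcov.compl_mem_cofinite,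
      ((Set.finite_Iio (4 * m)).biUnion hsmall).compl_mem_cofinite] with x h1 h2
    obtain ⟨j, hj, hx⟩ : ∃ j < 4 * m, x ∈ P (j + 1) := by
      simp only [Set.mem_compl_iff, Set.mem_ofPred_eq, not_forall, not_not] at h1
      obtain ⟨i, hi, hx⟩ := h1
      rcases Nat.eq_zero_or_pos i with rfl | hi0
      · exact ⟨4 * m - 1, by omega, by rwa [show 4 * m - 1 + 1 = 4 * m by omega, hP0]⟩
      · exact ⟨i - 1, by omega, by rwa [Nat.sub_add_cancel hi0]⟩
    have hMj := hM j hj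
    by_cases h3 : M ≤ ht j (f (j + 1) x)
    · have h4 := hN₁ j hj _ (by omega) ⟨x, hx, rfl⟩
      exact ⟨j, hj, f (j + 1) x, by omega, (hG (j + 1) hj).injOn h4.1 hx h4.2⟩
    by_cases h4 : M ≤ ht (j + 1) (f (j + 1) x)
    · have h5 := hN₂ j hj _ (by omega) ⟨x, hx, rfl⟩
      have h6 := (hG (j + 1) hj).injOn h5.1 hx h5.2
      rcases Nat.lt_or_ge (j + 1) (4 * m) with h | h
      · exact ⟨j + 1, h, _, by omega, h6⟩
      · have h7 : j + 1 = 4 * m := by omega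
        rw [h7, ht_congr (j := 0) (by omega)] at h4
        refine ⟨0, by omega, f (4 * m) x + -s, by rw [ht_add, ht_neg]; omega, ?_⟩
        rw [h7] at h6
        rw [← hn₃ _ (by omega), h6]
    · exact (h2 (Set.mem_biUnion (show j ∈ Set.Iio (4 * m) from hj)
        ⟨hx, by omega, by omega⟩)).elim

end GradedCorners

/-! ### Near `ℤ²`-sets covered by a development -/

section Covered

variable {X : Type u} {ρ : ℤ × ℤ → X → X}

theorem Development.exists_depth {c : ℕ → ℤ × ℤ → X} (hc : Development ρ c) {P : X → Prop}
    (hP : ∀ᶠ x in cofinite, P x) (K : ℕ) : ∃ N, ∀ j ≤ K, ∀ v, N ≤ ht j v → P (c j v) := by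
  choose n hn using hc.chart
  choose N hN using fun j => (hn j).tendsto hP
  obtain ⟨M, hM⟩ := ((Set.finite_Iic K).image N).bddAbove
  exact ⟨M, fun j hj v hv => hN j v ((hM ⟨j, hj, rfl⟩).trans hv)⟩

theorem Development.oneEndedRep {c : ℕ → ℤ × ℤ → X} (hc : Development ρ c) {m : ℕ}
    (hcov : Covers c m) : OneEndedRep ρ := by
  constructor
  · obtain ⟨n, hn⟩ := hc.chart 0
    exact Set.infinite_univ_iff.1 fun h => halfPlane_infinite 0 n
      (Set.Finite.of_injOn (fun _ _ => Set.mem_univ _) hn.injOn h)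
  intro A hA
  choose n hn using hc.chart
  choose n' hn' using hc.agree
  obtain ⟨M, hM⟩ := ((Set.finite_Iic (4 * m)).image fun j => max (n j) (n' j)).bddAbove
  replace hM : ∀ j ≤ 4 * m, n j ≤ M ∧ n' j ≤ M := fun j hj => max_le_iff.1 (hM ⟨j, hj, rfl⟩)
  obtain ⟨N, hN⟩ := hc.exists_depth (eventually_unitVec hA) (4 * m)
  set L := max M N
  have h1 : M ≤ L := le_max_left _ _
  have h2 : N ≤ L := le_max_right _ _
  -- each half-plane is contained in `A` or disjoint from it
  have hall : ∀ j ≤ 4 * m, (∃ v, L ≤ ht j v ∧ c j v ∈ A) → ∀ v, L ≤ ht j v → c j v ∈ A := by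
    rintro j hj ⟨v, hv, hvA⟩
    refine stepConnected_halfPlane j L (fun v => c j v ∈ A) v hv hvA fun u hu huA e he hue => ?_
    rw [← (hn j).equivariantOn u ((hM j hj).1.trans (h1.trans hu)) e he
      ((hM j hj).1.trans (h1.trans hue))]
    exact hN j hj u (h2.trans hu) e he huA
  have hsucc : ∀ j < 4 * m,
      ((∃ v, L ≤ ht j v ∧ c j v ∈ A) ↔ ∃ v, L ≤ ht (j + 1) v ∧ c (j + 1) v ∈ A) := by
    intro j hj
    obtain ⟨u, hu, hu'⟩ := exists_ht_eq j L L
    have h3 := hn' j u (by have := (hM j hj.le).2; omega) (by have := (hM j hj.le).2; omega)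
    exact ⟨fun h => ⟨u, hu'.ge, h3 ▸ hall j hj.le h u hu.ge⟩,
      fun h => ⟨u, hu.ge, h3.symm ▸ hall (j + 1) hj h u hu'.ge⟩⟩
  have hzero : ∀ j ≤ 4 * m,
      ((∃ v, L ≤ ht j v ∧ c j v ∈ A) ↔ ∃ v, L ≤ ht 0 v ∧ c 0 v ∈ A) := by
    intro j
    induction j with
    | zero => exact fun _ => Iff.rfl
    | succ j ih => exact fun hj => (hsucc j hj).symm.trans (ih (by omega))
  by_cases h : ∃ v, L ≤ ht 0 v ∧ c 0 v ∈ A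
  · right
    refine (show ∀ᶠ x in cofinite, x ∈ A from ?_)
    filter_upwards [hcov L] with x ⟨j, hj, v, hv, hvx⟩
    exact hvx ▸ hall j hj.le ((hzero j hj.le).2 h) v hv
  · left
    have : ∀ᶠ x in cofinite, ¬ x ∈ A := by
      filter_upwards [hcov L] with x ⟨j, hj, v, hv, hvx⟩ hx
      exact h ((hzero j hj.le).1 ⟨v, hv, hvx ▸ hx⟩)
    simpa [Filter.eventually_cofinite] using this

theorem IsChart.exists_equivariant (hρ : NearRep ρ) {c : ℤ × ℤ → X} {j : ℕ} {n : ℤ}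
    (hc : IsChart ρ c j n) (g : ℤ × ℤ) : ∃ N, ∀ v, N ≤ ht j v → ρ g (c v) = c (v + g) := by
  refine induction_unitVec (P := fun g => ∃ N, ∀ v, N ≤ ht j v → ρ g (c v) = c (v + g)) ?_ ?_ ?_ g
  · obtain ⟨N, hN⟩ := hc.tendsto hρ.zero
    exact ⟨N, fun v hv => by rw [hN v hv, add_zero]⟩
  · rintro g h ⟨N₁, h₁⟩ ⟨N₂, h₂⟩
    obtain ⟨N₃, h₃⟩ := hc.tendsto (hρ.add g h)
    refine ⟨max (N₁ - ht j h) (max N₂ N₃), fun v hv => ?_⟩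
    rw [h₃ v (by omega), h₂ v (by omega), h₁ _ (by rw [ht_add]; omega), add_assoc, add_comm h g]
  · intro e he
    refine ⟨n + 1, fun v hv => hc.equivariantOn v (by rw [mem_halfPlane]; omega) e he ?_⟩
    have := he.abs_ht_le j
    rw [mem_halfPlane, ht_add]
    omega

theorem Development.freeRep (hρ : NearRep ρ) {c : ℕ → ℤ × ℤ → X} (hc : Development ρ c) {m : ℕ}
    (hcov : Covers c m) : FreeRep ρ := by
  intro g hg
  choose n hn using hc.chart
  choose N hN using fun j => (hn j).exists_equivariant hρ g
  obtain ⟨M, hM⟩ := ((Set.finite_Iic (4 * m)).image fun j =>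
    max (N j) (max (n j) (n j - ht j g))).bddAbove
  filter_upwards [hcov M] with x ⟨j, hj, v, hv, hvx⟩ hx
  have h1 := hM ⟨j, hj.le, rfl⟩
  simp only at h1
  rw [← hvx, hN j v (by omega)] at hx
  have h2 := (hn j).injOn (by rw [mem_halfPlane, ht_add]; omega) (by rw [mem_halfPlane]; omega) hx
  exact hg (by simpa using h2)

end Covered

/-! ### The near `ℤ²`-sets `X_{m,s}` have winding number `m` and additive holonomy `s` -/

section ModelHolonomy

variable {m : ℕ} {s : ℤ × ℤ}

theorem coe_finRotate_mod (k : Fin m) : (finRotate m k : ℕ) = (k + 1) % m := by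
  rcases m with _ | n
  · exact k.elim0
  · rw [finRotate_apply, Fin.val_add_one]
    split_ifs with h
    · rw [h]; simp
    · have : (k : ℕ) < n := by
        have := k.2
        have : (k : ℕ) ≠ n := fun hc => h (Fin.ext (by simpa using hc))
        omega
      rw [Nat.mod_eq_of_lt (by omega)]

theorem eventually_notMem_box (N : ℤ) :
    ∀ᶠ p : modelSet m s in cofinite, ¬ (|p.1.x| ≤ N ∧ |p.1.y| ≤ N) := by
  have := finite_of_box m s N {p | |p.1.x| ≤ N ∧ |p.1.y| ≤ N} fun p hp => hp
  filter_upwards [this.compl_mem_cofinite] with p hp using hp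

theorem eventually_far : ∀ᶠ p : modelSet m s in cofinite, Far m s p.1 := by
  filter_upwards [eventually_notMem_box (|s.1| + |s.2| + 2)] with p hp
  unfold Far
  omega

theorem modelAction_right :
    modelAction m s (Multiplicative.ofAdd (1, 0)) = NearBij.mk (modelRight m s) := by
  change NearBij.mk (modelRight m s) ^ (1 : ℤ) * NearBij.mk (modelUp m s) ^ (0 : ℤ) = _
  exact (congrArg₂ _ (zpow_one _) (zpow_zero _)).trans (mul_one _)

theorem modelAction_up :
    modelAction m s (Multiplicative.ofAdd (0, 1)) = NearBij.mk (modelUp m s) := by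
  change NearBij.mk (modelRight m s) ^ (0 : ℤ) * NearBij.mk (modelUp m s) ^ (1 : ℤ) = _
  exact (congrArg₂ _ (zpow_zero _) (zpow_one _)).trans (one_mul _)

theorem modelAction_left :
    modelAction m s (Multiplicative.ofAdd (-1, 0)) = NearBij.mk (modelRight m s).symm := by
  have : Multiplicative.ofAdd ((-1, 0) : ℤ × ℤ) = (Multiplicative.ofAdd ((1, 0) : ℤ × ℤ))⁻¹ := rfl
  rw [this, map_inv, modelAction_right]
  rfl

theorem modelAction_down :
    modelAction m s (Multiplicative.ofAdd (0, -1)) = NearBij.mk (modelUp m s).symm := by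
  have : Multiplicative.ofAdd ((0, -1) : ℤ × ℤ) = (Multiplicative.ofAdd ((0, 1) : ℤ × ℤ))⁻¹ := rfl
  rw [this, map_inv, modelAction_up]
  rfl

/-- One step in the direction of a unit vector, on the points of the model. -/
def modelStep (m : ℕ) (s : ℤ × ℤ) (e : ℤ × ℤ) : Pt m → Pt m :=
  if e = (1, 0) then right m else if e = (-1, 0) then left m else
    if e = (0, 1) then up m s else down m s

theorem eventually_modelStep {ρ : ℤ × ℤ → modelSet m s → modelSet m s}
    (hρ : RepAction ρ (modelAction m s)) {e : ℤ × ℤ} (he : UnitVec e) :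
    ∀ᶠ p in cofinite, (ρ e p).1 = modelStep m s e p.1 := by
  have h := hρ e
  rcases he with rfl | rfl | rfl | rfl
  · rw [modelAction_right] at h
    filter_upwards [represents_mk.1 h, eventually_far] with p h1 h2
    have h3 := pequivOfMaps_apply _ _ _ p (right_spec m s p.1 p.2 h2)
    exact (congrArg Subtype.val (Option.some.inj (h3.symm.trans h1))).symm
  · rw [modelAction_left] at h
    filter_upwards [represents_mk.1 h, eventually_far] with p h1 h2
    have h3 : (modelRight m s).symm.toPEquiv p = some ⟨left m p.1, _⟩ :=
      dif_pos (left_spec m s p.1 p.2 h2)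
    exact (congrArg Subtype.val (Option.some.inj (h3.symm.trans h1))).symm
  · rw [modelAction_up] at h
    filter_upwards [represents_mk.1 h, eventually_far] with p h1 h2
    have h3 := pequivOfMaps_apply _ _ _ p (up_spec m s p.1 p.2 h2)
    exact (congrArg Subtype.val (Option.some.inj (h3.symm.trans h1))).symm
  · rw [modelAction_down] at h
    filter_upwards [represents_mk.1 h, eventually_far] with p h1 h2
    have h3 : (modelUp m s).symm.toPEquiv p = some ⟨down m s p.1, _⟩ :=
      dif_pos (down_spec m s p.1 p.2 h2)
    exact (congrArg Subtype.val (Option.some.inj (h3.symm.trans h1))).symm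

/-- The `j`-th quadrant of `X_{m,s}`, where `j` matters modulo `4 * m`. -/
def quadrant (m : ℕ) (s : ℤ × ℤ) (j : ℕ) : Set (modelSet m s) :=
  {p | (p.1.k : ℕ) = j / 4 % m ∧ (p.1.upper = true ↔ j % 4 < 2) ∧
    (0 ≤ p.1.x ↔ j % 4 = 0 ∨ j % 4 = 3)}

/-- The coordinates on the `j`-th quadrant of `X_{m,s}`, translated by `s` after the last one. -/
def quadrantGrading (m : ℕ) (s : ℤ × ℤ) (j : ℕ) (p : modelSet m s) : ℤ × ℤ :=
  if j < 4 * m then (p.1.x, p.1.y) else (p.1.x, p.1.y) + s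

theorem mem_image_quadrant {j : ℕ} (hj : j < 4 * m) {v : ℤ × ℤ} :
    v ∈ quadrantGrading m s j '' quadrant m s j ↔
      ((0 ≤ v.1 ↔ j % 4 = 0 ∨ j % 4 = 3) ∧
        if j % 4 < 2 then 0 ≤ v.2 else v.2 < height m s ⟨j / 4, by omega⟩ v.1) := by
  have hjm : j / 4 < m := by omega
  have hk : j / 4 % m = j / 4 := Nat.mod_eq_of_lt hjm
  constructor
  · rintro ⟨⟨⟨b, k, x, y⟩, hp⟩, ⟨h1, h2, h3⟩, rfl⟩
    simp only [hk] at h1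
    obtain rfl : k = ⟨j / 4, hjm⟩ := Fin.ext h1
    have hp2 : if b = true then 0 ≤ y else y < height m s ⟨j / 4, hjm⟩ x := hp
    simp only [quadrantGrading, hj, if_true]
    refine ⟨h3, ?_⟩
    by_cases hb : j % 4 < 2
    · have : b = true := h2.2 hb
      simpa [hb, this] using hp2
    · have : ¬ b = true := fun h => hb (h2.1 h)
      simpa [hb, this] using hp2
  · rintro ⟨h1, h2⟩
    refine ⟨⟨⟨decide (j % 4 < 2), ⟨j / 4, by omega⟩, v.1, v.2⟩, ?_⟩, ⟨by simp [hk], by simp, h1⟩,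
      by simp [quadrantGrading, hj]⟩
    simpa [modelSet] using h2

theorem image_quadrant {j : ℕ} (hj : j < 4 * m) :
    ∃ c, quadrantGrading m s j '' quadrant m s j = corner j c := by
  have hr : j % 4 = 0 ∨ j % 4 = 1 ∨ j % 4 = 2 ∨ j % 4 = 3 := by omega
  have key : ∀ c : ℤ × ℤ, (∀ v : ℤ × ℤ, ((0 ≤ v.1 ↔ j % 4 = 0 ∨ j % 4 = 3) ∧
        if j % 4 < 2 then 0 ≤ v.2 else v.2 < height m s ⟨j / 4, by omega⟩ v.1) ↔
        v ∈ corner j c) → ∃ c, quadrantGrading m s j '' quadrant m s j = corner j c :=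
    fun c h => ⟨c, Set.ext fun v => (mem_image_quadrant hj).trans (h v)⟩
  rcases hr with hr | hr | hr | hr
  · refine key (0, 0) fun v => ?_
    simp [corner, hr]
  · refine key (-1, 0) fun v => ?_
    simp only [corner, hr, Set.mem_ofPred_eq]
    norm_num
    omega
  · refine key (-1, -1) fun v => ?_
    simp only [corner, hr, Set.mem_ofPred_eq, height]
    norm_num
    split_ifs <;> omega
  · refine key (0, (seam m s ⟨j / 4, by omega⟩).2 - 1) fun v => ?_
    simp only [corner, hr, Set.mem_ofPred_eq, height]
    norm_num
    intro h
    simp only [h, if_true]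

theorem quadrant_gradedRep {ρ : ℤ × ℤ → modelSet m s → modelSet m s}
    (hρ : RepAction ρ (modelAction m s)) {j : ℕ} (hj : j < 4 * m) :
    GradedRep ρ j (quadrant m s j) (quadrantGrading m s j) where
  injOn := by
    rintro ⟨⟨b, k, x, y⟩, hp⟩ ⟨h1, h2, h3⟩ ⟨⟨b', k', x', y'⟩, hp'⟩ ⟨h1', h2', h3'⟩ h
    simp only [quadrantGrading, hj, if_true, Prod.mk.injEq] at *
    obtain ⟨rfl, rfl⟩ := h
    obtain rfl : k = k' := Fin.ext (h1.trans h1'.symm)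
    obtain rfl : b = b' := by
      rw [Bool.eq_iff_iff, h2, h2']
    rfl
  image := by
    obtain ⟨c, hc⟩ := image_quadrant (s := s) hj
    exact ⟨c, by rw [hc, symmDiff_self]; exact Set.finite_empty⟩
  step e he := by
    filter_upwards [eventually_modelStep hρ he] with p hp h1 h2
    rw [mem_image_quadrant hj] at h2
    have hjm : j / 4 < m := by omega
    have hk : j / 4 % m = j / 4 := Nat.mod_eq_of_lt hjm
    obtain ⟨⟨b, k, x, y⟩, hpm⟩ := p
    obtain ⟨q, hq⟩ : ∃ q, ρ e ⟨⟨b, k, x, y⟩, hpm⟩ = q := ⟨_, rfl⟩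
    rw [hq] at hp ⊢
    obtain ⟨h3, h4, h5⟩ := h1
    simp only [hk] at h3
    obtain rfl : k = ⟨j / 4, hjm⟩ := Fin.ext h3
    have hqq : q.1 = ⟨b, ⟨j / 4, hjm⟩, x + e.1, y + e.2⟩ := by
      rw [hp]
      simp only [quadrantGrading, hj, if_true] at h2
      rcases he with rfl | rfl | rfl | rfl
      · simp [modelStep, right]
      · simp [modelStep, left, sub_eq_add_neg]
      · have h6 : b = true ∨ y + 1 < height m s ⟨j / 4, hjm⟩ x := by
          by_cases h8 : j % 4 < 2
          · exact Or.inl (h4.2 h8)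
          · simp only [h8, if_false] at h2
            have h9 : y + 1 < height m s ⟨j / 4, hjm⟩ (x + 0) := h2.2
            rw [add_zero] at h9
            exact Or.inr h9
        have h7 : up m s ⟨b, ⟨j / 4, hjm⟩, x, y⟩ = ⟨b, ⟨j / 4, hjm⟩, x, y + 1⟩ := if_pos h6
        simpa [modelStep] using h7
      · have h6 : b = false ∨ 0 < y := by
          by_cases h8 : j % 4 < 2
          · simp only [h8, if_true] at h2
            have h9 : 0 ≤ y + -1 := h2.2
            exact Or.inr (by omega)
          · exact Or.inl (by simpa using fun h => h8 (h4.1 h))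
        have h7 : down m s ⟨b, ⟨j / 4, hjm⟩, x, y⟩ = ⟨b, ⟨j / 4, hjm⟩, x, y - 1⟩ := if_pos h6
        simpa [modelStep, sub_eq_add_neg] using h7
    simp only [quadrantGrading, hj, if_true, quadrant, Set.mem_ofPred_eq, hqq, hk] at *
    exact ⟨⟨trivial, h4, h2.1⟩, rfl⟩

theorem quadrant_adjacentRep {ρ : ℤ × ℤ → modelSet m s → modelSet m s}
    (hρ : RepAction ρ (modelAction m s)) {j : ℕ} (hj : j < 4 * m) :
    AdjacentRep ρ (exitVec j) (quadrant m s j) (quadrantGrading m s j) (quadrant m s (j + 1))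
      (quadrantGrading m s (j + 1)) := by
  filter_upwards [eventually_modelStep hρ (unitVec_exitVec j),
    eventually_notMem_box (|s.1| + |s.2| + 2)] with p hp hbox h1 h2
  rw [mem_image_quadrant hj] at h2
  have hjm : j / 4 < m := by omega
  have hk : j / 4 % m = j / 4 := Nat.mod_eq_of_lt hjm
  have hseam := seam_le m s p.1.k
  obtain ⟨⟨b, k, x, y⟩, hpm⟩ := p
  obtain ⟨q, hq⟩ : ∃ q, ρ (exitVec j) ⟨⟨b, k, x, y⟩, hpm⟩ = q := ⟨_, rfl⟩
  rw [hq] at hp ⊢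
  obtain ⟨h3, h4, h5⟩ := h1
  simp only [hk] at h3
  obtain rfl : k = ⟨j / 4, hjm⟩ := Fin.ext h3
  have hr : j % 4 = 0 ∨ j % 4 = 1 ∨ j % 4 = 2 ∨ j % 4 = 3 := by omega
  have hkk : (finRotate m ⟨j / 4, hjm⟩ : ℕ) = (j / 4 + 1) % m := coe_finRotate_mod _
  have hpm2 : if b = true then 0 ≤ y else y < height m s ⟨j / 4, hjm⟩ x := hpm
  simp only [quadrantGrading, hj, if_true] at h2 h4 h5 hbox hseam ⊢
  rcases hr with hr | hr | hr | hr
  · -- to the upper left quadrant of the same sheet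
    have e1 : exitVec j = (-1, 0) := by simp [exitVec, hr]
    have e2 : j + 1 < 4 * m := by omega
    have e3 : (j + 1) / 4 = j / 4 := by omega
    have e4 : (j + 1) % 4 = 1 := by omega
    rw [e1] at hp h2 ⊢
    simp [hr] at h4 h5 h2
    subst h4
    simp [quadrant, hp, modelStep, left, e2, e3, e4, hk, sub_eq_add_neg]
    simp at hpm2
    omega
  · -- to the lower left quadrant of the same sheet
    have e1 : exitVec j = (0, -1) := by simp [exitVec, hr]
    have e2 : j + 1 < 4 * m := by omega
    have e3 : (j + 1) / 4 = j / 4 := by omega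
    have e4 : (j + 1) % 4 = 2 := by omega
    rw [e1] at hp h2 ⊢
    simp [hr] at h4 h5 h2
    subst h4
    simp at hpm2
    have h6 : ¬ 0 < y := by omega
    have h7 : ¬ 0 ≤ x := by omega
    have h8 : y = 0 := by omega
    simpa [quadrant, hp, modelStep, down, e2, e3, e4, hk, h7, h8] using h5
  · -- to the lower right quadrant of the same sheet
    have e1 : exitVec j = (1, 0) := by simp [exitVec, hr]
    have e2 : j + 1 < 4 * m := by omega
    have e3 : (j + 1) / 4 = j / 4 := by omega
    have e4 : (j + 1) % 4 = 3 := by omega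
    rw [e1] at hp h2 ⊢
    simp [hr] at h4 h5 h2
    subst h4
    have hx : 0 ≤ x + 1 := by
      by_contra hx
      have h8 : ¬ 0 ≤ x := by omega
      have h9 := h2 (by omega)
      simp [height, h8] at hpm2
      simp [height, hx] at h9
      omega
    simp [quadrant, hp, modelStep, right, e2, e3, e4, hk, hx]
  · -- through the seam, to the upper right quadrant of the next sheet
    have e1 : exitVec j = (0, 1) := by simp [exitVec, hr]
    have e3 : (j + 1) / 4 = j / 4 + 1 := by omega
    have e4 : (j + 1) % 4 = 0 := by omega
    rw [e1] at hp h2 ⊢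
    simp [hr] at h4 h5 h2
    subst h4
    have h2' := h2 h5
    simp [height, h5] at h2' hpm2
    have h6 : ¬ y + 1 < (seam m s ⟨j / 4, hjm⟩).2 := by omega
    have h7 : y + 1 = (seam m s ⟨j / 4, hjm⟩).2 := by omega
    have hx : |x| = x := abs_of_nonneg h5
    have h8 : (seam m s ⟨j / 4, hjm⟩).1 ≤ x := by
      have := le_abs_self (seam m s ⟨j / 4, hjm⟩).1
      have := abs_nonneg (seam m s ⟨j / 4, hjm⟩).1
      have := neg_abs_le (seam m s ⟨j / 4, hjm⟩).2
      have := le_abs_self (seam m s ⟨j / 4, hjm⟩).2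
      have h9 : |y| ≤ |s.1| + |s.2| + 2 := abs_le.2 ⟨by omega, by omega⟩
      omega
    have hup : q.1 = ⟨true, finRotate m ⟨j / 4, hjm⟩, x - (seam m s ⟨j / 4, hjm⟩).1, 0⟩ := by
      rw [hp]
      simp [modelStep, up, height, h5, h6]
    refine ⟨⟨by rw [hup, hkk, e3], by rw [hup, e4]; simp, by rw [hup, e4]; simpa using h8⟩, ?_⟩
    rw [hup]
    by_cases hlast : j + 1 < 4 * m
    · have h9 : seam m s ⟨j / 4, hjm⟩ = 0 := by
        unfold seam
        rw [if_neg]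
        simp only
        omega
      rw [h9] at h7
      simp [hlast, h9]
      exact h7.symm
    · have h9 : seam m s ⟨j / 4, hjm⟩ = s := by
        unfold seam
        rw [if_pos]
        simp only
        omega
      rw [h9] at h7
      simp only [hlast, h9, if_false]
      ext
      · simp
      · simp [h7]

theorem modelAction_hasWindingHolonomy (s : ℤ × ℤ) (hm : 1 ≤ m) :
    HasWindingHolonomy (modelAction m s) m s := by
  obtain ⟨ρ, hρ⟩ := exists_repAction (modelAction m s)
  refine ⟨hm, quadrant m s, quadrantGrading m s,
    fun j hj => (isGradedCorner_iff hρ).2 (quadrant_gradedRep hρ hj), ?_, ?_,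
    fun j hj => (gradedAdjacent_iff hρ).2 (quadrant_adjacentRep hρ hj), ?_, ?_⟩
  · intro i hi j hj hij
    convert Set.finite_empty
    refine Set.eq_empty_of_forall_notMem ?_
    rintro p ⟨⟨h1, h2, h3⟩, h4, h5, h6⟩
    rw [h1, Nat.mod_eq_of_lt (by omega), Nat.mod_eq_of_lt (by omega)] at h4
    rw [h2] at h5
    rw [h3] at h6
    omega
  · convert Set.finite_empty
    refine Set.eq_empty_of_forall_notMem ?_
    rintro ⟨⟨b, k, x, y⟩, hp⟩ h
    have hk := k.2
    have hdiv : ∀ r < 4, (k : ℕ) = (4 * k + r) / 4 % m := fun r hr => by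
      rw [show (4 * (k : ℕ) + r) / 4 = k by omega, Nat.mod_eq_of_lt hk]
    rcases b with _ | _
    · by_cases hx : 0 ≤ x
      · exact h (4 * k + 3) (by omega) ⟨hdiv 3 (by omega), by simp, by simp [hx]⟩
      · exact h (4 * k + 2) (by omega) ⟨hdiv 2 (by omega), by simp, by simpa using hx⟩
    · by_cases hx : 0 ≤ x
      · exact h (4 * k + 0) (by omega) ⟨hdiv 0 (by omega), by simp, by simp [hx]⟩
      · exact h (4 * k + 1) (by omega) ⟨hdiv 1 (by omega), by simp, by simpa using hx⟩
  · ext p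
    simp [quadrant]
  · intro p
    simp only [quadrantGrading, lt_irrefl, if_false, show 0 < 4 * m by omega, if_true]

end ModelHolonomy

/-! ### Invariance under near isomorphisms -/

section Invariance

variable {X : Type u} {Y : Type v} {ρ : ℤ × ℤ → X → X} {σ : ℤ × ℤ → Y → Y}
  {α : NearAction Z2 X} {β : NearAction Z2 Y}

theorem NearIsomorphic.exists_functions [Nonempty X] [Nonempty Y] (hα : RepAction ρ α)
    (hβ : RepAction σ β) (h : NearIsomorphic α β) :
    ∃ (F : X → Y) (G : Y → X), Tendsto F cofinite cofinite ∧ (∀ᶠ x in cofinite, G (F x) = x) ∧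
      (∀ᶠ y in cofinite, F (G y) = y) ∧ ∀ g, ∀ᶠ x in cofinite, F (ρ g x) = σ g (F x) := by
  obtain ⟨φ, hφ⟩ := h
  obtain ⟨F, hF⟩ := exists_represents φ
  obtain ⟨G, -, h1, h2⟩ := exists_represents_symm hF
  exact ⟨F, G, hF.tendsto, h1, h2, represents_of_intertwines hα hβ hF hφ⟩

theorem nearIsomorphic_of_functions (hα : RepAction ρ α) (hβ : RepAction σ β) (F : X → Y)
    (G : Y → X) (h1 : ∀ᶠ x in cofinite, G (F x) = x) (h2 : ∀ᶠ y in cofinite, F (G y) = y)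
    (h : ∀ e, UnitVec e → ∀ᶠ x in cofinite, F (ρ e x) = σ e (F x)) : NearIsomorphic α β := by
  obtain ⟨φ, hφ⟩ := exists_nearBij F G h1 h2
  exact ⟨φ, nearIsomorphic_of_represents hα hβ hφ h⟩

/-- The image of a development under an equivariant near injection. -/
theorem Development.map {F : X → Y} {G : Y → X} (hGF : ∀ᶠ x in cofinite, G (F x) = x)
    (h : ∀ e, UnitVec e → ∀ᶠ x in cofinite, F (ρ e x) = σ e (F x)) {c : ℕ → ℤ × ℤ → X}
    (hc : Development ρ c) : Development σ fun j v => F (c j v) where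
  chart j := by
    obtain ⟨n, hn⟩ := hc.chart j
    obtain ⟨N, hN⟩ := hn.tendsto ((eventually_unitVec h).and hGF)
    replace hn := hn.mono (le_max_left n N)
    have hN' : ∀ v ∈ halfPlane j (max n N), N ≤ ht j v := fun v hv =>
      (le_max_right n N).trans (mem_halfPlane.1 hv)
    refine ⟨max n N, fun v hv e he hve => ?_, fun v hv w hw hvw => hn.injOn hv hw ?_⟩
    · rw [← (hN v (hN' v hv)).1 e he, hn.equivariantOn v hv e he hve]
    · rw [← (hN v (hN' v hv)).2, ← (hN w (hN' w hw)).2, hvw]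
  agree j := by
    obtain ⟨n, hn⟩ := hc.agree j
    exact ⟨n, fun v hv hv' => congrArg F (hn v hv hv')⟩

/-- The part of the pull-back of `P` on which `F` is injective. -/
def pullBack (F : X → Y) (G : Y → X) (P : Set Y) : Set X := {x | G (F x) = x ∧ F x ∈ P}

theorem finite_image_diff_image_pullBack {F : X → Y} {G : Y → X}
    (h2 : ∀ᶠ y in cofinite, F (G y) = y) (P : Set Y) (f : Y → ℤ × ℤ) :
    (f '' P \ (f ∘ F) '' pullBack F G P).Finite := by
  have hfin : {y | ¬ F (G y) = y}.Finite := h2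
  refine (hfin.image f).subset ?_
  rintro _ ⟨⟨y, hy, rfl⟩, hc⟩
  refine ⟨y, fun hFG => hc ⟨G y, ⟨congrArg G hFG, ?_⟩, congrArg f hFG⟩, rfl⟩
  rwa [hFG]

theorem image_pullBack_subset (F : X → Y) (G : Y → X) (P : Set Y) (f : Y → ℤ × ℤ) :
    (f ∘ F) '' pullBack F G P ⊆ f '' P := by
  rintro _ ⟨x, hx, rfl⟩
  exact ⟨F x, hx.2, rfl⟩

theorem injOn_pullBack (F : X → Y) (G : Y → X) {P : Set Y} {f : Y → ℤ × ℤ} (hf : Set.InjOn f P) :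
    Set.InjOn (f ∘ F) (pullBack F G P) := by
  intro x hx x' hx' h
  rw [← hx.1, ← hx'.1, hf hx.2 hx'.2 h]

theorem GradedRep.pullBack {F : X → Y} {G : Y → X} {j : ℕ} {P : Set Y} {f : Y → ℤ × ℤ}
    (hρ : NearRep ρ) (h1 : ∀ᶠ x in cofinite, G (F x) = x) (h2 : ∀ᶠ y in cofinite, F (G y) = y)
    (hF : Tendsto F cofinite cofinite) (h : ∀ g, ∀ᶠ x in cofinite, F (ρ g x) = σ g (F x))
    (hP : GradedRep σ j P f) : GradedRep ρ j (pullBack F G P) (f ∘ F) where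
  injOn := injOn_pullBack F G hP.injOn
  image := by
    obtain ⟨c, hc⟩ := hP.image
    refine ⟨c, ((finite_image_diff_image_pullBack h2 P f).union hc).subset ?_⟩
    refine (symmDiff_triangle _ (f '' P) _).trans (Set.union_subset_union_left _ ?_)
    rw [Set.symmDiff_def, Set.sdiff_eq_empty.2 (image_pullBack_subset F G P f), Set.empty_union]
  step e he := by
    filter_upwards [hF.eventually (hP.step e he), h e, (hρ.tendsto e).eventually h1]
      with x h3 h4 h5 hx hxe
    obtain ⟨h6, h7⟩ := h3 hx.2 (image_pullBack_subset F G P f hxe)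
    rw [← h4] at h6 h7
    exact ⟨⟨h5, h6⟩, h7⟩

theorem AdjacentRep.pullBack {F : X → Y} {G : Y → X} {P Q : Set Y} {f g : Y → ℤ × ℤ} {e : ℤ × ℤ}
    (hρ : NearRep ρ) (h1 : ∀ᶠ x in cofinite, G (F x) = x) (h2 : ∀ᶠ y in cofinite, F (G y) = y)
    (hF : Tendsto F cofinite cofinite) (h : ∀ g, ∀ᶠ x in cofinite, F (ρ g x) = σ g (F x))
    (hf : Set.InjOn f P) (hP : AdjacentRep σ e P f Q g) :
    AdjacentRep ρ e (NearActions.pullBack F G P) (f ∘ F) (NearActions.pullBack F G Q)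
      (g ∘ F) := by
  -- few points are on the boundary of the pull-back of `P` but not on that of `P`
  have hfin : {x | x ∈ NearActions.pullBack F G P ∧
      f (F x) + e ∈ f '' P \ (f ∘ F) '' NearActions.pullBack F G P}.Finite := by
    refine Set.Finite.of_finite_image (f := fun x => f (F x) + e)
      ((finite_image_diff_image_pullBack (G := G) h2 P f).subset ?_) ?_
    · rintro _ ⟨x, hx, rfl⟩
      exact hx.2
    · intro x hx x' hx' hxx
      exact injOn_pullBack F G hf hx.1 hx'.1 (add_right_cancel hxx)
  filter_upwards [hF.eventually hP, h e, (hρ.tendsto e).eventually h1, hfin.compl_mem_cofinite]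
    with x h3 h4 h5 h6 hx hxe
  obtain ⟨h7, h8⟩ := h3 hx.2 fun hc => h6 ⟨hx, hc, hxe⟩
  rw [← h4] at h7 h8
  exact ⟨⟨h5, h7⟩, h8⟩

theorem HasWindingHolonomy.of_nearIsomorphic [Nonempty X] [Nonempty Y] {m : ℕ} {s : ℤ × ℤ}
    (hβ : HasWindingHolonomy β m s) (h : NearIsomorphic α β) : HasWindingHolonomy α m s := by
  obtain ⟨ρ, hρ⟩ := exists_repAction α
  obtain ⟨σ, hσ⟩ := exists_repAction β
  obtain ⟨F, G, hF, h1, h2, hFρ⟩ := h.exists_functions hρ hσ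
  obtain ⟨hm, P, f, h3, h4, h5, h6, h7, h8⟩ := hβ
  have h3' := fun j hj => (isGradedCorner_iff hσ).1 (h3 j hj)
  refine ⟨hm, fun j => pullBack F G (P j), fun j => f j ∘ F, fun j hj => (isGradedCorner_iff hρ).2
    ((h3' j hj).pullBack hρ.nearRep h1 h2 hF hFρ), fun i hi j hj hij => ?_, ?_, fun j hj =>
    (gradedAdjacent_iff hρ).2 (((gradedAdjacent_iff hσ).1 (h6 j hj)).pullBack hρ.nearRep h1 h2
      hF hFρ (h3' j hj).injOn), by simp only [h7], fun x => h8 (F x)⟩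
  · have h9 := hF.eventually (show ∀ᶠ y in cofinite, ¬ y ∈ P i ∩ P j by
      simpa [Filter.eventually_cofinite] using h4 i hi j hj hij)
    refine Set.Finite.subset (show {x | ¬ ¬ F x ∈ P i ∩ P j}.Finite from h9) ?_
    rintro x ⟨hx, hx'⟩
    exact not_not.2 ⟨hx.2, hx'.2⟩
  · have h9 := hF.eventually (show ∀ᶠ y in cofinite, ¬ ∀ j < 4 * m, y ∉ P j by
      simpa only [Filter.eventually_cofinite, not_not] using h5)
    have h10 := h9.and h1
    refine Set.Finite.subset h10 fun x hx hc => ?_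
    exact hc.1 fun j hj hxj => hx j hj ⟨hc.2, hxj⟩

end Invariance

/-! ### Classification -/

section Classification

variable {X : Type u} {Y : Type v} {α : NearAction Z2 X} {β : NearAction Z2 Y}
  {m n : ℕ} {s t : ℤ × ℤ}

theorem HasWindingHolonomy.unique (h : HasWindingHolonomy α m s) (h' : HasWindingHolonomy α n t) :
    m = n ∧ s = t := by
  obtain ⟨ρ, hρ⟩ := exists_repAction α
  obtain ⟨c, hc, hcm, -⟩ := h.exists_development hρ
  obtain ⟨d, hd, hdm, hcov⟩ := h'.exists_development hρ
  exact hcm.eq_of_covers hc hd hdm hcov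

theorem HasWindingHolonomy.oneEnded (h : HasWindingHolonomy α m s) : OneEnded α := by
  obtain ⟨ρ, hρ⟩ := exists_repAction α
  obtain ⟨c, hc, -, hcov⟩ := h.exists_development hρ
  exact (oneEnded_iff hρ).2 (hc.oneEndedRep hcov)

theorem HasWindingHolonomy.nearFree (h : HasWindingHolonomy α m s) : NearFree α := by
  obtain ⟨ρ, hρ⟩ := exists_repAction α
  obtain ⟨c, hc, -, hcov⟩ := h.exists_development hρ
  exact hρ.nearFree (hc.freeRep hρ.nearRep hcov)

theorem OneEnded.nonempty (h : OneEnded α) : Nonempty X := h.1.nonempty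

theorem HasWindingHolonomy.nearIsomorphic (h : HasWindingHolonomy α m s)
    (h' : HasWindingHolonomy β m s) : NearIsomorphic α β := by
  obtain ⟨ρ, hρ⟩ := exists_repAction α
  obtain ⟨σ, hσ⟩ := exists_repAction β
  obtain ⟨c, hc, hcm, -⟩ := h.exists_development hρ
  obtain ⟨d, hd, hdm, -⟩ := h'.exists_development hσ
  obtain ⟨F, G, h1, h2, h3, -⟩ := exists_nearIso_of_period ((oneEnded_iff hρ).1 h.oneEnded)
    ((oneEnded_iff hσ).1 h'.oneEnded) hc hd hcm hdm
  exact nearIsomorphic_of_functions hρ hσ F G h1 h2 h3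

theorem HasWindingHolonomy.eq_of_nearIsomorphic (h : HasWindingHolonomy α m s)
    (h' : HasWindingHolonomy β n t) (hαβ : NearIsomorphic α β) : m = n ∧ s = t :=
  have := h.oneEnded.nonempty
  have := h'.oneEnded.nonempty
  h.unique (h'.of_nearIsomorphic hαβ)

theorem exists_nearIsomorphic_modelAction (h1 : OneEnded α) (hf : NearFree α) :
    ∃ (m : ℕ) (s : ℤ × ℤ), 1 ≤ m ∧ NearIsomorphic α (modelAction m s) := by
  obtain ⟨ρ, hρ⟩ := exists_repAction α
  have h1ρ := (oneEnded_iff hρ).1 h1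
  obtain ⟨c, m, s, hc, hcm⟩ := exists_hasPeriod hρ.nearRep (hρ.freeRep hf) h1ρ
  have h' := modelAction_hasWindingHolonomy s hcm.pos
  obtain ⟨σ, hσ⟩ := exists_repAction (modelAction m s)
  obtain ⟨d, hd, hdm, -⟩ := h'.exists_development hσ
  obtain ⟨F, G, h2, h3, h4, -⟩ := exists_nearIso_of_period h1ρ ((oneEnded_iff hσ).1 h'.oneEnded)
    hc hd hcm hdm
  exact ⟨m, s, hcm.pos, nearIsomorphic_of_functions hρ hσ F G h2 h3 h4⟩

theorem hasWindingHolonomy_iff_nearIsomorphic (h1 : OneEnded α) :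
    HasWindingHolonomy α m s ↔ 1 ≤ m ∧ NearIsomorphic α (modelAction m s) := by
  constructor
  · exact fun h => ⟨h.1, h.nearIsomorphic (modelAction_hasWindingHolonomy s h.1)⟩
  · rintro ⟨hm, h⟩
    have h' := modelAction_hasWindingHolonomy s hm
    have := h1.nonempty
    have := h'.oneEnded.nonempty
    exact h'.of_nearIsomorphic h

theorem existsUnique_hasWindingHolonomy (h1 : OneEnded α) (hf : NearFree α) :
    ∃! p : ℕ × (ℤ × ℤ), HasWindingHolonomy α p.1 p.2 := by
  obtain ⟨m, s, h⟩ := exists_nearIsomorphic_modelAction h1 hf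
  refine ⟨(m, s), (hasWindingHolonomy_iff_nearIsomorphic h1).2 h, fun p hp => ?_⟩
  obtain ⟨h2, h3⟩ := hp.unique ((hasWindingHolonomy_iff_nearIsomorphic h1).2 h)
  exact Prod.ext h2 h3

end Classification

/-! ### The simply transitive action -/

theorem repAction_translationAction :
    RepAction (fun g x => Multiplicative.ofAdd g * x) translationAction :=
  fun g => represents_ofEquiv (MulAction.toPermHom Z2 Z2 (Multiplicative.ofAdd g))

/-- The development of the simply transitive action is constant. -/
theorem development_translationAction :
    Development (fun (g : ℤ × ℤ) (x : Z2) => Multiplicative.ofAdd g * x)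
      (fun _ v => Multiplicative.ofAdd v) where
  chart j := ⟨0, fun v _ e _ _ => by rw [← ofAdd_add, add_comm],
    fun _ _ _ _ h => Multiplicative.ofAdd.injective h⟩
  agree _ := ⟨0, fun _ _ _ => rfl⟩

theorem hasPeriod_const {X : Type u} (c : ℤ × ℤ → X) : HasPeriod (fun _ => c) 1 0 where
  pos := le_rfl
  shift := by simpa using Shift.refl 0 c
  minimal k h h' := absurd h' (by omega)

theorem oneEndedRep_translationAction :
    OneEndedRep (fun (g : ℤ × ℤ) (x : Z2) => Multiplicative.ofAdd g * x) := by
  refine development_translationAction.oneEndedRep (m := 1) fun N => ?_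
  refine Set.Finite.subset (s := Multiplicative.toAdd ⁻¹' {v : ℤ × ℤ | ∀ j < 4, ht j v < N}) ?_ ?_
  · refine Set.Finite.preimage Multiplicative.toAdd.injective.injOn
      (finite_of_ht 0 (n := -N) (N := N) fun v hv => ?_)
    have h0 := hv 0 (by norm_num)
    have h1 := hv 1 (by norm_num)
    have h2 := hv 2 (by norm_num)
    have h3 := hv 3 (by norm_num)
    simp only [ht_zero, ht_one, ht_two, ht_three, zero_add] at *
    omega
  · intro x hx j hj
    by_contra hc
    exact hx ⟨j, by omega, Multiplicative.toAdd x, not_lt.1 hc, rfl⟩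

theorem modelAction_one_zero_nearIsomorphic :
    NearIsomorphic (modelAction 1 0) translationAction := by
  obtain ⟨ρ, hρ⟩ := exists_repAction (modelAction 1 0)
  have h := modelAction_hasWindingHolonomy 0 le_rfl
  obtain ⟨c, hc, hcm, -⟩ := h.exists_development hρ
  obtain ⟨F, G, h1, h2, h3, -⟩ := exists_nearIso_of_period ((oneEnded_iff hρ).1 h.oneEnded)
    oneEndedRep_translationAction hc development_translationAction hcm (hasPeriod_const _)
  exact nearIsomorphic_of_functions hρ repAction_translationAction F G h1 h2 h3

/-! ### Completable near `ℤ²`-sets -/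

section Completable

variable {X : Type u} {Y : Type v} {ρ : ℤ × ℤ → X → X} {α : NearAction Z2 X}

theorem Represents.sum {F : X → X} {G : Y → Y} {φ : NearPerm X} {ψ : NearPerm Y}
    (hF : Represents F φ) (hG : Represents G ψ) :
    Represents (Sum.map F G) (NearBij.sum φ ψ) := by
  obtain ⟨f, rfl⟩ := φ.exists_mk
  obtain ⟨g, rfl⟩ := ψ.exists_mk
  change Represents _ (NearBij.mk (f.sum g))
  have h1 : {x | ¬ f.toPEquiv x = some (F x)}.Finite := hF f rfl
  have h2 : {y | ¬ g.toPEquiv y = some (G y)}.Finite := hG g rfl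
  refine represents_mk.2 (((h1.image Sum.inl).union (h2.image Sum.inr)).subset ?_)
  rintro (x | y) hx
  · refine Or.inl ⟨x, fun hc => hx ?_, rfl⟩
    change Option.map Sum.inl (f.toPEquiv x) = _
    rw [hc]
    rfl
  · refine Or.inr ⟨y, fun hc => hx ?_, rfl⟩
    change Option.map Sum.inr (g.toPEquiv y) = _
    rw [hc]
    rfl

/-- A near `ℤ²`-set that coincides with the simply transitive action through a bijection is
realizable, hence completable. -/
theorem completable_of_equiv (hρ : RepAction ρ α) (E : X ≃ Z2)
    (h : ∀ e, UnitVec e → ∀ᶠ x in cofinite, E (ρ e x) = Multiplicative.ofAdd e * E x) :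
    Completable.{u, v} α := by
  have hE := represents_ofEquiv E
  have h1 := represents_of_intertwines hρ repAction_translationAction hE
    (nearIsomorphic_of_represents hρ repAction_translationAction hE h)
  let E' : X ⊕ PEmpty.{v + 1} ≃ Z2 := (Equiv.sumEmpty X PEmpty).trans E
  let r : Z2 →* Equiv.Perm (X ⊕ PEmpty.{v + 1}) :=
    { toFun := fun g => (E'.trans (MulAction.toPerm g)).trans E'.symm
      map_one' := by ext z; simp
      map_mul' := fun g k => by ext z; simp [mul_assoc] }
  refine ⟨PEmpty, 1, r, MonoidHom.ext fun g => ?_⟩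
  have h2 : Represents (Sum.map (ρ (Multiplicative.toAdd g)) id)
      (α.sum (1 : NearAction Z2 PEmpty.{v + 1}) g) :=
    (hρ (Multiplicative.toAdd g)).sum (represents_one (X := PEmpty.{v + 1}))
  refine h2.unique (represents_ofEquiv (r g)) ?_
  have h3 := h1 (Multiplicative.toAdd g)
  refine Set.Finite.subset (Set.Finite.image Sum.inl h3) ?_
  rintro (x | x) hx
  · refine ⟨x, fun hc => hx ?_, rfl⟩
    have : E' (Sum.map (ρ (Multiplicative.toAdd g)) id (Sum.inl x)) = g * E' (Sum.inl x) := hc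
    exact (E'.symm_apply_eq.2 this.symm).symm
  · exact x.elim

/-- In a realization of `X ⊔ Y`, the half-plane `c 0` is contained in a free orbit. This orbit is a
constant development, so that `c 4` continues `c 0` as it does in the plane. -/
theorem Completable.eq_of_development (h : Completable.{u, v} α) (hρ : RepAction ρ α)
    {c : ℕ → ℤ × ℤ → X} (hc : Development ρ c) {m : ℕ} {s : ℤ × ℤ} (hm : HasPeriod c m s) :
    m = 1 ∧ s = 0 := by
  obtain ⟨Y, β, r, hr⟩ := h
  obtain ⟨σ, hσ⟩ := exists_repAction β
  let τ : ℤ × ℤ → X ⊕ Y → X ⊕ Y := fun g => r (Multiplicative.ofAdd g)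
  have hτ : ∀ g, ∀ᶠ x in cofinite, τ g (Sum.inl x) = Sum.inl (ρ g x) := by
    intro g
    have h1 : Represents (Sum.map (ρ g) (σ g)) (α.sum β (Multiplicative.ofAdd g)) :=
      (hρ g).sum (hσ g)
    rw [hr] at h1
    filter_upwards [Sum.inl_injective.tendsto_cofinite.eventually
      (h1.eventuallyEq (represents_ofEquiv (r (Multiplicative.ofAdd g))))] with x hx
    exact hx.symm
  have hadd : ∀ g k z, τ g (τ k z) = τ (k + g) z := by
    intro g k z
    simp only [τ, ofAdd_add, map_mul, Equiv.Perm.mul_apply, add_comm k g]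
  have hdev : Development τ fun j v => (Sum.inl (c j v) : X ⊕ Y) :=
    hc.map (G := Sum.elim id fun _ => c 0 0) (Eventually.of_forall fun _ => rfl)
      fun e _ => (hτ e).mono fun _ hx => hx.symm
  obtain ⟨N, hN⟩ := hdev.chart 0
  obtain ⟨v₀, hv₀, -⟩ := exists_ht_eq 0 N 0
  let d : ℤ × ℤ → X ⊕ Y := fun v => τ (v - v₀) (Sum.inl (c 0 v₀))
  have hd : ∀ v g, τ g (d v) = d (v + g) := fun v g => by
    simp only [d, hadd, sub_add_eq_add_sub]
  have hcd : ∀ v ∈ halfPlane 0 N, Sum.inl (c 0 v) = d v := by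
    refine hN.equivariantOn.eqOn (stepConnected_halfPlane 0 N) (fun v _ e _ _ => hd v e)
      (v := v₀) hv₀.ge ?_
    simp [d, τ]
  have hinj : Function.Injective d := by
    intro v w hvw
    obtain ⟨u, hu, -⟩ := exists_ht_eq 0 (max (N - ht 0 v) (N - ht 0 w)) 0
    have h1 : d (v + u) = d (w + u) := by rw [← hd, ← hd, hvw]
    have hv : v + u ∈ halfPlane 0 N := by
      rw [mem_halfPlane, ht_add, hu]
      omega
    have hw : w + u ∈ halfPlane 0 N := by
      rw [mem_halfPlane, ht_add, hu]
      omega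
    rw [← hcd _ hv, ← hcd _ hw] at h1
    exact add_right_cancel (hN.injOn hv hw h1)
  have hddev : Development τ fun _ => d :=
    ⟨fun j => ⟨0, fun v _ e _ _ => hd v e, hinj.injOn⟩, fun j => ⟨0, fun _ _ _ => rfl⟩⟩
  have h0 : Shift 0 (fun v => (Sum.inl (c 0 v) : X ⊕ Y)) d 0 :=
    ⟨N, fun v hv => by rw [add_zero]; exact hcd v hv⟩
  obtain ⟨n, hn⟩ := ((hdev.shift_add hddev rfl h0 4).congr_mod (i := 4) (j := 0) rfl).trans h0.symm
  obtain ⟨k, hk, hk'⟩ := hc.eq_of_shift hm (i := 0) (j := 4) (by omega) rfl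
    ⟨n, fun v hv => Sum.inl_injective (hn v hv)⟩
  have hmk : m * k = 1 := by omega
  obtain rfl : m = 1 := Nat.dvd_one.1 ⟨k, hmk.symm⟩
  obtain rfl : k = 1 := by omega
  exact ⟨rfl, by simpa using hk'⟩

/-- The upper and the lower halves of `X_{1,0}` form the plane. -/
def modelOneZeroEquiv : modelSet 1 0 ≃ Z2 where
  toFun p := Multiplicative.ofAdd (p.1.x, p.1.y)
  invFun g := ⟨⟨decide (0 ≤ (Multiplicative.toAdd g).2), 0, (Multiplicative.toAdd g).1,
    (Multiplicative.toAdd g).2⟩, by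
      by_cases h : 0 ≤ (Multiplicative.toAdd g).2
      · simp [modelSet, h]
      · simp [modelSet, height, seam, not_le.1 h]⟩
  left_inv := by
    rintro ⟨⟨b, k, x, y⟩, hp⟩
    obtain rfl : k = 0 := Subsingleton.elim _ _
    have hp2 : if b = true then 0 ≤ y else y < height 1 0 0 x := hp
    simp only [height, seam] at hp2
    cases b <;> simp at hp2 ⊢ <;> exact hp2
  right_inv _ := rfl

theorem completable_modelAction_one_zero : Completable.{0, v} (modelAction 1 0) := by
  obtain ⟨ρ, hρ⟩ := exists_repAction (modelAction 1 0)
  refine completable_of_equiv hρ modelOneZeroEquiv fun e he => ?_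
  filter_upwards [eventually_modelStep hρ he] with p hp
  have key : ((ρ e p).1.x, (ρ e p).1.y) = e + (p.1.x, p.1.y) := by
    rw [hp]
    obtain ⟨⟨b, k, x, y⟩, hpm⟩ := p
    obtain rfl : k = 0 := Subsingleton.elim _ _
    have hp2 : if b = true then 0 ≤ y else y < height 1 0 0 x := hpm
    have hh : ∀ k x, height 1 0 k x = 0 := by simp [height, seam]
    have hs : ∀ k, seam 1 0 k = 0 := by simp [seam]
    rw [hh] at hp2
    rcases he with rfl | rfl | rfl | rfl
    · simp [modelStep, right, add_comm]
    · simp [modelStep, left, sub_eq_add_neg, add_comm]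
    · have hu : modelStep 1 0 (0, 1) = up 1 0 := by simp [modelStep]
      simp only [hu, up, hh, hs]
      cases b <;> simp at hp2 ⊢
      · split_ifs <;> simp <;> omega
      · omega
    · have hu : modelStep 1 0 (0, -1) = down 1 0 := by simp [modelStep]
      simp only [hu, down, hs]
      cases b <;> simp at hp2 ⊢
      · omega
      · split_ifs <;> simp <;> omega
  exact congrArg Multiplicative.ofAdd key

theorem completable_modelAction_iff {m : ℕ} {s : ℤ × ℤ} (hm : 1 ≤ m) :
    Completable.{0, v} (modelAction m s) ↔ m = 1 ∧ s = 0 := by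
  constructor
  · intro h
    obtain ⟨ρ, hρ⟩ := exists_repAction (modelAction m s)
    obtain ⟨c, hc, hcm, -⟩ := (modelAction_hasWindingHolonomy s hm).exists_development hρ
    exact h.eq_of_development hρ hc hcm
  · rintro ⟨rfl, rfl⟩
    exact completable_modelAction_one_zero

end Completable

/-! ### Near automorphisms -/

section Automorphisms

variable {X : Type u} {ρ : ℤ × ℤ → X → X} {α : NearAction Z2 X} {c : ℕ → ℤ × ℤ → X} {m : ℕ}
  {s : ℤ × ℤ}

theorem range_le_nearAut (α : NearAction Z2 X) : α.range ≤ nearAut α := by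
  rintro _ ⟨g, rfl⟩
  refine Subgroup.mem_centralizer_iff.2 ?_
  rintro _ ⟨h, rfl⟩
  rw [← map_mul, ← map_mul, mul_comm]

theorem eventually_comm_of_mem_nearAut (hρ : RepAction ρ α) {f : NearPerm X} (hf : f ∈ nearAut α)
    {F : X → X} (hF : Represents F f) (g : ℤ × ℤ) :
    ∀ᶠ x in cofinite, F (ρ g x) = ρ g (F x) := by
  have h1 := hF.mul (hρ g)
  rw [← Subgroup.mem_centralizer_iff.1 hf _ ⟨_, rfl⟩] at h1
  exact h1.eventuallyEq ((hρ g).mul hF)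

/-- The near permutation `f` turns the development `c` by `k` turns and translates it by `t`. -/
def Moves (c : ℕ → ℤ × ℤ → X) (f : NearPerm X) (k : ℕ) (t : ℤ × ℤ) : Prop :=
  ∃ F, Represents F f ∧ Shift 0 (fun v => F (c 0 v)) (c (4 * k)) t

theorem Development.map_of_mem_nearAut (hρ : RepAction ρ α) (hc : Development ρ c)
    {f : NearPerm X} (hf : f ∈ nearAut α) {F : X → X} (hF : Represents F f) :
    Development ρ fun j v => F (c j v) := by
  have : Nonempty X := ⟨c 0 0⟩
  obtain ⟨G, -, hG, -⟩ := exists_represents_symm hF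
  exact hc.map hG fun e _ => eventually_comm_of_mem_nearAut hρ hf hF e

theorem Shift.of_eventuallyEq (hc : Development ρ c) {F F' : X → X} (h : F =ᶠ[cofinite] F') :
    Shift 0 (fun v => F (c 0 v)) (fun v => F' (c 0 v)) 0 := by
  obtain ⟨n, hn⟩ := hc.chart 0
  obtain ⟨N, hN⟩ := hn.tendsto h
  exact ⟨N, fun v hv => by simpa using hN v hv⟩

theorem moves_one (c : ℕ → ℤ × ℤ → X) : Moves c 1 0 0 := ⟨_, represents_one, Shift.refl 0 _⟩

theorem moves_action (hρ : RepAction ρ α) (hc : Development ρ c) (g : ℤ × ℤ) :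
    Moves c (α (Multiplicative.ofAdd g)) 0 g := by
  obtain ⟨n, hn⟩ := hc.chart 0
  exact ⟨_, hρ g, hn.exists_equivariant hρ.nearRep g⟩

theorem Moves.mul (hρ : RepAction ρ α) (hc : Development ρ c) {f f' : NearPerm X}
    (hf : f ∈ nearAut α) {k k' : ℕ} {t t' : ℤ × ℤ} (h : Moves c f k t) (h' : Moves c f' k' t') :
    Moves c (f * f') (k + k') (t + t') := by
  obtain ⟨F, hF, hs⟩ := h
  obtain ⟨F', hF', n, hn⟩ := h'
  refine ⟨_, hF.mul hF', ?_⟩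
  have h1 := (hc.map_of_mem_nearAut hρ hf hF).shift_add hc (by omega) hs (4 * k')
  rw [zero_add, ← mul_add] at h1
  have h2 : Shift 0 (fun v => F (F' (c 0 v))) (fun v => F (c (4 * k') v)) t' :=
    ⟨n, fun v hv => congrArg F (hn v hv)⟩
  rw [add_comm t t']
  exact h2.trans (h1.congr_mod (by omega))

theorem Moves.pow (hρ : RepAction ρ α) (hc : Development ρ c) {f : NearPerm X}
    (hf : f ∈ nearAut α) (h : Moves c f 1 0) (k : ℕ) : Moves c (f ^ k) k 0 := by
  induction k with
  | zero => simpa using moves_one c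
  | succ k ih => simpa [pow_succ] using ih.mul hρ hc (pow_mem hf k) h

theorem Moves.eq (hρ : RepAction ρ α) (h1 : OneEndedRep ρ) (hc : Development ρ c)
    {f f' : NearPerm X} (hf : f ∈ nearAut α) (hf' : f' ∈ nearAut α) {k : ℕ} {t : ℤ × ℤ}
    (h : Moves c f k t) (h' : Moves c f' k t) : f = f' := by
  obtain ⟨F, hF, hs⟩ := h
  obtain ⟨F', hF', hs'⟩ := h'
  refine hF.unique hF' ?_
  -- the set where `F` and `F'` coincide is commensurated, and infinite
  rcases h1.2 {x | F x = F' x} fun e _ => by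
    filter_upwards [eventually_comm_of_mem_nearAut hρ hf hF e,
      eventually_comm_of_mem_nearAut hρ hf' hF' e] with x h2 h3 (h4 : F x = F' x)
    rw [h2, h3, h4] with h2 | h2
  · obtain ⟨N, hN⟩ := hs.trans hs'.symm
    obtain ⟨n, hn⟩ := hc.chart 0
    refine absurd (Set.Finite.of_injOn (f := c 0) (s := halfPlane 0 (max n N)) ?_ ?_ h2)
      (halfPlane_infinite 0 _)
    · intro v hv
      have := hN v ((le_max_right n N).trans (mem_halfPlane.1 hv))
      rwa [add_neg_cancel, add_zero] at this
    · exact hn.injOn.mono (halfPlane_anti 0 (le_max_left n N))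
  · exact h2

theorem moves_one_period (hm : HasPeriod c m s) : Moves c 1 m s := by
  refine ⟨_, represents_one, ?_⟩
  have := hm.shift.symm
  rwa [neg_neg] at this

theorem Moves.exists_of_one (hc : Development ρ c) (hm : HasPeriod c m s) {k : ℕ} {t : ℤ × ℤ}
    (h : Moves c 1 k t) : ∃ l : ℕ, k = m * l ∧ t = l • s := by
  obtain ⟨F, hF, hs⟩ := h
  have h1 := (hs.symm.congr_mod (j := 0) rfl).trans
    (Shift.of_eventuallyEq hc (hF.eventuallyEq represents_one))
  obtain ⟨l, h2, h3⟩ := hc.eq_of_shift hm (i := 0) (j := 4 * k) (by omega) (by omega) h1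
  exact ⟨l, by omega, neg_injective (by simpa using h3)⟩

theorem exists_moves (hρ : RepAction ρ α) (hc : Development ρ c) (hm : HasPeriod c m s)
    (hcov : Covers c m) {f : NearPerm X} (hf : f ∈ nearAut α) : ∃ k t, Moves c f k t := by
  have : Nonempty X := ⟨c 0 0⟩
  obtain ⟨F, hF⟩ := exists_represents f
  have hFc := hc.map_of_mem_nearAut hρ hf hF
  obtain ⟨a, b, t, hab, h⟩ := hFc.exists_shift_of_covers hc hcov
  have hpos := hm.pos
  have h4 : a ≤ 4 * (m * a) := by nlinarith
  -- continuing up to the next multiple of the period of `c`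
  obtain ⟨l, hl⟩ : ∃ l, a + l = 4 * (m * a) := ⟨4 * (m * a) - a, by omega⟩
  obtain ⟨k, hk⟩ : ∃ k, b + l = 4 * k := ⟨(b + l) / 4, by omega⟩
  have h1 := hFc.shift_add hc hab h l
  rw [hl, hk] at h1
  obtain ⟨n, hn⟩ := hc.shift_period hm.shift 0 a
  rw [zero_add] at hn
  have h2 : Shift 0 (fun v => F (c (4 * (m * a)) v)) (fun v => F (c 0 v)) (-(a • s)) :=
    ⟨n, fun v hv => congrArg F (hn v hv)⟩
  exact ⟨k, _, F, hF, h2.symm.trans (h1.congr_mod (by omega))⟩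

/-- There is a near automorphism that turns the development by one turn. -/
theorem exists_moves_one_turn (hρ : RepAction ρ α) (h1 : OneEndedRep ρ) (hc : Development ρ c)
    (hm : HasPeriod c m s) : ∃ z ∈ nearAut α, Moves c z 1 0 := by
  have hm' : HasPeriod (fun j => c (4 * 1 + j)) m s := by
    refine ⟨hm.pos, ?_, fun k hk hkm t h => ?_⟩
    · have := hc.shift_period hm.shift 4 1
      rw [mul_one, one_smul] at this
      exact this.congr_mod (i := 4) (j := 0) rfl
    · obtain ⟨l, h2, -⟩ := hc.eq_of_shift hm (i := 4) (j := 4 * 1 + 4 * k) (by omega) (by omega)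
        (h.congr_mod (i := 0) (j := 4) rfl)
      have h3 : k = m * l := by omega
      rcases Nat.eq_zero_or_pos l with rfl | hl
      · omega
      · nlinarith
  obtain ⟨F, G, h2, h3, h4, N, hN⟩ := exists_nearIso_of_period h1 h1 hc (hc.tail 1) hm hm'
  obtain ⟨z, hz⟩ := exists_nearBij F G h2 h3
  refine ⟨z, Subgroup.mem_centralizer_iff.2 ?_, F, hz, N, fun v hv => ?_⟩
  · rintro _ ⟨g, rfl⟩
    exact (nearIsomorphic_of_represents hρ hρ hz h4 g).symm
  · rw [add_zero]
    exact hN v hv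

/-- The group of near automorphisms is generated by the image of `ℤ²` and by one turn, subject to
the relation that `m` turns amount to the translation by `-s`. -/
theorem exists_nearAut_equiv (hρ : RepAction ρ α) (hc : Development ρ c)
    (hm : HasPeriod c m s) (hcov : Covers c m) :
    ∃ e : nearAut α ≃*
        Multiplicative ((ℤ × ℤ × ℤ) ⧸ AddSubgroup.zmultiples (s.1, s.2, -(m : ℤ))),
      ∀ (a : ℤ × ℤ) (f : nearAut α), (f : NearPerm X) = α (Multiplicative.ofAdd a) →
        e f = Multiplicative.ofAdd (QuotientAddGroup.mk (a.1, a.2, 0)) := by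
  have h1 := hc.oneEndedRep hcov
  obtain ⟨z, hz, hzm⟩ := exists_moves_one_turn hρ h1 hc hm
  have hα : ∀ g, α g ∈ nearAut α := fun g => range_le_nearAut α ⟨g, rfl⟩
  have hcomm : ∀ g, Commute (α g) z := fun g => Subgroup.mem_centralizer_iff.1 hz _ ⟨g, rfl⟩
  have hmv : ∀ t (k : ℕ), Moves c (α (Multiplicative.ofAdd t) * z ^ k) k t := fun t k => by
    simpa using (moves_action hρ hc t).mul hρ hc (hα _) (hzm.pow hρ hc hz k)
  have hrel : α (Multiplicative.ofAdd s) * z ^ m = 1 :=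
    (hmv s m).eq hρ h1 hc (mul_mem (hα _) (pow_mem hz m)) (one_mem _) (moves_one_period hm)
  have hrel' : ∀ t (k : ℕ), α (Multiplicative.ofAdd t) * z ^ k = 1 →
      ∃ l : ℕ, k = m * l ∧ t = l • s := fun t k h => (h ▸ hmv t k).exists_of_one hc hm
  let ψ : Multiplicative (ℤ × ℤ × ℤ) →* nearAut α :=
    { toFun := fun p => ⟨α (Multiplicative.ofAdd ((Multiplicative.toAdd p).1,
        (Multiplicative.toAdd p).2.1)) * z ^ (-(Multiplicative.toAdd p).2.2),
        mul_mem (hα _) (zpow_mem hz _)⟩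
      map_one' := by
        apply Subtype.ext
        change α 1 * z ^ (-(0 : ℤ)) = 1
        simp
      map_mul' := fun p q => by
        apply Subtype.ext
        have : ∀ g h : Z2, ∀ k l : ℤ, α (g * h) * z ^ (-(k + l)) =
            (α g * z ^ (-k)) * (α h * z ^ (-l)) := fun g h k l => by
          rw [map_mul, neg_add, zpow_add, mul_assoc, mul_assoc, ← mul_assoc (α h),
            ((hcomm h).zpow_right (-k)).eq, mul_assoc]
        exact this
          (Multiplicative.ofAdd ((Multiplicative.toAdd p).1, (Multiplicative.toAdd p).2.1))
          (Multiplicative.ofAdd ((Multiplicative.toAdd q).1, (Multiplicative.toAdd q).2.1))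
          (Multiplicative.toAdd p).2.2 (Multiplicative.toAdd q).2.2 }
  have hψ : ∀ t : ℤ × ℤ, ∀ k : ℤ, (ψ (Multiplicative.ofAdd (t.1, t.2, k)) : NearPerm X) =
      α (Multiplicative.ofAdd t) * z ^ (-k) := fun _ _ => rfl
  have hsurj : Function.Surjective ψ := by
    rintro ⟨f, hf⟩
    obtain ⟨k, t, hk⟩ := exists_moves hρ hc hm hcov hf
    refine ⟨Multiplicative.ofAdd (t.1, t.2, -(k : ℤ)), Subtype.ext ?_⟩
    rw [hψ, neg_neg, zpow_natCast]
    exact (hmv t k).eq hρ h1 hc (mul_mem (hα _) (pow_mem hz k)) hf hk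
  let φ : (ℤ × ℤ × ℤ) →+ Additive (nearAut α) := MonoidHom.toAdditiveRight ψ
  have hφ : ∀ p, φ p = Additive.ofMul (ψ (Multiplicative.ofAdd p)) := fun _ => rfl
  have hker : AddSubgroup.zmultiples (s.1, s.2, -(m : ℤ)) = φ.ker := by
    have hnat : ∀ t : ℤ × ℤ, ∀ k : ℕ, φ (t.1, t.2, -(k : ℤ)) = 0 →
        (t.1, t.2, -(k : ℤ)) ∈ AddSubgroup.zmultiples (s.1, s.2, -(m : ℤ)) := by
      intro t k h
      have h2 : (ψ (Multiplicative.ofAdd (t.1, t.2, -(k : ℤ))) : NearPerm X) = 1 :=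
        congrArg Subtype.val (show ψ (Multiplicative.ofAdd (t.1, t.2, -(k : ℤ))) = 1 from h)
      rw [hψ, neg_neg, zpow_natCast] at h2
      obtain ⟨l, rfl, rfl⟩ := hrel' t k h2
      exact AddSubgroup.mem_zmultiples_iff.2 ⟨l, by ext <;> simp [mul_comm]⟩
    refine le_antisymm ?_ ?_
    · rw [AddSubgroup.zmultiples_le, AddMonoidHom.mem_ker]
      refine congrArg Additive.ofMul (Subtype.ext ?_)
      rw [hψ, neg_neg, zpow_natCast]
      exact hrel
    · rintro ⟨a, b, k⟩ h
      rw [AddMonoidHom.mem_ker] at h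
      obtain ⟨n, rfl | rfl⟩ := k.eq_nat_or_neg
      · have := hnat (-a, -b) n (by
          rw [← neg_eq_zero, ← map_neg]
          simpa using h)
        simpa using neg_mem this
      · exact hnat (a, b) n h
  let e := (QuotientAddGroup.quotientAddEquivOfEq hker).trans
    (QuotientAddGroup.quotientKerEquivOfSurjective φ hsurj)
  refine ⟨(AddEquiv.toMultiplicativeLeft e).symm, fun a f hf => ?_⟩
  rw [MulEquiv.symm_apply_eq]
  apply Subtype.ext
  rw [hf]
  exact ((hψ a 0).trans (by simp)).symm

end Automorphisms

/-! ### The quotient of `ℤ³` by a cyclic subgroup -/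

section Algebra

/-- Bézout's identity as an automorphism of `ℤ²`. -/
theorem exists_addEquiv_gcd (a b : ℤ) :
    ∃ T : (ℤ × ℤ) ≃+ (ℤ × ℤ), T (a, b) = (0, (Int.gcd a b : ℤ)) := by
  obtain ⟨a', b', p, q, ha, hb, hpq⟩ : ∃ a' b' p q : ℤ, a = Int.gcd a b * a' ∧
      b = Int.gcd a b * b' ∧ p * a' + q * b' = 1 := by
    rcases Nat.eq_zero_or_pos (Int.gcd a b) with h | h
    · rw [Int.gcd_eq_zero_iff] at h
      exact ⟨1, 0, 1, 0, by simp [h.1, h.2], by simp [h.2], by simp⟩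
    · obtain ⟨a', ha⟩ := Int.gcd_dvd_left a b
      obtain ⟨b', hb⟩ := Int.gcd_dvd_right a b
      refine ⟨a', b', Int.gcdA a b, Int.gcdB a b, ha, hb, ?_⟩
      have h1 := Int.gcd_eq_gcd_ab a b
      have h2 : (Int.gcd a b : ℤ) ≠ 0 := by exact_mod_cast h.ne'
      refine mul_left_cancel₀ h2 ?_
      linear_combination -h1 - Int.gcdA a b * ha - Int.gcdB a b * hb
  refine ⟨{ toFun := fun v => (-b' * v.1 + a' * v.2, p * v.1 + q * v.2)
            invFun := fun v => (-q * v.1 + a' * v.2, p * v.1 + b' * v.2)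
            left_inv := fun v => ?_
            right_inv := fun v => ?_
            map_add' := fun v w => ?_ }, ?_⟩
  · ext
    · change -q * (-b' * v.1 + a' * v.2) + a' * (p * v.1 + q * v.2) = v.1
      linear_combination v.1 * hpq
    · change p * (-b' * v.1 + a' * v.2) + b' * (p * v.1 + q * v.2) = v.2
      linear_combination v.2 * hpq
  · ext
    · change -b' * (-q * v.1 + a' * v.2) + a' * (p * v.1 + b' * v.2) = v.1
      linear_combination v.1 * hpq
    · change p * (-q * v.1 + a' * v.2) + q * (p * v.1 + b' * v.2) = v.2
      linear_combination v.2 * hpq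
  · ext
    · simp only [Prod.fst_add, Prod.snd_add]
      ring
    · simp only [Prod.fst_add, Prod.snd_add]
      ring
  · ext
    · change -b' * a + a' * b = 0
      linear_combination -b' * ha + a' * hb
    · change p * a + q * b = _
      linear_combination p * ha + q * hb + (Int.gcd a b : ℤ) * hpq

theorem exists_addEquiv_gcd_three (a b c : ℤ) :
    ∃ T : (ℤ × ℤ × ℤ) ≃+ (ℤ × ℤ × ℤ),
      T (a, b, c) = (0, 0, (Nat.gcd (Int.gcd a b) c.natAbs : ℤ)) := by
  obtain ⟨T₁, h₁⟩ := exists_addEquiv_gcd a b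
  obtain ⟨T₂, h₂⟩ := exists_addEquiv_gcd (Int.gcd a b) c
  refine ⟨((AddEquiv.prodAssoc.symm.trans (T₁.prodCongr (AddEquiv.refl ℤ))).trans
    AddEquiv.prodAssoc).trans ((AddEquiv.refl ℤ).prodCongr T₂), ?_⟩
  change ((T₁ (a, b)).1, T₂ ((T₁ (a, b)).2, c)) = _
  rw [h₁, h₂]
  rfl

theorem nonempty_quotient_addEquiv (a b c : ℤ) :
    Nonempty ((ℤ × ℤ × ℤ) ⧸ AddSubgroup.zmultiples (a, b, c) ≃+
      ℤ × ℤ × ZMod (Nat.gcd (Int.gcd a b) c.natAbs)) := by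
  obtain ⟨T, hT⟩ := exists_addEquiv_gcd_three a b c
  set g := Nat.gcd (Int.gcd a b) c.natAbs
  let φ : (ℤ × ℤ × ℤ) →+ ℤ × ℤ × ZMod g :=
    ((AddMonoidHom.id ℤ).prodMap ((AddMonoidHom.id ℤ).prodMap (Int.castAddHom (ZMod g)))).comp
      T.toAddMonoidHom
  have hφ : ∀ p, φ p = ((T p).1, (T p).2.1, ((T p).2.2 : ZMod g)) := fun _ => rfl
  have hsurj : Function.Surjective φ := by
    rintro ⟨x, y, z⟩
    obtain ⟨z, rfl⟩ := ZMod.intCast_surjective z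
    exact ⟨T.symm (x, y, z), by rw [hφ, AddEquiv.apply_symm_apply]⟩
  have hker : AddSubgroup.zmultiples (a, b, c) = φ.ker := by
    refine le_antisymm ?_ ?_
    · rw [AddSubgroup.zmultiples_le, AddMonoidHom.mem_ker, hφ, hT]
      simp
    · intro p hp
      rw [AddMonoidHom.mem_ker, hφ, Prod.mk_eq_zero, Prod.mk_eq_zero,
        ZMod.intCast_zmod_eq_zero_iff_dvd] at hp
      obtain ⟨h1, h2, k, h3⟩ := hp
      refine AddSubgroup.mem_zmultiples_iff.2 ⟨k, T.injective ?_⟩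
      rw [map_zsmul, hT]
      ext <;> simp [h1, h2, h3, mul_comm]
  exact ⟨(QuotientAddGroup.quotientAddEquivOfEq hker).trans
    (QuotientAddGroup.quotientKerEquivOfSurjective φ hsurj)⟩

/-- The image of `ℤ²` has index `m` in `ℤ³ / ⟨(a, b, -m)⟩`. -/
theorem exists_hom_zmod (a b : ℤ) (m : ℕ) :
    ∃ π : (ℤ × ℤ × ℤ) ⧸ AddSubgroup.zmultiples (a, b, -(m : ℤ)) →+ ZMod m,
      Function.Surjective π ∧ ∀ p, π p = 0 ↔ ∃ x y : ℤ, p = QuotientAddGroup.mk (x, y, 0) := by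
  let φ : (ℤ × ℤ × ℤ) →+ ZMod m := (Int.castAddHom (ZMod m)).comp
    ((AddMonoidHom.snd ℤ ℤ).comp (AddMonoidHom.snd ℤ (ℤ × ℤ)))
  have hφ : ∀ p, φ p = (p.2.2 : ZMod m) := fun _ => rfl
  have h0 : AddSubgroup.zmultiples (a, b, -(m : ℤ)) ≤ φ.ker := by
    rw [AddSubgroup.zmultiples_le, AddMonoidHom.mem_ker, hφ]
    simp
  refine ⟨QuotientAddGroup.lift _ φ h0, fun z => ?_, fun p => ?_⟩
  · obtain ⟨z, rfl⟩ := ZMod.intCast_surjective z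
    exact ⟨QuotientAddGroup.mk (0, 0, z), rfl⟩
  · induction p using QuotientAddGroup.induction_on with
    | H p =>
      rw [QuotientAddGroup.lift_mk, hφ, ZMod.intCast_zmod_eq_zero_iff_dvd]
      constructor
      · rintro ⟨k, hk⟩
        refine ⟨p.1 + k * a, p.2.1 + k * b, ?_⟩
        rw [QuotientAddGroup.eq]
        exact AddSubgroup.mem_zmultiples_iff.2 ⟨k, by ext <;> simp [hk, mul_comm]⟩
      · rintro ⟨x, y, h⟩
        rw [QuotientAddGroup.eq] at h
        obtain ⟨k, hk⟩ := AddSubgroup.mem_zmultiples_iff.1 h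
        have := congrArg (fun q : ℤ × ℤ × ℤ => q.2.2) hk
        simp at this
        exact ⟨k, by linarith⟩

/-- The torsion subgroup of `ℤ² × ℤ/g` is `ℤ/g`. -/
theorem isOfFinAddOrder_iff {g : ℕ} (hg : 0 < g) (p : ℤ × ℤ × ZMod g) :
    IsOfFinAddOrder p ↔ p.1 = 0 ∧ p.2.1 = 0 := by
  rw [isOfFinAddOrder_iff_nsmul_eq_zero]
  constructor
  · rintro ⟨n, hn, h⟩
    have h1 : n • p.1 = 0 := congrArg Prod.fst h
    have h2 : n • p.2.1 = 0 := congrArg (fun q : ℤ × ℤ × ZMod g => q.2.1) h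
    exact ⟨(smul_eq_zero.1 h1).resolve_left hn.ne', (smul_eq_zero.1 h2).resolve_left hn.ne'⟩
  · rintro ⟨h1, h2⟩
    refine ⟨g, hg, ?_⟩
    ext <;> simp [h1, h2]

theorem torsionFree_iff {g : ℕ} (hg : 0 < g) :
    (∀ p : ℤ × ℤ × ZMod g, IsOfFinAddOrder p → p = 0) ↔ g = 1 := by
  constructor
  · intro h
    have h1 := h (0, 0, 1) ((isOfFinAddOrder_iff hg _).2 ⟨rfl, rfl⟩)
    simp only [Prod.mk_eq_zero, true_and] at h1
    exact (ZMod.one_eq_zero_iff).1 h1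
  · rintro rfl p hp
    obtain ⟨h1, h2⟩ := (isOfFinAddOrder_iff hg p).1 hp
    ext
    · exact h1
    · exact h2
    · exact Subsingleton.elim (α := ZMod 1) _ _

theorem dvd_of_addEquiv {g m : ℕ} (hg : 0 < g) (hm : 0 < m)
    (e : ℤ × ℤ × ZMod m ≃+ ℤ × ℤ × ZMod g) : m ∣ g := by
  have h1 : IsOfFinAddOrder (e (0, 0, 1)) :=
    e.toAddMonoidHom.isOfFinAddOrder ((isOfFinAddOrder_iff hm _).2 ⟨rfl, rfl⟩)
  obtain ⟨h2, h3⟩ := (isOfFinAddOrder_iff hg _).1 h1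
  have h4 : g • e (0, 0, 1) = 0 := by
    ext <;> simp [h2, h3]
  rw [← map_nsmul, EmbeddingLike.map_eq_zero_iff] at h4
  simpa [ZMod.natCast_eq_zero_iff] using congrArg (fun q : ℤ × ℤ × ZMod m => q.2.2) h4

end Algebra

/-! ### The group of near automorphisms of `X_{m,s}` -/

section ModelAutomorphisms

variable {m : ℕ} {s : ℤ × ℤ}

theorem exists_nearAut_modelAction_equiv (hm : 1 ≤ m) (s : ℤ × ℤ) :
    ∃ e : nearAut (modelAction m s) ≃*
        Multiplicative ((ℤ × ℤ × ℤ) ⧸ AddSubgroup.zmultiples (s.1, s.2, -(m : ℤ))),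
      ∀ (a : ℤ × ℤ) (f : nearAut (modelAction m s)),
        (f : NearPerm (modelSet m s)) = modelAction m s (Multiplicative.ofAdd a) →
          e f = Multiplicative.ofAdd (QuotientAddGroup.mk (a.1, a.2, 0)) := by
  obtain ⟨ρ, hρ⟩ := exists_repAction (modelAction m s)
  obtain ⟨c, hc, hcm, hcov⟩ := (modelAction_hasWindingHolonomy s hm).exists_development hρ
  exact exists_nearAut_equiv hρ hc hcm hcov

theorem mul_comm_of_mem_nearAut_modelAction (hm : 1 ≤ m) (s : ℤ × ℤ)
    {a b : NearPerm (modelSet m s)} (ha : a ∈ nearAut (modelAction m s))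
    (hb : b ∈ nearAut (modelAction m s)) : a * b = b * a := by
  obtain ⟨e, -⟩ := exists_nearAut_modelAction_equiv hm s
  have : (⟨a, ha⟩ : nearAut (modelAction m s)) * ⟨b, hb⟩ = ⟨b, hb⟩ * ⟨a, ha⟩ :=
    e.injective (by rw [map_mul, map_mul, mul_comm])
  exact congrArg Subtype.val this

theorem relIndex_range_modelAction (hm : 1 ≤ m) (s : ℤ × ℤ) :
    (modelAction m s).range.relIndex (nearAut (modelAction m s)) = m := by
  obtain ⟨e, he⟩ := exists_nearAut_modelAction_equiv hm s
  obtain ⟨π, hπ, hπ0⟩ := exists_hom_zmod s.1 s.2 m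
  let ψ : nearAut (modelAction m s) →* Multiplicative (ZMod m) :=
    (AddMonoidHom.toMultiplicative π).comp e.toMonoidHom
  have hψ : ∀ f, ψ f = Multiplicative.ofAdd (π (Multiplicative.toAdd (e f))) := fun _ => rfl
  have hsurj : Function.Surjective ψ := by
    intro k
    obtain ⟨p, hp⟩ := hπ (Multiplicative.toAdd k)
    exact ⟨e.symm (Multiplicative.ofAdd p), by rw [hψ, MulEquiv.apply_symm_apply]; exact hp⟩
  have hker : (modelAction m s).range.subgroupOf (nearAut (modelAction m s)) = ψ.ker := by
    ext f
    have h1 : f ∈ ψ.ker ↔ π (Multiplicative.toAdd (e f)) = 0 := Iff.rfl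
    rw [h1, hπ0, Subgroup.mem_subgroupOf]
    constructor
    · rintro ⟨g, hg⟩
      exact ⟨(Multiplicative.toAdd g).1, (Multiplicative.toAdd g).2,
        congrArg Multiplicative.toAdd (he (Multiplicative.toAdd g) f hg.symm)⟩
    · rintro ⟨x, y, h⟩
      have h2 := he (x, y) ⟨modelAction m s (Multiplicative.ofAdd (x, y)),
        range_le_nearAut _ ⟨_, rfl⟩⟩ rfl
      rw [← show e f = Multiplicative.ofAdd (QuotientAddGroup.mk (x, y, 0)) from h] at h2
      exact ⟨_, congrArg Subtype.val (e.injective h2)⟩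
  have hcard : Nat.card (Multiplicative (ZMod m)) = m := by
    rw [Nat.card_congr Multiplicative.toAdd, Nat.card_zmod]
  rw [Subgroup.relIndex, hker, Subgroup.index_ker, MonoidHom.range_eq_top.2 hsurj,
    Subgroup.card_top, hcard]

theorem nonempty_nearAut_modelAction_equiv (hm : 1 ≤ m) (s : ℤ × ℤ) :
    Nonempty (nearAut (modelAction m s) ≃*
      Multiplicative (ℤ × ℤ × ZMod (Nat.gcd (Int.gcd s.1 s.2) m))) := by
  obtain ⟨e, -⟩ := exists_nearAut_modelAction_equiv hm s
  obtain ⟨e'⟩ := nonempty_quotient_addEquiv s.1 s.2 (-(m : ℤ))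
  rw [Int.natAbs_neg, Int.natAbs_natCast] at e'
  exact ⟨e.trans (AddEquiv.toMultiplicative e')⟩

theorem gcd_eq_one_iff (m : ℕ) (s : ℤ × ℤ) : Nat.gcd (Int.gcd s.1 s.2) m = 1 ↔
    ∀ p : ℕ, p.Prime → p ∣ m → ¬ ((p : ℤ) ∣ s.1 ∧ (p : ℤ) ∣ s.2) := by
  constructor
  · rintro h p hp hpm ⟨h1, h2⟩
    have h3 : p ∣ 1 := h ▸ Nat.dvd_gcd (Int.dvd_gcd h1 h2) hpm
    exact hp.one_lt.ne' (Nat.dvd_one.1 h3)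
  · intro h
    by_contra hc
    obtain ⟨p, hp, hpg⟩ := Nat.exists_prime_and_dvd hc
    have h1 : (p : ℤ) ∣ Int.gcd s.1 s.2 :=
      Int.natCast_dvd_natCast.2 (hpg.trans (Nat.gcd_dvd_left _ _))
    exact h p hp (hpg.trans (Nat.gcd_dvd_right _ _))
      ⟨h1.trans (Int.gcd_dvd_left _ _), h1.trans (Int.gcd_dvd_right _ _)⟩

theorem torsionFree_nearAut_modelAction_iff (hm : 1 ≤ m) (s : ℤ × ℤ) :
    (∀ f ∈ nearAut (modelAction m s), IsOfFinOrder f → f = 1) ↔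
      ∀ p : ℕ, p.Prime → p ∣ m → ¬ ((p : ℤ) ∣ s.1 ∧ (p : ℤ) ∣ s.2) := by
  obtain ⟨e⟩ := nonempty_nearAut_modelAction_equiv hm s
  rw [← gcd_eq_one_iff m, ← torsionFree_iff (Nat.gcd_pos_of_pos_right _ hm)]
  constructor
  · intro h p hp
    have h1 : IsOfFinOrder (e.symm (Multiplicative.ofAdd p)) :=
      e.symm.toMonoidHom.isOfFinOrder (isOfFinOrder_ofAdd_iff.2 hp)
    have h2 := h _ (e.symm (Multiplicative.ofAdd p)).2 (Submonoid.isOfFinOrder_coe.2 h1)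
    have h3 : e.symm (Multiplicative.ofAdd p) = 1 := Subtype.ext h2
    rw [EmbeddingLike.map_eq_one_iff] at h3
    exact h3
  · intro h f hf hfin
    have h1 : IsOfFinOrder (⟨f, hf⟩ : nearAut (modelAction m s)) :=
      Submonoid.isOfFinOrder_coe.1 hfin
    have h2 := h (Multiplicative.toAdd (e ⟨f, hf⟩))
      (isOfFinOrder_ofAdd_iff.1 (e.toMonoidHom.isOfFinOrder h1))
    have h3 : e ⟨f, hf⟩ = 1 := h2
    rw [EmbeddingLike.map_eq_one_iff] at h3
    exact congrArg Subtype.val h3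

theorem nonempty_nearAut_modelAction_equiv_prod_iff (hm : 1 ≤ m) (s : ℤ × ℤ) :
    Nonempty (nearAut (modelAction m s) ≃* Multiplicative (ℤ × ℤ × ZMod m)) ↔
      (m : ℤ) ∣ s.1 ∧ (m : ℤ) ∣ s.2 := by
  obtain ⟨e⟩ := nonempty_nearAut_modelAction_equiv hm s
  constructor
  · rintro ⟨e'⟩
    have h1 : m ∣ Nat.gcd (Int.gcd s.1 s.2) m := dvd_of_addEquiv (Nat.gcd_pos_of_pos_right _ hm) hm
      (AddEquiv.toMultiplicative.symm (e'.symm.trans e))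
    have h2 : (m : ℤ) ∣ Int.gcd s.1 s.2 :=
      Int.natCast_dvd_natCast.2 (h1.trans (Nat.gcd_dvd_left _ _))
    exact ⟨h2.trans (Int.gcd_dvd_left _ _), h2.trans (Int.gcd_dvd_right _ _)⟩
  · rintro ⟨h1, h2⟩
    rw [Nat.gcd_eq_right (Int.dvd_gcd h1 h2)] at e
    exact ⟨e⟩

end ModelAutomorphisms

end NearActions

open NearActions in
theorem mainTheorem1 :
    -- for 1-ended near `ℤ²`-sets, near free is the same as `⋆`-faithful
    (∀ (X : Type u) (α : NearAction Z2 X), OneEnded α → (NearFree α ↔ StarFaithful α)) ∧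
    -- the winding number and the additive holonomy are well-defined
    (∀ (X : Type u) (α : NearAction Z2 X), OneEnded α → NearFree α →
      ∃! p : ℕ × (ℤ × ℤ), HasWindingHolonomy α p.1 p.2) ∧
    -- they form a complete invariant
    (∀ (X : Type u) (Y : Type v) (α : NearAction Z2 X) (β : NearAction Z2 Y),
      OneEnded α → NearFree α → OneEnded β → NearFree β →
      ∀ (m n : ℕ) (s t : ℤ × ℤ), HasWindingHolonomy α m s → HasWindingHolonomy β n t →
        (NearIsomorphic α β ↔ m = n ∧ s = t)) ∧
    -- every pair `(m, s)` with `m ≥ 1` is realized, by `X_{m,s}`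
    (∀ (m : ℕ) (s : ℤ × ℤ), 1 ≤ m → OneEnded (modelAction m s) ∧ NearFree (modelAction m s) ∧
      StarFaithful (modelAction m s) ∧ HasWindingHolonomy (modelAction m s) m s) ∧
    -- every near free 1-ended near `ℤ²`-set is near isomorphic to exactly one `X_{m,s}`
    (∀ (X : Type u) (α : NearAction Z2 X), OneEnded α → NearFree α →
      ∃! p : ℕ × (ℤ × ℤ), 1 ≤ p.1 ∧ NearIsomorphic α (modelAction p.1 p.2)) ∧
    -- the `X_{m,s}` are pairwise not near isomorphic
    (∀ (m n : ℕ) (s t : ℤ × ℤ), 1 ≤ m → 1 ≤ n →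
      NearIsomorphic (modelAction m s) (modelAction n t) → m = n ∧ s = t) ∧
    -- `X_{1,0}` is the simply transitive action, and is the only completable one
    NearIsomorphic (modelAction 1 0) translationAction ∧
    (∀ (m : ℕ) (s : ℤ × ℤ), 1 ≤ m →
      (Completable.{0, w} (modelAction m s) ↔ m = 1 ∧ s = 0)) ∧
    -- the near automorphism group of `X_{m,s}`
    (∀ (m : ℕ) (s : ℤ × ℤ), 1 ≤ m →
      (∀ a ∈ nearAut (modelAction m s), ∀ b ∈ nearAut (modelAction m s), a * b = b * a) ∧
      (modelAction m s).range ≤ nearAut (modelAction m s) ∧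
      (modelAction m s).range.relIndex (nearAut (modelAction m s)) = m ∧
      (∃ e : nearAut (modelAction m s) ≃*
          Multiplicative ((ℤ × ℤ × ℤ) ⧸ AddSubgroup.zmultiples (s.1, s.2, -(m : ℤ))),
        ∀ (a : ℤ × ℤ) (f : nearAut (modelAction m s)),
          (f : NearPerm (modelSet m s)) = modelAction m s (Multiplicative.ofAdd a) →
          e f = Multiplicative.ofAdd (QuotientAddGroup.mk (a.1, a.2, 0))) ∧
      Nonempty (nearAut (modelAction m s) ≃*
        Multiplicative (ℤ × ℤ × ZMod (Nat.gcd (Int.gcd s.1 s.2) m))) ∧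
      ((∀ f ∈ nearAut (modelAction m s), IsOfFinOrder f → f = 1) ↔
        ∀ p : ℕ, p.Prime → p ∣ m → ¬ ((p : ℤ) ∣ s.1 ∧ (p : ℤ) ∣ s.2)) ∧
      (Nonempty (nearAut (modelAction m s) ≃* Multiplicative (ℤ × ℤ × ZMod m)) ↔
        (m : ℤ) ∣ s.1 ∧ (m : ℤ) ∣ s.2)) := by
  refine ⟨fun X α h1 => h1.nearFree_iff_starFaithful,
    fun X α h1 hf => existsUnique_hasWindingHolonomy h1 hf, ?_, ?_, ?_, ?_,
    modelAction_one_zero_nearIsomorphic, fun m s hm => completable_modelAction_iff hm, ?_⟩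
  · intro X Y α β _ _ _ _ m n s t hα hβ
    refine ⟨hα.eq_of_nearIsomorphic hβ, ?_⟩
    rintro ⟨rfl, rfl⟩
    exact hα.nearIsomorphic hβ
  · intro m s hm
    have h := modelAction_hasWindingHolonomy s hm
    exact ⟨h.oneEnded, h.nearFree, h.oneEnded.nearFree_iff_starFaithful.1 h.nearFree, h⟩
  · intro X α h1 hf
    simpa only [hasWindingHolonomy_iff_nearIsomorphic h1] using
      existsUnique_hasWindingHolonomy h1 hf
  · intro m n s t hm hn h
    exact (modelAction_hasWindingHolonomy s hm).eq_of_nearIsomorphic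
      (modelAction_hasWindingHolonomy t hn) h
  · intro m s hm
    exact ⟨fun a ha b hb => mul_comm_of_mem_nearAut_modelAction hm s ha hb, range_le_nearAut _,
      relIndex_range_modelAction hm s, exists_nearAut_modelAction_equiv hm s,
      nonempty_nearAut_modelAction_equiv hm s, torsionFree_nearAut_modelAction_iff hm s,
      nonempty_nearAut_modelAction_equiv_prod_iff hm s⟩
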